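/- Let $X=(X_t)_{t\ge 0}$ be a real Lévy process with Lévy triplet $(\gamma,\sigma,\Pi)$, where $\gamma\in\mathbb R$, $\sigma\ge 0$, $\Pi(\{0\})=0$ and $\int(x^2\wedge 1)\,\Pi(dx)<\infty$; that is, $\mathbb E e^{\theta X_t}=e^{t\psi(\theta)}$ for all $t\ge0$ and all purely imaginary $\theta$, with $$\psi(\theta)=\gamma\theta+\tfrac12\sigma^2\theta^2+\int_{\mathbb R}\left(e^{\theta x}-1-\theta x 1_{\{|x|<1\}}\right)\Pi(dx).$$ For $x>0$ put $$m(x)=\gamma-\int_{x\le|y|<1}y\,\Pi(dy),\qquad v(x)=\sigma^2+\int_{|y|<x}y^2\,\Pi(dy),$$ $$\overline\Pi_+(x)=\Pi(x,\infty),\quad \overline\Pi_-(x)=\Pi(-\infty,-x),\quad \overline\Pi(x)=\overline\Pi_+(x)+\overline\Pi_-(x).$$ Write $f\in RV_\rho$ if $f$ is positive and measurable on $(0,\delta)$ for some $\delta>0$ and $f(x\varepsilon)/f(\varepsilon)\to x^\rho$ as $\varepsilon\downarrow0$ for every $x>0$. Call $X$ b.v. if almost all its paths have bounded variation on compacts;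 then $\int_{|x|<1}|x|\,\Pi(dx)<\infty$ and we put $\gamma'=\gamma-\int_{|x|<1}x\,\Pi(dx)$. A scaling function is a function $\varepsilon\mapsto a_\varepsilon>0$, $\varepsilon>0$. We say that $X$ is attracted to a Lévy process $\widehat X$ with Lévy exponent $\widehat\psi$, with the scaling function $a_\varepsilon$, if $\varepsilon\psi(\theta/a_\varepsilon)\to\widehat\psi(\theta)$ as $\varepsilon\downarrow0$ for all purely imaginary $\theta$; and that $X$ is attracted to $\widehat X$ if this holds for some scaling function. In each of the following cases, $X$ is attracted to $\widehat X$ if and only if the stated conditions hold, and $X$ is attracted to $\widehat X$ with a given scaling function $a_\varepsilon$ if and only if the conditions hold and $a_\varepsilon$ satisfies the stated asymptotic relation as $\varepsilon\downarrow0$ (where $\sim$ means that the ratio tends to $1$). (i) $\widehat X$ is the Brownian motion with variance $\widehat\sigma^2$, $\widehat\sigma>0$ (so $\widehat\psi(\theta)=\widehat\sigma^2\theta^2/2$). Condition: $v\in RV_0$. This condition is equivalent to: $v(x)>0$ for all small $x>0$ and $x^2\overline\Pi(x)/v(x)\to0$ as $x\downarrow0$. Scaling: $a_\varepsilon^2/v(a_\varepsilon)\sim\varepsilon/\widehat\sigma^2$.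 (ii) $\widehat X_t=\widehat\gamma t$ with $\widehat\gamma\ne0$. Conditions: $\sigma=0$, $m(x)/\widehat\gamma>0$ for all small $x>0$, and $x\overline\Pi(x)/m(x)\to0$ as $x\downarrow0$. Scaling: $a_\varepsilon/m(a_\varepsilon)\sim\varepsilon/\widehat\gamma$. (iii) $\widehat X$ is the strictly $\alpha$-stable process, $\alpha\in(0,2)$, with parameters $\widehat c_+,\widehat c_-\ge0$, $\widehat c_++\widehat c_->0$ and $\widehat\gamma\in\mathbb R$, where $\widehat\gamma=(\widehat c_+-\widehat c_-)/(1-\alpha)$ if $\alpha\ne1$ and $\widehat c_+=\widehat c_-$ if $\alpha=1$; its Lévy triplet is $(\widehat\gamma,0,\widehat\Pi)$ with $\widehat\Pi(dx)=1_{\{x>0\}}\widehat c_+x^{-1-\alpha}dx+1_{\{x<0\}}\widehat c_-|x|^{-1-\alpha}dx$. Conditions: (a) $\sigma=0$, and $\gamma'=0$ if $X$ is b.v.; (b) $\overline\Pi_+\in RV_{-\alpha}$ if $\widehat c_+>0$, $\overline\Pi_-\in RV_{-\alpha}$ if $\widehat c_->0$, and $\overline\Pi_+(x)/\overline\Pi_-(x)\to\widehat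 c_+/\widehat c_-$ in $[0,\infty]$ as $x\downarrow0$ (with $c/0=\infty$ for $c>0$); (c) if $\alpha=1$, additionally $m(x)/(x\overline\Pi_+(x))\to\widehat\gamma/\widehat c_+$ as $x\downarrow0$. Scaling: $\overline\Pi_+(a_\varepsilon)\sim\varepsilon^{-1}\widehat c_+/\alpha$ if $\widehat c_+>0$, and $\overline\Pi_-(a_\varepsilon)\sim\varepsilon^{-1}\widehat c_- /\alpha$ if $\widehat c_->0$. -/

import Mathlib

open MeasureTheory ProbabilityTheory Filter Set
open scoped Topology NNReal ENNReal Asymptotics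

namespace ZoomingIn

noncomputable section

/-- A real-valued Lévy process on `[0, ∞)`: it starts at `0`, has independent and stationary
increments, and almost all its paths are right-continuous with left limits. -/
structure IsLevyProcess {Ω : Type*} [MeasurableSpace Ω] (P : Measure Ω) (X : ℝ≥0 → Ω → ℝ) :
    Prop where
  measurable : ∀ t, Measurable (X t)
  zero : ∀ᵐ ω ∂P, X 0 ω = 0
  indep_increments : HasIndepIncrements X P
  stationary : ∀ s t, IdentDistrib (fun ω => X (s + t) ω - X s ω) (X t) P P
  cadlag : ∀ᵐ ω ∂P, ∀ t, ContinuousWithinAt (fun s => X s ω) (Ici t) t ∧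
    ∃ l, Tendsto (fun s => X s ω) (𝓝[<] t) (𝓝 l)

/-- `X` is a b.v. process: almost all paths are of bounded variation on compact intervals. -/
def IsBVProcess {Ω : Type*} [MeasurableSpace Ω] (P : Measure Ω) (X : ℝ≥0 → Ω → ℝ) : Prop :=
  ∀ᵐ ω ∂P, LocallyBoundedVariationOn (fun t => X t ω) univ

/-- `ν` is a Lévy measure: it does not charge `0` and `∫ (x² ∧ 1) ν(dx) < ∞`. -/
def IsLevyMeasure (ν : Measure ℝ) : Prop :=
  ν {0} = 0 ∧ ∫⁻ x, ENNReal.ofReal (min (x ^ 2) 1) ∂ν < ∞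

/-- The Lévy exponent of the triplet `(γ, σ, ν)`, given by the Lévy-Khintchine formula
`γ θ + σ² θ² / 2 + ∫ (e^{θ x} - 1 - θ x 1_{|x| < 1}) ν(dx)`.
It is used at purely imaginary `θ`. -/
def levyExponent (γ σ : ℝ) (ν : Measure ℝ) (θ : ℂ) : ℂ :=
  γ * θ + (σ : ℂ) ^ 2 * θ ^ 2 / 2 +
    ∫ x : ℝ, (Complex.exp (θ * x) - 1 - if |x| < 1 then θ * x else 0) ∂ν

/-- `X` has the Lévy triplet `(γ, σ, ν)`: `E e^{θ X_t} = e^{t ψ(θ)}` for all `t ≥ 0` and all purely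
imaginary `θ`, where `ψ` is the Lévy exponent of the triplet. -/
structure HasLevyTriplet {Ω : Type*} [MeasurableSpace Ω] (P : Measure Ω) (X : ℝ≥0 → Ω → ℝ)
    (γ σ : ℝ) (ν : Measure ℝ) : Prop where
  sigma_nonneg : 0 ≤ σ
  levyMeasure : IsLevyMeasure ν
  exponent : ∀ (t : ℝ≥0) (u : ℝ),
    ∫ ω, Complex.exp (u * Complex.I * X t ω) ∂P =
      Complex.exp ((t : ℝ) * levyExponent γ σ ν (u * Complex.I))

/-- The drift `γ'` when `∫_{|x| < 1} |x| ν(dx) < ∞`, so that the Lévy exponent equals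
`γ' θ + σ² θ² / 2 + ∫ (e^{θ x} - 1) ν(dx)`. -/
def bvDrift (γ : ℝ) (ν : Measure ℝ) : ℝ := γ - ∫ x in {x : ℝ | |x| < 1}, x ∂ν

/-- The truncated mean `m(x) = γ - ∫_{x ≤ |y| < 1} y ν(dy)`. -/
def truncMean (γ : ℝ) (ν : Measure ℝ) (x : ℝ) : ℝ :=
  γ - ∫ y in {y : ℝ | x ≤ |y| ∧ |y| < 1}, y ∂ν

/-- The truncated variance `v(x) = σ² + ∫_{|y| < x} y² ν(dy)`. -/
def truncVar (σ : ℝ) (ν : Measure ℝ) (x : ℝ) : ℝ :=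
  σ ^ 2 + ∫ y in {y : ℝ | |y| < x}, y ^ 2 ∂ν

/-- The right tail `ν (x, ∞)`, finite for `x > 0`. -/
def tailPos (ν : Measure ℝ) (x : ℝ) : ℝ := (ν (Ioi x)).toReal

/-- The left tail `ν (-∞, -x)`, finite for `x > 0`. -/
def tailNeg (ν : Measure ℝ) (x : ℝ) : ℝ := (ν (Iio (-x))).toReal

/-- The two-sided tail. -/
def tail (ν : Measure ℝ) (x : ℝ) : ℝ := tailPos ν x + tailNeg ν x

/-- `f ∈ RV_ρ`: `f` is positive and measurable on some `(0, δ)`, and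
`f (x ε) / f ε → x ^ ρ` as `ε ↓ 0` for every `x > 0`. -/
def RegVaryingAtZero (ρ : ℝ) (f : ℝ → ℝ) : Prop :=
  (∃ δ > 0, (∀ x ∈ Ioo 0 δ, 0 < f x) ∧ Measurable (fun x : Ioo (0 : ℝ) δ => f x)) ∧
    ∀ x > 0, Tendsto (fun ε => f (x * ε) / f ε) (𝓝[>] 0) (𝓝 (x ^ ρ))

/-- `ε ψ(θ / a_ε) → ψ'(θ)` as `ε ↓ 0` for all purely imaginary `θ`. -/
def ZoomsInTo (ψ ψ' : ℂ → ℂ) (a : ℝ → ℝ) : Prop :=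
  ∀ u : ℝ, Tendsto (fun ε : ℝ => (ε : ℂ) * ψ (u * Complex.I / a ε)) (𝓝[>] 0)
    (𝓝 (ψ' (u * Complex.I)))

/-- A (strictly positive) scaling function `a_ε`, `ε > 0`. -/
def IsScaling (a : ℝ → ℝ) : Prop := ∀ ε > 0, 0 < a ε

/-- The process with Lévy exponent `ψ` is attracted, under zooming in, to the one with Lévy
exponent `ψ'`, for some scaling function. -/
def IsAttractedTo (ψ ψ' : ℂ → ℂ) : Prop := ∃ a, IsScaling a ∧ ZoomsInTo ψ ψ' a

/-- The Lévy measure `1_{x > 0} c₊ x^{-1-α} dx + 1_{x < 0} c₋ |x|^{-1-α} dx`. -/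
def stableLevyMeasure (α cpos cneg : ℝ) : Measure ℝ :=
  volume.withDensity fun x => ENNReal.ofReal
    (if 0 < x then cpos * x ^ (-1 - α) else if x < 0 then cneg * |x| ^ (-1 - α) else 0)

/-- `(α, c₊, c₋, γ)` are the parameters of a strictly `α`-stable Lévy process, `α ∈ (0, 2)`, that
is, of the process with the triplet `(γ, 0, stableLevyMeasure α c₊ c₋)`. -/
structure IsStrictlyStableParam (α cpos cneg γ : ℝ) : Prop where
  alpha_pos : 0 < α
  alpha_lt_two : α < 2
  cpos_nonneg : 0 ≤ cpos
  cneg_nonneg : 0 ≤ cneg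
  sum_pos : 0 < cpos + cneg
  gamma_eq : α ≠ 1 → γ = (cpos - cneg) / (1 - α)
  symmetric : α = 1 → cpos = cneg

/-- The conditions for attraction to the strictly `α`-stable process with parameters
`c₊`, `c₋`, `γ'` (here `γhat`). The quotient of the tails takes values in `[0, ∞]`. -/
structure StableConditions {Ω : Type*} [MeasurableSpace Ω] (P : Measure Ω) (X : ℝ≥0 → Ω → ℝ)
    (γ σ : ℝ) (ν : Measure ℝ) (α cpos cneg γhat : ℝ) : Prop where
  sigma_eq_zero : σ = 0
  drift_eq_zero : IsBVProcess P X → bvDrift γ ν = 0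
  regVarying_pos : 0 < cpos → RegVaryingAtZero (-α) (tailPos ν)
  regVarying_neg : 0 < cneg → RegVaryingAtZero (-α) (tailNeg ν)
  balance : Tendsto (fun x => ν (Ioi x) / ν (Iio (-x))) (𝓝[>] 0)
    (𝓝 (ENNReal.ofReal cpos / ENNReal.ofReal cneg))
  mean_of_alpha_eq_one : α = 1 →
    Tendsto (fun x => truncMean γ ν x / (x * tailPos ν x)) (𝓝[>] 0) (𝓝 (γhat / cpos))

end

end ZoomingIn

/-!
# Zooming in on Lévy processes

Write `f u = ψ(iu)` for the Lévy exponent of `X` and `g` for that of the limit; `g` is homogeneous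
of some order `α > 0`, with `α = 2` for Brownian motion and `α = 1` for a linear drift.

*Space as the free variable.* Attraction says `ε f (u / a_ε) → g u`, where the scaling function is
unknown. It is equivalent to the existence of a time scale `e z > 0` with `e z f (u / z) → g u` as
`z ↓ 0`, and the given `a` works exactly when `a_ε → 0` and `e (a_ε) ∼ ε`. The point is that `a`
need not be monotone or continuous, so that it may miss most values of `z`. But `f` is
quasi-additive: `f (u + h) - f u - f h` is controlled by `f u` and `f h`. Baire's theorem then turns
pointwise convergence into locally uniform convergence (`equicontinuous_zero`), which shows that
`a` shrinks at most by a bounded factor when `ε` is halved. So every small `z` is comparable to some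
`a_ε`, and the limit, being locally uniform, carries over from `a_ε` to `z`
(`TendsToAlong.exists_tendsToUnder`; conversely `TendsToUnder.exists_scaling`). Each of the three
criteria is thereby reduced to finding the right `e` in terms of `v`, `m` or the tails
(`attraction_criterion`).

*Zooming acts on triplets.* The function `u ↦ e f (u / z)` is the exponent of the triplet with
drift `e m(z) / z`, Gaussian coefficient `√e σ / z`, and Lévy measure `e` times the image of `ν`
under `y ↦ y / z` (`charExp_zoom`). So one has to understand the convergence of triplets.

*Necessity.* The function `f u - ½ ∫ f (u + s) ds` over `s ∈ [-1, 1]` is the characteristic function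
of the finite measure `(1 - sinc x) ν(dx) + σ² / 6 δ₀`, called `levyK`. By Lévy's continuity theorem
convergence of the exponents makes these measures converge weakly, so that the integrals
`∫ h dν` of test functions of order `x² ∧ 1` converge (`tendsto_integral_of_charExp`). Taking for
`h` indicators of half-lines, or `y²` cut off, gives the limits of `e z Π̄±(z x)` and of
`e z v(z x) / z²`; the limit of `e z m(z) / z` follows by subtraction. All the conditions are
read off from these three limits.

*Sufficiency.* Everything is obtained by comparing the scales `z` and `2 z`. In the Brownian case
the normalized tail `r z = z² Π̄(z) / v(z)` satisfies `r z ≤ q r (2 z) + o(1)` with `q < 1`, and hence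
tends to zero (`tendsto_zero_of_tendsto_contraction`); the same works for the mean. In the drift
case the condition forces `m(z / 2) / m(z)` to be nearly `1`, so that the second moments of dyadic
shells are dominated by a geometric series with a sum of smaller order than `z m(z)`
(`IsLevyMeasure.lintegral_pow_le`). All parts of the zoomed triplet but one then vanish in the limit
(`tendsToUnder_gaussian`, `tendsToUnder_drift`). In the stable case regular variation gives the
convergence of the tails, and again a geometric series controls the small jumps, so the integrals
converge as well (`TailsTendTo.tendsto_integral`). What remains is the mean `m(z)`. For `α > 1` its
deviation from the expected value contracts along halving; for `α = 1` its limit is assumed; for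
`α < 1` the jumps are summable, and `m(z) = γ' + ∫_{|y| < z} y ν(dy)` has the right order exactly if
`γ' = 0`.

*Bounded variation.* The condition on `γ'` speaks of the paths of `X`, and so requires that for
`σ = 0` the paths have bounded variation if and only if the small jumps are summable
(`isBVProcess_iff`). The bridge between the two is the identity
`1 - e^{-|y|} = ∫ (1 - cos (s y)) c(ds)` for the Cauchy distribution `c`, which expresses both
`E (1 - e^{-λ |X_t|})` and `∫ (1 - e^{-λ |x|}) ν(dx)` through the exponent; up to a drift term the former is `t` times the
latter. Since increments are independent and stationary, the Laplace transform of the variation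
along a grid with mesh `1 / n` is a power of `E e^{-|X_{1/n}|}`. Bounded variation keeps it away
from zero, which bounds `n E (1 - e^{-|X_{1/n}|})`. Conversely, for small `λ` the sum over the grid
of the expectations `E (1 - e^{-λ |X_{1/n}|})` is small uniformly in `n`, so that almost surely the
variation does not escape to infinity as the grid is refined.
-/

namespace ZoomingIn

section

/-! ### Recursions along doubling -/

/-- Every small `z > 0` lies in a dyadic shell below a given level. -/
lemma exists_dyadic_shell {d z : ℝ} (hz : 0 < z) (hzd : z ≤ d) :
    ∃ n : ℕ, 2 ^ n * z ≤ d ∧ d < 2 ^ (n + 1) * z := by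
  obtain ⟨n, h1, h2⟩ := exists_nat_pow_near (one_le_div hz |>.2 hzd) (one_lt_two (α := ℝ))
  exact ⟨n, (le_div_iff₀ hz).1 h1, (div_lt_iff₀ hz).1 h2⟩

/-- A function that is bounded above on compact subsets of `(0, d₀]` and contracts, up to an
additive error `η`, when its argument is halved, has upper limit at most `η / (1 - q)` at `0`. -/
lemma eventually_le_of_contraction {r : ℝ → ℝ} {q η κ d₀ : ℝ} (hq0 : 0 ≤ q) (hq1 : q < 1)
    (hη : 0 ≤ η) (hκ : η / (1 - q) < κ) (hd : 0 < d₀)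
    (hb : ∀ a ∈ Ioo 0 d₀, ∃ C, ∀ z ∈ Icc a d₀, r z ≤ C)
    (hr : ∀ᶠ z in 𝓝[>] 0, r z ≤ q * r (2 * z) + η) : ∀ᶠ z in 𝓝[>] 0, r z ≤ κ := by
  obtain ⟨d₁, hd₁, hr⟩ := (mem_nhdsGT_iff_exists_Ioo_subset).1 hr
  simp only [mem_Ioi] at hd₁
  set d := min d₀ d₁ / 2 with hdd
  have hm : 0 < min d₀ d₁ := lt_min hd hd₁
  have hd0 : 0 < d := by positivity
  have hdd₀ : d < d₀ := by have := min_le_left d₀ d₁; linarith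
  have hdd₁ : d < d₁ := by have := min_le_right d₀ d₁; linarith
  obtain ⟨C', hC'⟩ := hb (d / 2) ⟨by positivity, by linarith⟩
  set C := max C' 0
  have hC0 : 0 ≤ C := le_max_right _ _
  have h1q : 0 < 1 - q := by linarith
  -- iterate the contraction `n` times, from the dyadic shell of `z` up to `(d / 2, d]`
  have key : ∀ n : ℕ, ∀ z, 0 < z → 2 ^ n * z ≤ d → d < 2 ^ (n + 1) * z →
      r z ≤ q ^ n * C + η / (1 - q) := by
    intro n
    induction n with
    | zero =>
      intro z hz h1 h2
      have h3 : r z ≤ C := (hC' z ⟨by simp at h2; linarith, by simp at h1; linarith⟩).trans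
        (le_max_left _ _)
      have : 0 ≤ η / (1 - q) := by positivity
      simp only [pow_zero, one_mul]; linarith
    | succ n ih =>
      intro z hz h1 h2
      have hzd : z ≤ d := by
        have : (1 : ℝ) ≤ 2 ^ (n + 1) := one_le_pow₀ (by norm_num)
        nlinarith
      have h3 := hr (show z ∈ Ioo 0 d₁ from ⟨hz, by linarith⟩)
      have h4 := ih (2 * z) (by positivity) (by rw [pow_succ] at h1; linarith)
        (by rw [pow_succ] at h2; linarith)
      simp only [mem_ofPred_eq] at h3
      calc r z ≤ q * (q ^ n * C + η / (1 - q)) + η := by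
            have := mul_le_mul_of_nonneg_left h4 hq0; linarith
        _ = q ^ (n + 1) * C + η / (1 - q) := by field_simp; ring
  have hlim : Tendsto (fun n : ℕ => q ^ n * C + η / (1 - q)) atTop (𝓝 (0 * C + η / (1 - q))) :=
    ((tendsto_pow_atTop_nhds_zero_of_lt_one hq0 hq1).mul_const C).add_const _
  rw [zero_mul, zero_add] at hlim
  obtain ⟨N, hN⟩ := eventually_atTop.1 (hlim.eventually (gt_mem_nhds hκ))
  have hs : Ioo 0 (d / 2 ^ N) ∈ 𝓝[>] (0 : ℝ) := Ioo_mem_nhdsGT (by positivity)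
  filter_upwards [hs] with z hz
  have h2N : (0 : ℝ) < 2 ^ N := by positivity
  have hzN : z * 2 ^ N < d := (lt_div_iff₀ h2N).1 hz.2
  have h1N : (1 : ℝ) ≤ 2 ^ N := one_le_pow₀ (by norm_num)
  obtain ⟨n, h1, h2⟩ := exists_dyadic_shell hz.1 (show z ≤ d by nlinarith [hz.1])
  have hn : N ≤ n := by
    by_contra hlt
    have : (2 : ℝ) ^ (n + 1) ≤ 2 ^ N := pow_le_pow_right₀ (by norm_num) (by omega)
    nlinarith [hz.1]
  exact (key n z hz.1 h1 h2).trans (hN n hn).le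

/-- The version of `eventually_le_of_contraction` with asymptotically constant coefficients. -/
lemma eventually_le_of_tendsto_contraction {r q η : ℝ → ℝ} {q₀ η₀ κ d₀ : ℝ} (hq0 : 0 ≤ q₀)
    (hq1 : q₀ < 1) (hη : 0 ≤ η₀) (hκ : η₀ / (1 - q₀) < κ) (hd : 0 < d₀)
    (hb : ∀ a ∈ Ioo 0 d₀, ∃ C, ∀ z ∈ Icc a d₀, r z ≤ C)
    (hq : Tendsto q (𝓝[>] 0) (𝓝 q₀)) (hη' : Tendsto η (𝓝[>] 0) (𝓝 η₀))
    (hr0 : ∀ᶠ z in 𝓝[>] 0, 0 ≤ r z)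
    (hr : ∀ᶠ z in 𝓝[>] 0, r z ≤ q z * r (2 * z) + η z) : ∀ᶠ z in 𝓝[>] 0, r z ≤ κ := by
  have hc : Tendsto (fun t : ℝ => (η₀ + t) / (1 - (q₀ + t))) (𝓝[>] 0) (𝓝 (η₀ / (1 - q₀))) := by
    have : ContinuousAt (fun t : ℝ => (η₀ + t) / (1 - (q₀ + t))) 0 :=
      ContinuousAt.div (by fun_prop) (by fun_prop) (by simp; linarith)
    simpa using this.tendsto.mono_left nhdsWithin_le_nhds
  obtain ⟨t, ht1, ht2, ht3⟩ := ((hc.eventually (gt_mem_nhds hκ)).and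
    (Ioo_mem_nhdsGT (show (0 : ℝ) < 1 - q₀ by linarith))).exists
  refine eventually_le_of_contraction (q := q₀ + t) (η := η₀ + t) (by linarith) (by linarith)
    (by linarith) ht1 hd hb ?_
  have h2 : Tendsto (fun z : ℝ => 2 * z) (𝓝[>] 0) (𝓝[>] 0) := by
    refine tendsto_nhdsWithin_iff.2 ⟨?_, ?_⟩
    · have : Tendsto (fun z : ℝ => 2 * z) (𝓝 0) (𝓝 (2 * 0)) := (continuous_const_mul 2).tendsto 0
      rw [mul_zero] at this
      exact this.mono_left nhdsWithin_le_nhds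
    · filter_upwards [self_mem_nhdsWithin] with z hz
      simpa using hz
  filter_upwards [hr, hq.eventually (gt_mem_nhds (show q₀ < q₀ + t by linarith)),
    hη'.eventually (gt_mem_nhds (show η₀ < η₀ + t by linarith)), h2.eventually hr0] with z h1 h2 h3 h4
  nlinarith

/-- A nonnegative function that contracts along halving, up to an error tending to zero, tends to
zero. -/
lemma tendsto_zero_of_tendsto_contraction {r q η : ℝ → ℝ} {q₀ d₀ : ℝ} (hq0 : 0 ≤ q₀)
    (hq1 : q₀ < 1) (hd : 0 < d₀)
    (hb : ∀ a ∈ Ioo 0 d₀, ∃ C, ∀ z ∈ Icc a d₀, r z ≤ C)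
    (hq : Tendsto q (𝓝[>] 0) (𝓝 q₀)) (hη' : Tendsto η (𝓝[>] 0) (𝓝 0))
    (hr0 : ∀ᶠ z in 𝓝[>] 0, 0 ≤ r z)
    (hr : ∀ᶠ z in 𝓝[>] 0, r z ≤ q z * r (2 * z) + η z) : Tendsto r (𝓝[>] 0) (𝓝 0) := by
  rw [tendsto_order]
  refine ⟨fun a ha => hr0.mono fun z hz => ha.trans_le hz, fun a ha => ?_⟩
  refine (eventually_le_of_tendsto_contraction (κ := a / 2) hq0 hq1 le_rfl (by simpa using ha) hd
    hb hq hη' hr0 hr).mono fun z hz => by linarith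

lemma tendsto_const_mul_nhdsGT_zero {c : ℝ} (hc : 0 < c) :
    Tendsto (fun z : ℝ => c * z) (𝓝[>] 0) (𝓝[>] 0) := by
  refine tendsto_nhdsWithin_iff.2 ⟨?_, ?_⟩
  · have : Tendsto (fun z : ℝ => c * z) (𝓝 0) (𝓝 (c * 0)) := (continuous_const_mul c).tendsto 0
    rw [mul_zero] at this
    exact this.mono_left nhdsWithin_le_nhds
  · filter_upwards [self_mem_nhdsWithin] with z hz
    exact mul_pos hc hz

/-! ### Quasi-additive functions and locally uniform convergence -/

/-- The increments of `f` are controlled by `f` itself, as is the case for every Lévy exponent.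
The last field is the square-root bound `‖f (u + h) - f u - f h‖ ≤ 2 (‖f u‖ ‖f h‖) ^ (1/2)`
in a form without roots. -/
structure IsQuasiAdditive (f : ℝ → ℂ) : Prop where
  continuous : Continuous f
  map_zero : f 0 = 0
  norm_neg : ∀ u, ‖f (-u)‖ = ‖f u‖
  norm_add_sub : ∀ u h δ : ℝ, 0 < δ → ‖f (u + h) - f u - f h‖ ≤ δ * ‖f u‖ + δ⁻¹ * ‖f h‖

lemma IsQuasiAdditive.rescale {f : ℝ → ℂ} (hf : IsQuasiAdditive f) {e : ℝ} (he : 0 ≤ e) (z : ℝ) :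
    IsQuasiAdditive (fun u => (e : ℂ) * f (u / z)) where
  continuous := by have := hf.continuous; fun_prop
  map_zero := by simp [hf.map_zero]
  norm_neg u := by simp only [norm_mul, neg_div, hf.norm_neg]
  norm_add_sub u h δ hδ := by
    have := hf.norm_add_sub (u / z) (h / z) δ hδ
    rw [add_div, ← mul_sub, ← mul_sub, norm_mul, norm_mul, norm_mul, Complex.norm_real,
      Real.norm_of_nonneg he]
    calc _ ≤ e * (δ * ‖f (u / z)‖ + δ⁻¹ * ‖f (h / z)‖) := by gcongr
      _ = _ := by ring

/-- Baire's theorem turns pointwise convergence into equicontinuity at `0`. -/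
lemma equicontinuous_zero {ι : Type*} {l : Filter ι} [l.IsCountablyGenerated] {f : ι → ℝ → ℂ}
    {g : ℝ → ℂ} (hf : ∀ᶠ i in l, IsQuasiAdditive (f i)) (hg : Continuous g) (hg0 : g 0 = 0)
    (h : ∀ u, Tendsto (fun i => f i u) l (𝓝 (g u))) {η : ℝ} (hη : 0 < η) :
    ∃ δ > 0, ∀ᶠ i in l, ∀ u, |u| < δ → ‖f i u‖ ≤ η := by
  obtain ⟨B, hB⟩ := l.exists_antitone_basis
  obtain ⟨δ, hδ, hgδ⟩ : ∃ δ > 0, ∀ u, |u| < δ → ‖g u‖ < η / 4 := by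
    have := Metric.continuous_iff.1 hg 0 (η / 4) (by positivity)
    simpa [hg0] using this
  set A : ℕ → Set ℝ := fun N => {u | ∀ i ∈ B N, IsQuasiAdditive (f i) → ‖f i u‖ ≤ η / 4} with hA
  -- the complement of `(-δ, δ)` is added, so that the closed sets cover the line
  have hclosed : ∀ N, IsClosed (A N ∪ {u | δ ≤ |u|}) := by
    intro N
    refine IsClosed.union ?_ (isClosed_le continuous_const continuous_abs)
    have : A N = ⋂ i ∈ B N, ⋂ _ : IsQuasiAdditive (f i), {u | ‖f i u‖ ≤ η / 4} := by
      ext u; simp [hA]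
    rw [this]
    exact isClosed_biInter fun i _ => isClosed_iInter fun hi =>
      isClosed_le hi.continuous.norm continuous_const
  have hcover : ⋃ N, (A N ∪ {u | δ ≤ |u|}) = univ := by
    refine eq_univ_of_forall fun u => ?_
    by_cases hu : δ ≤ |u|
    · exact mem_iUnion.2 ⟨0, Or.inr hu⟩
    · have h1 := (h u).norm.eventually (gt_mem_nhds (hgδ u (not_le.1 hu)))
      obtain ⟨N, -, hN⟩ := hB.1.eventually_iff.1 h1
      exact mem_iUnion.2 ⟨N, Or.inl fun i hi _ => (hN hi).le⟩
  have hdense := dense_iUnion_interior_of_closed hclosed hcover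
  obtain ⟨u₀, hu₀, hu₀'⟩ := hdense.inter_open_nonempty (Ioo (-δ) δ) isOpen_Ioo
    ⟨0, by constructor <;> linarith⟩
  obtain ⟨N, hN⟩ := mem_iUnion.1 hu₀'
  have hnhds : (A N) ∈ 𝓝 u₀ := by
    filter_upwards [mem_interior_iff_mem_nhds.1 hN, isOpen_Ioo.mem_nhds hu₀] with u h1 h2
    refine h1.resolve_right fun h3 => ?_
    exact absurd (abs_lt.2 ⟨h2.1, h2.2⟩) (not_lt.2 h3)
  obtain ⟨ρ, hρ, hball⟩ := Metric.mem_nhds_iff.1 hnhds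
  refine ⟨ρ, hρ, ?_⟩
  filter_upwards [hB.1.mem_of_mem (i := N) trivial, hf] with i hi hqa u hu
  have h1 : ‖f i (u₀ + u)‖ ≤ η / 4 := hball (by simpa [Real.dist_eq] using hu) i hi hqa
  have h2 : ‖f i u₀‖ ≤ η / 4 := hball (Metric.mem_ball_self hρ) i hi hqa
  -- transport the bound from a neighbourhood of `u₀` to one of `0`
  have h3 := hqa.norm_add_sub (u₀ + u) (-u₀) 1 one_pos
  rw [show u₀ + u + -u₀ = u by ring, hqa.norm_neg] at h3
  have h4 : ‖f i u‖ ≤ ‖f i u - f i (u₀ + u) - f i (-u₀)‖ + ‖f i (u₀ + u)‖ + ‖f i (-u₀)‖ := by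
    calc ‖f i u‖ = ‖(f i u - f i (u₀ + u) - f i (-u₀)) + f i (u₀ + u) + f i (-u₀)‖ := by ring_nf
      _ ≤ _ := norm_add₃_le
  rw [hqa.norm_neg] at h4
  norm_num at h3
  linarith

/-- Pointwise convergence of quasi-additive functions to a continuous limit is locally uniform. -/
lemma tendstoLocallyUniformly_of_quasiAdditive {ι : Type*} {l : Filter ι} [l.IsCountablyGenerated]
    {f : ι → ℝ → ℂ} {g : ℝ → ℂ} (hf : ∀ᶠ i in l, IsQuasiAdditive (f i)) (hg : Continuous g)
    (hg0 : g 0 = 0) (h : ∀ u, Tendsto (fun i => f i u) l (𝓝 (g u))) :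
    TendstoLocallyUniformly f g l := by
  rw [Metric.tendstoLocallyUniformly_iff]
  intro ε hε u
  set M := ‖g u‖ + 1
  have hM : 0 < M := by positivity
  set κ := ε / (8 * M) with hκ
  have hκ0 : 0 < κ := by positivity
  set η := min (ε / 8) (κ * (ε / 8)) with hη
  have hη0 : 0 < η := by positivity
  obtain ⟨δ, hδ, hsmall⟩ := equicontinuous_zero hf hg hg0 h hη0
  obtain ⟨δ', hδ', hgδ⟩ := Metric.continuous_iff.1 hg u (ε / 8) (by positivity)
  refine ⟨Metric.ball u (min δ δ'), Metric.ball_mem_nhds _ (lt_min hδ hδ'), ?_⟩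
  have hb : ∀ᶠ i in l, ‖f i u‖ < M := (h u).norm.eventually (gt_mem_nhds (by simp [M]))
  have hc : ∀ᶠ i in l, dist (f i u) (g u) < ε / 8 := (Metric.tendsto_nhds.1 (h u)) _ (by positivity)
  filter_upwards [hsmall, hb, hc, hf] with i h1 h2 h3 hqa y hy
  rw [Metric.mem_ball, Real.dist_eq] at hy
  have h4 := h1 (y - u) (hy.trans_le (min_le_left _ _))
  have h5 := hgδ y (by rw [Real.dist_eq]; exact hy.trans_le (min_le_right _ _))
  have h6 := hqa.norm_add_sub u (y - u) κ hκ0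
  rw [show u + (y - u) = y by ring] at h6
  have h7 : ‖f i y - f i u‖ ≤ ‖f i y - f i u - f i (y - u)‖ + ‖f i (y - u)‖ := by
    calc _ = ‖(f i y - f i u - f i (y - u)) + f i (y - u)‖ := by ring_nf
      _ ≤ _ := norm_add_le _ _
  have h8 : κ * ‖f i u‖ ≤ ε / 8 := by
    calc κ * ‖f i u‖ ≤ κ * M := by gcongr
      _ = ε / 8 := by rw [hκ]; field_simp
  have h9 : κ⁻¹ * ‖f i (y - u)‖ ≤ ε / 8 := by
    rw [inv_mul_le_iff₀ hκ0]; exact h4.trans (min_le_right _ _)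
  have h10 : ‖f i (y - u)‖ ≤ ε / 8 := h4.trans (min_le_left _ _)
  have h11 : dist (f i y) (f i u) ≤ 3 * (ε / 8) := by rw [dist_eq_norm]; linarith
  calc dist (g y) (f i y) ≤ dist (g y) (g u) + dist (g u) (f i u) + dist (f i u) (f i y) :=
        dist_triangle4 _ _ _ _
    _ < ε := by rw [dist_comm (g u), dist_comm (f i u) (f i y)]; linarith

end

section

/-! ### Rescaling along all small arguments -/

/-- `g` is a nonzero continuous function that is homogeneous of order `α > 0` on half-lines, as is
the exponent of every self-similar limit process. -/
structure IsHomogeneousExponent (α : ℝ) (g : ℝ → ℂ) : Prop where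
  alpha_pos : 0 < α
  continuous : Continuous g
  map_mul : ∀ w u : ℝ, 0 < w → g (w * u) = ((w ^ α : ℝ) : ℂ) * g u
  map_one_ne_zero : g 1 ≠ 0

lemma IsHomogeneousExponent.map_zero {α : ℝ} {g : ℝ → ℂ} (hg : IsHomogeneousExponent α g) :
    g 0 = 0 := by
  have h := hg.map_mul 2 0 two_pos
  have h2 : (1 : ℝ) < 2 ^ α := Real.one_lt_rpow one_lt_two hg.alpha_pos
  rw [mul_zero] at h
  by_contra h0
  have h3 : (((2 : ℝ) ^ α : ℝ) : ℂ) = 1 := mul_right_cancel₀ h0 (by rw [← h, one_mul])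
  have h4 : (2 : ℝ) ^ α = 1 := by exact_mod_cast h3
  linarith

/-- `e z * f (u / z) → g u` as `z ↓ 0`: the function `f` is attracted to `g`, where the scale `z`
is the free variable and the time `e z` depends on it. -/
def TendsToUnder (e : ℝ → ℝ) (f g : ℝ → ℂ) : Prop :=
  ∀ u : ℝ, Tendsto (fun z : ℝ => (e z : ℂ) * f (u / z)) (𝓝[>] 0) (𝓝 (g u))

/-- `ε * f (u / a ε) → g u` as `ε ↓ 0`. -/
def TendsToAlong (a : ℝ → ℝ) (f g : ℝ → ℂ) : Prop :=
  ∀ u : ℝ, Tendsto (fun ε : ℝ => (ε : ℂ) * f (u / a ε)) (𝓝[>] 0) (𝓝 (g u))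

variable {α : ℝ} {f g : ℝ → ℂ} {a e : ℝ → ℝ}

/-- A scaling function of an attracted process tends to zero. -/
lemma TendsToAlong.scaling_tendsto (hf : Continuous f) (hg : g 1 ≠ 0) (ha : IsScaling a)
    (h : TendsToAlong a f g) : Tendsto a (𝓝[>] 0) (𝓝[>] 0) := by
  have hpos : ∀ᶠ ε in 𝓝[>] (0 : ℝ), 0 < a ε := by
    filter_upwards [self_mem_nhdsWithin] with ε hε using ha ε hε
  refine tendsto_nhdsWithin_iff.2 ⟨?_, hpos⟩
  rw [tendsto_order]
  refine ⟨fun b hb => hpos.mono fun ε hε => hb.trans hε, fun c hc => ?_⟩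
  obtain ⟨C, hC⟩ := (isCompact_Icc (a := (0 : ℝ)) (b := 1 / c)).exists_bound_of_continuousOn
    hf.continuousOn
  have hg' : 0 < ‖g 1‖ := norm_pos_iff.2 hg
  have h1 : ∀ᶠ ε : ℝ in 𝓝[>] 0, ‖g 1‖ / 2 < ‖(ε : ℂ) * f (1 / a ε)‖ :=
    (h 1).norm.eventually (lt_mem_nhds (by linarith))
  have h2 : ∀ᶠ ε : ℝ in 𝓝[>] 0, ε * C < ‖g 1‖ / 2 := by
    have : Tendsto (fun ε : ℝ => ε * C) (𝓝 0) (𝓝 (0 * C)) := (continuous_mul_const C).tendsto 0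
    rw [zero_mul] at this
    exact (this.mono_left nhdsWithin_le_nhds).eventually (gt_mem_nhds (by linarith))
  filter_upwards [h1, h2, hpos, self_mem_nhdsWithin] with ε h1 h2 h3 hε
  by_contra hca
  rw [not_lt] at hca
  have hε : 0 < ε := hε
  have h4 := hC (1 / a ε) ⟨by positivity, one_div_le_one_div_of_le hc hca⟩
  rw [norm_mul, Complex.norm_real, Real.norm_of_nonneg hε.le] at h1
  have : ε * ‖f (1 / a ε)‖ ≤ ε * C := by gcongr
  linarith

/-- Halving the time changes the scaling function by a bounded factor. -/
lemma TendsToAlong.exists_ratio_bound (hf : IsQuasiAdditive f) (hg : IsHomogeneousExponent α g)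
    (ha : IsScaling a) (h : TendsToAlong a f g) :
    ∃ w > 0, ∀ᶠ ε in 𝓝[>] (0 : ℝ), w * a ε ≤ a (1 / 2 * ε) := by
  have hg' : 0 < ‖g 1‖ := norm_pos_iff.2 hg.map_one_ne_zero
  obtain ⟨δ, hδ, hsmall⟩ := equicontinuous_zero (l := 𝓝[>] (0 : ℝ))
    (f := fun ε u => (ε : ℂ) * f (u / a ε))
    (by filter_upwards [self_mem_nhdsWithin] with ε hε
        exact hf.rescale (le_of_lt hε) _) hg.continuous hg.map_zero h
    (show 0 < ‖g 1‖ / 8 by positivity)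
  refine ⟨δ, hδ, ?_⟩
  have h1 : ∀ᶠ ε : ℝ in 𝓝[>] 0, ‖g 1‖ / 2 < ‖(ε : ℂ) * f (1 / a ε)‖ :=
    (h 1).norm.eventually (lt_mem_nhds (by linarith))
  filter_upwards [(tendsto_const_mul_nhdsGT_zero (show (0 : ℝ) < 1 / 2 by norm_num)).eventually
    hsmall, h1, self_mem_nhdsWithin] with ε h1 h2 hε
  have hε : 0 < ε := hε
  have ha1 := ha ε hε
  have ha2 := ha (1 / 2 * ε) (by positivity)
  by_contra hlt
  rw [not_le] at hlt
  have h3 := h1 (a (1 / 2 * ε) / a ε) (by rw [abs_of_pos (by positivity), div_lt_iff₀ ha1]; exact hlt)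
  rw [div_div, mul_comm (a ε), ← div_div, div_self ha2.ne'] at h3
  push_cast at h3
  rw [mul_assoc, norm_mul] at h3
  norm_num at h3
  norm_num at h2
  linarith

/-- If `a` shrinks at most by the factor `w` when its argument is halved, then every small `z`
is comparable to some `a ε`, where `ε → 0` as `z ↓ 0`. -/
lemma exists_inverse_scaling (ha : IsScaling a) (ha0 : Tendsto a (𝓝[>] 0) (𝓝[>] 0)) {w : ℝ}
    (hwa : ∀ᶠ ε in 𝓝[>] (0 : ℝ), w * a ε ≤ a (1 / 2 * ε)) :
    ∃ b : ℝ → ℝ, Tendsto b (𝓝[>] 0) (𝓝[>] 0) ∧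
      ∀ᶠ z in 𝓝[>] (0 : ℝ), w * a (b z) ≤ z ∧ z ≤ a (b z) := by
  obtain ⟨ε₁, hε₁, hwa⟩ := (mem_nhdsGT_iff_exists_Ioo_subset).1 hwa
  simp only [mem_Ioi] at hε₁
  set s : ℕ → ℝ := fun n => ε₁ / 2 * (1 / 2) ^ n with hs
  have hs0 : ∀ n, 0 < s n := fun n => by positivity
  have hs1 : ∀ n, s n < ε₁ := fun n => by
    have : (1 / 2 : ℝ) ^ n ≤ 1 := pow_le_one₀ (by norm_num) (by norm_num)
    simp only [hs]; nlinarith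
  have hsucc : ∀ n, s (n + 1) = 1 / 2 * s n := fun n => by simp only [hs, pow_succ]; ring
  have hwas : ∀ n, w * a (s n) ≤ a (s (n + 1)) := fun n => by
    rw [hsucc]; exact hwa ⟨hs0 n, hs1 n⟩
  have hslim : Tendsto s atTop (𝓝[>] 0) := by
    refine tendsto_nhdsWithin_iff.2 ⟨?_, .of_forall fun n => hs0 n⟩
    have := (tendsto_pow_atTop_nhds_zero_of_lt_one (show (0 : ℝ) ≤ 1 / 2 by norm_num)
      (by norm_num)).const_mul (ε₁ / 2)
    rwa [mul_zero] at this
  have haslim : Tendsto (fun n => a (s n)) atTop (𝓝 0) :=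
    tendsto_nhds_of_tendsto_nhdsWithin (ha0.comp hslim)
  have hex : ∀ z : ℝ, 0 < z → ∃ n, a (s (n + 1)) ≤ z := fun z hz => by
    obtain ⟨N, hN⟩ := eventually_atTop.1 (haslim.eventually (gt_mem_nhds hz))
    exact ⟨N, (hN (N + 1) (by omega)).le⟩
  classical
  -- `b z` is `s n` for the first `n` with `a (s (n + 1)) ≤ z`
  let n : ℝ → ℕ := fun z => if hz : 0 < z then Nat.find (hex z hz) else 0
  have hn : ∀ z (hz : 0 < z), n z = Nat.find (hex z hz) := fun z hz => dif_pos hz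
  refine ⟨fun z => s (n z), hslim.comp ?_, ?_⟩
  · rw [tendsto_atTop]
    intro N
    have hev : ∀ᶠ z in 𝓝[>] (0 : ℝ), ∀ m ∈ Finset.range N, z < a (s (m + 1)) := by
      rw [eventually_all_finset]
      intro m _
      exact eventually_nhdsWithin_of_eventually_nhds (gt_mem_nhds (ha _ (hs0 _)))
    filter_upwards [hev, self_mem_nhdsWithin] with z hz hz0
    by_contra hlt
    rw [not_le] at hlt
    have h1 := hz (n z) (Finset.mem_range.2 hlt)
    rw [hn z hz0] at h1
    exact absurd (Nat.find_spec (hex z hz0)) (not_le.2 h1)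
  · filter_upwards [Ioo_mem_nhdsGT (ha _ (hs0 0))] with z hz
    have hfind := Nat.find_spec (hex z hz.1)
    rw [← hn z hz.1] at hfind
    refine ⟨(hwas _).trans hfind, ?_⟩
    rcases Nat.eq_zero_or_pos (n z) with h0 | h0
    · rw [h0]; exact hz.2.le
    · have := Nat.find_min (hex z hz.1) (m := n z - 1) (by rw [← hn z hz.1]; omega)
      rw [not_le, Nat.sub_add_cancel h0] at this
      exact this.le

/-- Attraction along some scaling function is attraction with the scale as the free variable. -/
lemma TendsToAlong.exists_tendsToUnder (hf : IsQuasiAdditive f) (hg : IsHomogeneousExponent α g)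
    (ha : IsScaling a) (h : TendsToAlong a f g) :
    ∃ e : ℝ → ℝ, (∀ᶠ z in 𝓝[>] 0, 0 < e z) ∧ TendsToUnder e f g := by
  have ha0 := h.scaling_tendsto hf.continuous hg.map_one_ne_zero ha
  obtain ⟨w, hw, hwa⟩ := h.exists_ratio_bound hf hg ha
  obtain ⟨b, hb0, hb⟩ := exists_inverse_scaling ha ha0 hwa
  have hbpos : ∀ᶠ z in 𝓝[>] (0 : ℝ), 0 < b z := (tendsto_nhdsWithin_iff.1 hb0).2
  -- the factor corrects for the bounded discrepancy between `z` and `a (b z)`, by homogeneity of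
  -- `g`
  refine ⟨fun z => b z * (z / a (b z)) ^ α, ?_, fun u => ?_⟩
  · filter_upwards [hbpos, self_mem_nhdsWithin] with z h1 h2
    have := ha _ h1
    have h2 : 0 < z := h2
    positivity
  · have hloc := tendstoLocallyUniformly_of_quasiAdditive (l := 𝓝[>] (0 : ℝ))
      (f := fun ε u => (ε : ℂ) * f (u / a ε))
      (by filter_upwards [self_mem_nhdsWithin] with ε hε
          exact hf.rescale (le_of_lt hε) _) hg.continuous hg.map_zero h
    have hK : IsCompact ((fun t => u * t) '' Icc 1 (1 / w)) :=
      isCompact_Icc.image (continuous_const_mul u)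
    have hunif := (tendstoLocallyUniformlyOn_iff_tendstoUniformlyOn_of_compact hK).1
      (hloc.tendstoLocallyUniformlyOn (s := (fun t => u * t) '' Icc 1 (1 / w)))
    rw [Metric.tendstoUniformlyOn_iff] at hunif
    rw [Metric.tendsto_nhds]
    intro η hη
    filter_upwards [hb0.eventually (hunif η hη), hb, hbpos, self_mem_nhdsWithin] with z h1 h2 h3 hz
    have hz : 0 < z := hz
    have hab := ha _ h3
    set r := z / a (b z) with hr
    have hr0 : 0 < r := by positivity
    have hr1 : r ≤ 1 := (div_le_one hab).2 h2.2
    have hrw : w ≤ r := (le_div_iff₀ hab).2 h2.1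
    have h4 := h1 (u * r⁻¹) ⟨r⁻¹, ⟨(one_le_inv₀ hr0).2 hr1, by
      rw [one_div]; exact inv_anti₀ hw hrw⟩, rfl⟩
    have h5 : u * r⁻¹ / a (b z) = u / z := by rw [hr]; field_simp
    have h6 : g u = ((r ^ α : ℝ) : ℂ) * g (u * r⁻¹) := by
      rw [← hg.map_mul r _ hr0]; congr 1; field_simp
    rw [h5] at h4
    rw [h6, Complex.ofReal_mul, mul_comm (b z : ℂ), mul_assoc, dist_comm, dist_eq_norm, ← mul_sub,
      norm_mul, Complex.norm_real, Real.norm_of_nonneg (by positivity), ← dist_eq_norm]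
    have : r ^ α ≤ 1 := Real.rpow_le_one hr0.le hr1 hg.alpha_pos.le
    calc _ ≤ 1 * dist (g (u * r⁻¹)) (b z * f (u / z)) := by gcongr
      _ < η := by rwa [one_mul]

/-- The time at which the norm of the rescaled exponent at `1` equals that of the limit. -/
lemma TendsToUnder.normalize (hg : g 1 ≠ 0) (he : ∀ᶠ z in 𝓝[>] 0, 0 < e z)
    (h : TendsToUnder e f g) :
    Tendsto (fun z => ‖g 1‖ / ‖f (1 / z)‖ / e z) (𝓝[>] 0) (𝓝 1) := by
  have hg' : ‖g 1‖ ≠ 0 := norm_ne_zero_iff.2 hg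
  have h1 := (tendsto_const_nhds (x := ‖g 1‖)).div (h 1).norm hg'
  rw [div_self hg'] at h1
  refine h1.congr' ?_
  filter_upwards [he] with z hz
  simp only [Pi.div_apply]
  rw [norm_mul, Complex.norm_real, Real.norm_of_nonneg hz.le, div_div, mul_comm]

lemma TendsToUnder.congr_equiv {e' : ℝ → ℝ} (he : ∀ᶠ z in 𝓝[>] 0, 0 < e z)
    (h : TendsToUnder e f g) (h' : Tendsto (fun z => e' z / e z) (𝓝[>] 0) (𝓝 1)) :
    TendsToUnder e' f g := by
  intro u
  have h1 : Tendsto (fun z => ((e' z / e z : ℝ) : ℂ)) (𝓝[>] 0) (𝓝 ((1 : ℝ) : ℂ)) :=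
    (Complex.continuous_ofReal.tendsto 1).comp h'
  have h2 := h1.mul (h u)
  rw [Complex.ofReal_one, one_mul] at h2
  refine h2.congr' ?_
  filter_upwards [he] with z hz
  have : (e z : ℂ) ≠ 0 := by exact_mod_cast hz.ne'
  push_cast
  field_simp

/-- Conversely to `TendsToAlong.exists_tendsToUnder`, the time may be inverted to yield a scaling
function, by the intermediate value theorem for `z ↦ ‖g 1‖ / ‖f (1 / z)‖`. -/
lemma TendsToUnder.exists_scaling (hf : Continuous f) (hg : IsHomogeneousExponent α g)
    (he : ∀ᶠ z in 𝓝[>] 0, 0 < e z) (h : TendsToUnder e f g) :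
    ∃ a, IsScaling a ∧ TendsToAlong a f g := by
  have hg' : 0 < ‖g 1‖ := norm_pos_iff.2 hg.map_one_ne_zero
  set E : ℝ → ℝ := fun z => ‖g 1‖ / ‖f (1 / z)‖ with hE
  have hEe := h.normalize hg.map_one_ne_zero he
  have hE' : TendsToUnder E f g := h.congr_equiv he hEe
  have hne : ∀ᶠ z in 𝓝[>] (0 : ℝ), f (1 / z) ≠ 0 := by
    filter_upwards [(h 1).eventually_ne hg.map_one_ne_zero] with z hz hfz
    exact hz (by rw [hfz, mul_zero])
  obtain ⟨d, hd, hne⟩ := (mem_nhdsGT_iff_exists_Ioc_subset).1 hne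
  simp only [mem_Ioi] at hd
  have hEpos : ∀ z ∈ Ioc 0 d, 0 < E z := fun z hz => div_pos hg' (norm_pos_iff.2 (hne hz))
  have hEcont : ContinuousOn E (Ioc 0 d) := by
    refine ContinuousOn.div continuousOn_const ?_ fun z hz => (norm_pos_iff.2 (hne hz)).ne'
    refine ContinuousOn.norm (hf.comp_continuousOn ?_)
    exact ContinuousOn.div continuousOn_const continuousOn_id fun z hz => hz.1.ne'
  -- `E` tends to zero, as halving its argument contracts by `2 ^ (-α)` in the limit
  have hElim : Tendsto E (𝓝[>] 0) (𝓝 0) := by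
    have hq : Tendsto (fun z => ‖(E z : ℂ) * f ((1 / 2) / z)‖ / ‖(E z : ℂ) * f (1 / z)‖) (𝓝[>] 0)
        (𝓝 (‖g (1 / 2)‖ / ‖g 1‖)) := (hE' (1 / 2)).norm.div (hE' 1).norm hg'.ne'
    have hq1 : ‖g (1 / 2)‖ / ‖g 1‖ < 1 := by
      have := hg.map_mul (1 / 2) 1 (by norm_num)
      rw [mul_one] at this
      rw [this, norm_mul, mul_div_assoc, div_self hg'.ne', mul_one, Complex.norm_real,
        Real.norm_of_nonneg (by positivity)]
      exact Real.rpow_lt_one (by norm_num) (by norm_num) hg.alpha_pos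
    refine tendsto_zero_of_tendsto_contraction (η := fun _ => 0) (by positivity) hq1 hd ?_ hq
      tendsto_const_nhds ?_ ?_
    · intro a ha
      obtain ⟨C, hC⟩ := (isCompact_Icc (a := a) (b := d)).exists_bound_of_continuousOn
        (hEcont.mono fun z hz => ⟨ha.1.trans_le hz.1, hz.2⟩)
      exact ⟨C, fun z hz => (le_abs_self _).trans (hC z hz)⟩
    · exact .of_forall fun z => by positivity
    · filter_upwards [Ioo_mem_nhdsGT (show 0 < d / 2 by positivity)] with z hz
      have h1 := norm_pos_iff.2 (hne (show z ∈ Ioc 0 d from ⟨hz.1, by linarith [hz.2, hz.1]⟩))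
      have h2 := norm_pos_iff.2 (hne (show 2 * z ∈ Ioc 0 d from
        ⟨by linarith [hz.1], by linarith [hz.2]⟩))
      have h3 : (1 / 2) / z = 1 / (2 * z) := by field_simp
      have h4 := hEpos z ⟨hz.1, by linarith [hz.2, hz.1]⟩
      rw [h3, norm_mul, norm_mul, mul_div_mul_left _ _ (by
        rw [Complex.norm_real, Real.norm_of_nonneg h4.le]; exact h4.ne'), add_zero]
      simp only [hE]
      rw [div_mul_div_comm, mul_comm ‖f (1 / (2 * z))‖, mul_div_mul_right _ _ h2.ne']
  have hivt : ∀ t ∈ Ioo 0 (E d), ∃ z ∈ Ioc 0 d, E z = t := by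
    intro t ht
    obtain ⟨z₀, h1, h2⟩ := ((hElim.eventually (gt_mem_nhds ht.1)).and (Ioo_mem_nhdsGT hd)).exists
    obtain ⟨z, hz, hzt⟩ := intermediate_value_Icc h2.2.le
      (hEcont.mono fun z hz => ⟨h2.1.trans_le hz.1, hz.2⟩) (show t ∈ Icc (E z₀) (E d) from
        ⟨h1.le, ht.2.le⟩)
    exact ⟨z, ⟨h2.1.trans_le hz.1, hz.2⟩, hzt⟩
  choose! b hb hbE using hivt
  classical
  refine ⟨fun ε => if ε ∈ Ioo 0 (E d) then b ε else 1, ?_, ?_⟩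
  · intro ε _
    show 0 < if ε ∈ Ioo 0 (E d) then b ε else 1
    split_ifs with hε
    · exact (hb ε hε).1
    · exact one_pos
  · have hmem : Ioo 0 (E d) ∈ 𝓝[>] (0 : ℝ) := Ioo_mem_nhdsGT (hEpos d ⟨hd, le_rfl⟩)
    have hblim : Tendsto b (𝓝[>] 0) (𝓝[>] 0) := by
      have hbpos : ∀ᶠ ε in 𝓝[>] (0 : ℝ), 0 < b ε := by
        filter_upwards [hmem] with ε hε using (hb ε hε).1
      refine tendsto_nhdsWithin_iff.2 ⟨?_, hbpos⟩
      rw [tendsto_order]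
      refine ⟨fun c hc => hbpos.mono fun ε hε => hc.trans hε, fun c hc => ?_⟩
      rcases lt_or_ge d c with hcd | hcd
      · filter_upwards [hmem] with ε hε using (hb ε hε).2.trans_lt hcd
      · obtain ⟨z₁, hz₁, hmin⟩ := (isCompact_Icc (a := c) (b := d)).exists_isMinOn
          ⟨d, hcd, le_rfl⟩ (hEcont.mono fun z hz => ⟨hc.trans_le hz.1, hz.2⟩)
        filter_upwards [hmem, Ioo_mem_nhdsGT (hEpos z₁ ⟨hc.trans_le hz₁.1, hz₁.2⟩)] with ε hε hε'
        by_contra hcb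
        rw [not_lt] at hcb
        have := isMinOn_iff.1 hmin (b ε) ⟨hcb, (hb ε hε).2⟩
        rw [hbE ε hε] at this
        exact absurd hε'.2 (not_lt.2 this)
    intro u
    refine ((hE' u).comp hblim).congr' ?_
    filter_upwards [hmem] with ε hε
    simp only [Function.comp_apply, if_pos hε, hbE ε hε]

/-- The scaling functions are exactly the asymptotic inverses of the time `e`. -/
lemma TendsToUnder.tendsToAlong_iff (hf : Continuous f) (hg : g 1 ≠ 0)
    (he : ∀ᶠ z in 𝓝[>] 0, 0 < e z) (h : TendsToUnder e f g) (ha : IsScaling a) :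
    TendsToAlong a f g ↔
      Tendsto a (𝓝[>] 0) (𝓝[>] 0) ∧ Tendsto (fun ε => e (a ε) / ε) (𝓝[>] 0) (𝓝 1) := by
  constructor
  · intro h'
    have ha0 := h'.scaling_tendsto hf hg ha
    refine ⟨ha0, ?_⟩
    have hg' : ‖g 1‖ ≠ 0 := norm_ne_zero_iff.2 hg
    have h1 := ((h 1).comp ha0).norm.div (h' 1).norm hg'
    rw [div_self hg'] at h1
    refine h1.congr' ?_
    filter_upwards [ha0.eventually he, self_mem_nhdsWithin, (h' 1).eventually_ne hg]
      with ε h2 hε h3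
    have hε : 0 < ε := hε
    have h4 : ‖f (1 / a ε)‖ ≠ 0 := norm_ne_zero_iff.2 (right_ne_zero_of_mul h3)
    simp only [Pi.div_apply, Function.comp_apply]
    rw [norm_mul, norm_mul, Complex.norm_real, Complex.norm_real, Real.norm_of_nonneg h2.le,
      Real.norm_of_nonneg hε.le, mul_div_mul_right _ _ h4]
  · rintro ⟨ha0, h1⟩ u
    have h2 : Tendsto (fun ε => (((e (a ε) / ε)⁻¹ : ℝ) : ℂ)) (𝓝[>] 0) (𝓝 ((1⁻¹ : ℝ) : ℂ)) :=
      (Complex.continuous_ofReal.tendsto _).comp (h1.inv₀ one_ne_zero)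
    have h3 := h2.mul ((h u).comp ha0)
    rw [inv_one, Complex.ofReal_one, one_mul] at h3
    refine h3.congr' ?_
    filter_upwards [ha0.eventually he, self_mem_nhdsWithin] with ε h4 hε
    have hε : 0 < ε := hε
    have h5 : (e (a ε) : ℂ) ≠ 0 := by exact_mod_cast h4.ne'
    simp only [Function.comp_apply, inv_div, Complex.ofReal_div]
    field_simp

end

section

/-! ### Lévy measures and Lévy exponents -/

/-- The integrand of the Lévy-Khintchine formula at the imaginary argument `u * I`. -/
noncomputable def levyKernel (u x : ℝ) : ℂ :=
  Complex.exp (u * Complex.I * x) - 1 - if |x| < 1 then u * Complex.I * x else 0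

/-- The Lévy exponent as a function of the real frequency. -/
noncomputable def charExp (γ σ : ℝ) (ν : Measure ℝ) (u : ℝ) : ℂ :=
  levyExponent γ σ ν (u * Complex.I)

lemma charExp_eq (γ σ : ℝ) (ν : Measure ℝ) (u : ℝ) :
    charExp γ σ ν u = γ * u * Complex.I - ((σ ^ 2 * u ^ 2 / 2 : ℝ) : ℂ) +
      ∫ x, levyKernel u x ∂ν := by
  unfold charExp levyExponent levyKernel
  rw [mul_pow, Complex.I_sq]
  push_cast
  ring

lemma measurable_levyKernel (u : ℝ) : Measurable (levyKernel u) := by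
  unfold levyKernel
  refine Measurable.sub (by fun_prop) (Measurable.ite ?_ (by fun_prop) (by fun_prop))
  exact measurableSet_lt (by fun_prop) (by fun_prop)

lemma continuous_levyKernel (x : ℝ) : Continuous (fun u => levyKernel u x) := by
  unfold levyKernel
  split_ifs <;> fun_prop

lemma norm_exp_sub_one_le_two (y : ℝ) : ‖Complex.exp (y * Complex.I) - 1‖ ≤ 2 := by
  calc _ ≤ ‖Complex.exp (y * Complex.I)‖ + ‖(1 : ℂ)‖ := norm_sub_le _ _
    _ = 2 := by rw [Complex.norm_exp_ofReal_mul_I, norm_one]; norm_num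

lemma norm_exp_sub_one_sub_le (y : ℝ) :
    ‖Complex.exp (y * Complex.I) - 1 - y * Complex.I‖ ≤ 3 * y ^ 2 := by
  have hn : ‖(y : ℂ) * Complex.I‖ = |y| := by simp
  rcases le_total |y| 1 with h | h
  · have := Complex.norm_exp_sub_one_sub_id_le (x := y * Complex.I) (by rw [hn]; exact h)
    rw [hn, sq_abs] at this
    nlinarith [sq_nonneg y]
  · calc _ ≤ ‖Complex.exp (y * Complex.I) - 1‖ + ‖(y : ℂ) * Complex.I‖ := norm_sub_le _ _
      _ ≤ 2 + |y| := by rw [hn]; gcongr; exact norm_exp_sub_one_le_two y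
      _ ≤ 3 * y ^ 2 := by rw [← sq_abs]; nlinarith

lemma levyKernel_of_lt {u x : ℝ} (hx : |x| < 1) : levyKernel u x =
    Complex.exp ((u * x : ℝ) * Complex.I) - 1 - ((u * x : ℝ) : ℂ) * Complex.I := by
  rw [levyKernel, if_pos hx]; push_cast; ring_nf

lemma levyKernel_of_le {u x : ℝ} (hx : 1 ≤ |x|) : levyKernel u x =
    Complex.exp ((u * x : ℝ) * Complex.I) - 1 := by
  rw [levyKernel, if_neg (not_lt.2 hx)]; push_cast; ring_nf

lemma norm_levyKernel_le (u x : ℝ) : ‖levyKernel u x‖ ≤ (3 * u ^ 2 + 2) * min (x ^ 2) 1 := by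
  rcases lt_or_ge |x| 1 with hx | hx
  · have hx2 : x ^ 2 ≤ 1 := by rw [← sq_abs]; nlinarith [abs_nonneg x]
    rw [levyKernel_of_lt hx, min_eq_left hx2]
    refine (norm_exp_sub_one_sub_le _).trans ?_
    nlinarith [sq_nonneg x]
  · have hx2 : 1 ≤ x ^ 2 := by rw [← sq_abs]; nlinarith [abs_nonneg x]
    rw [levyKernel_of_le hx, min_eq_right hx2]
    refine (norm_exp_sub_one_le_two _).trans ?_
    nlinarith [sq_nonneg u]

lemma levyKernel_add_sub (u h x : ℝ) : levyKernel (u + h) x - levyKernel u x - levyKernel h x =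
    (Complex.exp ((u * x : ℝ) * Complex.I) - 1) * (Complex.exp ((h * x : ℝ) * Complex.I) - 1) := by
  have : Complex.exp (((u + h : ℝ) : ℂ) * Complex.I * x) =
      Complex.exp ((u * x : ℝ) * Complex.I) * Complex.exp ((h * x : ℝ) * Complex.I) := by
    rw [← Complex.exp_add]; push_cast; ring_nf
  have h1 : Complex.exp ((u : ℂ) * Complex.I * x) = Complex.exp ((u * x : ℝ) * Complex.I) := by
    push_cast; ring_nf
  have h2 : Complex.exp ((h : ℂ) * Complex.I * x) = Complex.exp ((h * x : ℝ) * Complex.I) := by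
    push_cast; ring_nf
  unfold levyKernel
  rw [this, h1, h2]
  split_ifs <;> push_cast <;> ring

lemma sq_norm_exp_sub_one (y : ℝ) :
    ‖Complex.exp (y * Complex.I) - 1‖ ^ 2 = 2 * (1 - Real.cos y) := by
  rw [← Complex.normSq_eq_norm_sq, Complex.normSq_apply, Complex.exp_mul_I]
  simp only [Complex.sub_re, Complex.add_re, Complex.mul_re, Complex.I_re, Complex.I_im,
    Complex.cos_ofReal_re, Complex.sin_ofReal_re, Complex.sin_ofReal_im, Complex.one_re,
    Complex.sub_im, Complex.add_im, Complex.mul_im, Complex.cos_ofReal_im, Complex.one_im]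
  nlinarith [Real.sin_sq_add_cos_sq y]

lemma re_levyKernel (u x : ℝ) : (levyKernel u x).re = Real.cos (u * x) - 1 := by
  rcases lt_or_ge |x| 1 with hx | hx
  · rw [levyKernel_of_lt hx, Complex.sub_re, Complex.sub_re, Complex.exp_ofReal_mul_I_re,
      Complex.one_re, Complex.re_ofReal_mul, Complex.I_re, mul_zero, sub_zero]
  · rw [levyKernel_of_le hx, Complex.sub_re, Complex.exp_ofReal_mul_I_re, Complex.one_re]

lemma levyKernel_neg (u x : ℝ) : levyKernel (-u) x = (starRingEnd ℂ) (levyKernel u x) := by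
  unfold levyKernel
  simp only [map_sub, map_one, ← Complex.exp_conj, map_mul, Complex.conj_ofReal, Complex.conj_I,
    Complex.ofReal_neg, apply_ite (starRingEnd ℂ), map_zero]
  simp

namespace IsLevyMeasure

variable {ν : Measure ℝ} (hν : IsLevyMeasure ν)
include hν

lemma integrable_min : Integrable (fun x : ℝ => min (x ^ 2) 1) ν := by
  refine ⟨by fun_prop, ?_⟩
  rw [hasFiniteIntegral_iff_ofReal (.of_forall fun x => by positivity)]
  exact hν.2

lemma integrable_of_le {E : Type*} [NormedAddCommGroup E] {h : ℝ → E}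
    (hm : AEStronglyMeasurable h ν) {C : ℝ} (hC : ∀ x, ‖h x‖ ≤ C * min (x ^ 2) 1) :
    Integrable h ν :=
  (hν.integrable_min.const_mul C).mono' hm (.of_forall hC)

lemma integrable_levyKernel (u : ℝ) : Integrable (levyKernel u) ν :=
  hν.integrable_of_le (measurable_levyKernel u).aestronglyMeasurable (norm_levyKernel_le u)

lemma measure_abs_ge_lt_top {δ : ℝ} (hδ : 0 < δ) : ν {x | δ ≤ |x|} < ∞ := by
  have hm := hν.integrable_min.measure_norm_ge_lt_top (show 0 < min (δ ^ 2) 1 by positivity)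
  refine (measure_mono fun x hx => ?_).trans_lt hm
  have hx : δ ≤ |x| := hx
  simp only [mem_ofPred_eq]
  rw [Real.norm_of_nonneg (by positivity), ← sq_abs x]
  gcongr

lemma measure_lt_top_of_subset {δ : ℝ} (hδ : 0 < δ) {s : Set ℝ} (hs : s ⊆ {x | δ ≤ |x|}) :
    ν s < ∞ := (measure_mono hs).trans_lt (hν.measure_abs_ge_lt_top hδ)

lemma Ioi_lt_top {x : ℝ} (hx : 0 < x) : ν (Ioi x) < ∞ :=
  hν.measure_lt_top_of_subset hx fun y hy => by
    have hy : x < y := hy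
    exact hy.le.trans (le_abs_self y)

lemma Iio_lt_top {x : ℝ} (hx : 0 < x) : ν (Iio (-x)) < ∞ :=
  hν.measure_lt_top_of_subset hx fun y hy => by
    have hy : y < -x := hy
    exact (show x ≤ -y by linarith).trans (neg_le_abs y)

/-- A Lévy measure is `σ`-finite, as `x² ∧ 1` is integrable and positive almost everywhere. -/
lemma sigmaFinite : SigmaFinite ν := by
  have h0 : ∀ᵐ x ∂ν, x ≠ 0 := by
    rw [ae_iff]; simpa using hν.1
  have hm : Measurable (fun x : ℝ => ENNReal.ofReal (min (x ^ 2) 1)) := by fun_prop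
  have hpos : ∀ᵐ x ∂ν, ENNReal.ofReal (min (x ^ 2) 1) ≠ 0 := by
    filter_upwards [h0] with x hx
    rw [Ne, ENNReal.ofReal_eq_zero, not_le]
    positivity
  have hfin : IsFiniteMeasure (ν.withDensity fun x => ENNReal.ofReal (min (x ^ 2) 1)) :=
    isFiniteMeasure_withDensity hν.2.ne
  have := withDensity_inv_same (μ := ν) hm hpos (.of_forall fun x => ENNReal.ofReal_ne_top)
  rw [← this]
  refine SigmaFinite.withDensity_of_ne_top ?_
  rw [ae_withDensity_iff hm]
  refine .of_forall fun x hx => ?_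
  exact ENNReal.inv_ne_top.2 hx

end IsLevyMeasure

variable {γ σ : ℝ} {ν : Measure ℝ}

lemma integrable_one_sub_cos (hν : IsLevyMeasure ν) (u : ℝ) :
    Integrable (fun x => 1 - Real.cos (u * x)) ν := by
  have := (hν.integrable_levyKernel u).re.neg
  refine this.congr (.of_forall fun x => ?_)
  show -(levyKernel u x).re = _
  rw [re_levyKernel]; ring

lemma charExp_re (hν : IsLevyMeasure ν) (u : ℝ) : (charExp γ σ ν u).re =
    -(σ ^ 2 * u ^ 2 / 2 + ∫ x, (1 - Real.cos (u * x)) ∂ν) := by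
  have h1 : (∫ x, levyKernel u x ∂ν).re = ∫ x, (levyKernel u x).re ∂ν :=
    (integral_re (hν.integrable_levyKernel u)).symm
  have h2 : ∫ x, (levyKernel u x).re ∂ν = - ∫ x, (1 - Real.cos (u * x)) ∂ν := by
    rw [← integral_neg]
    refine integral_congr_ae (.of_forall fun x => ?_)
    simp only [re_levyKernel]; ring
  rw [charExp_eq, Complex.add_re, Complex.sub_re, Complex.ofReal_re, h1, h2]
  have : ((γ : ℂ) * u * Complex.I).re = 0 := by simp
  rw [this]; ring

lemma charExp_zero : charExp γ σ ν 0 = 0 := by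
  rw [charExp_eq]
  have : ∀ x, levyKernel 0 x = 0 := fun x => by simp [levyKernel]
  simp [this]

lemma continuous_charExp (hν : IsLevyMeasure ν) : Continuous (charExp γ σ ν) := by
  have : Continuous (fun u => ∫ x, levyKernel u x ∂ν) := by
    refine continuous_iff_continuousAt.2 fun u₀ => ?_
    refine continuousAt_of_dominated (bound := fun x => (3 * (|u₀| + 1) ^ 2 + 2) * min (x ^ 2) 1)
      (.of_forall fun u => (measurable_levyKernel u).aestronglyMeasurable) ?_
      (hν.integrable_min.const_mul _) (.of_forall fun x => (continuous_levyKernel x).continuousAt)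
    filter_upwards [Metric.ball_mem_nhds u₀ one_pos] with u hu
    refine .of_forall fun x => (norm_levyKernel_le u x).trans ?_
    have h1 : |u| ≤ |u₀| + 1 := by
      rw [Metric.mem_ball, Real.dist_eq] at hu
      have := abs_sub_abs_le_abs_sub u u₀
      linarith
    have h2 : u ^ 2 ≤ (|u₀| + 1) ^ 2 := by rw [← sq_abs u]; gcongr
    gcongr
  have h2 : charExp γ σ ν = fun u => γ * u * Complex.I - ((σ ^ 2 * u ^ 2 / 2 : ℝ) : ℂ) +
      ∫ x, levyKernel u x ∂ν := funext fun u => charExp_eq γ σ ν u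
  rw [h2]
  fun_prop

/-- A Lévy exponent is quasi-additive: the drift and the truncation cancel in
`f (u + h) - f u - f h`, which leaves `-σ² u h + ∫ (e^{iux} - 1) (e^{ihx} - 1) ν(dx)`. -/
lemma isQuasiAdditive_charExp (hν : IsLevyMeasure ν) : IsQuasiAdditive (charExp γ σ ν) where
  continuous := continuous_charExp hν
  map_zero := charExp_zero
  norm_neg u := by
    have : charExp γ σ ν (-u) = (starRingEnd ℂ) (charExp γ σ ν u) := by
      have h1 : ∫ x, levyKernel (-u) x ∂ν = (starRingEnd ℂ) (∫ x, levyKernel u x ∂ν) := by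
        simp only [levyKernel_neg]; exact integral_conj
      rw [charExp_eq, charExp_eq, h1]
      simp only [map_add, map_sub, map_mul, Complex.conj_ofReal, Complex.conj_I]
      push_cast; ring
    rw [this, Complex.norm_conj]
  norm_add_sub u h δ hδ := by
    have hi := hν.integrable_levyKernel
    have e1 : charExp γ σ ν (u + h) - charExp γ σ ν u - charExp γ σ ν h =
        -((σ ^ 2 * u * h : ℝ) : ℂ) + ∫ x, (Complex.exp ((u * x : ℝ) * Complex.I) - 1) *
          (Complex.exp ((h * x : ℝ) * Complex.I) - 1) ∂ν := by
      simp only [← levyKernel_add_sub]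
      have h2 := integral_sub ((hi (u + h)).sub (hi u)) (hi h)
      have h3 := integral_sub (hi (u + h)) (hi u)
      simp only [Pi.sub_apply] at h2
      rw [h2, h3, charExp_eq, charExp_eq, charExp_eq]
      push_cast; ring
    have hI := fun v => integrable_one_sub_cos hν v
    have hR : ∀ v, σ ^ 2 * v ^ 2 / 2 + ∫ x, (1 - Real.cos (v * x)) ∂ν ≤ ‖charExp γ σ ν v‖ := by
      intro v
      have := (Complex.abs_re_le_norm (charExp γ σ ν v))
      rw [charExp_re hν, abs_neg] at this
      exact (le_abs_self _).trans this
    have e2 : ‖∫ x, (Complex.exp ((u * x : ℝ) * Complex.I) - 1) *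
          (Complex.exp ((h * x : ℝ) * Complex.I) - 1) ∂ν‖ ≤
        δ * ∫ x, (1 - Real.cos (u * x)) ∂ν + δ⁻¹ * ∫ x, (1 - Real.cos (h * x)) ∂ν := by
      rw [← integral_const_mul, ← integral_const_mul,
        ← integral_add ((hI u).const_mul _) ((hI h).const_mul _)]
      refine norm_integral_le_of_norm_le (((hI u).const_mul _).add ((hI h).const_mul _))
        (.of_forall fun x => ?_)
      rw [norm_mul]
      have h1 := sq_norm_exp_sub_one (u * x)
      have h2 := sq_norm_exp_sub_one (h * x)
      set A := ‖Complex.exp ((u * x : ℝ) * Complex.I) - 1‖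
      set B := ‖Complex.exp ((h * x : ℝ) * Complex.I) - 1‖
      have h3 : A * B ≤ δ * (A ^ 2 / 2) + δ⁻¹ * (B ^ 2 / 2) := by
        have h4 : 0 ≤ (δ * A - B) ^ 2 := sq_nonneg _
        have h5 : δ * (A ^ 2 / 2) + δ⁻¹ * (B ^ 2 / 2) - A * B = (δ * A - B) ^ 2 / (2 * δ) := by
          field_simp; ring
        have h6 : 0 ≤ (δ * A - B) ^ 2 / (2 * δ) := by positivity
        linarith
      rw [h1, h2] at h3
      calc A * B ≤ _ := h3
        _ = _ := by ring
    have e3 : ‖-((σ ^ 2 * u * h : ℝ) : ℂ)‖ ≤ δ * (σ ^ 2 * u ^ 2 / 2) + δ⁻¹ * (σ ^ 2 * h ^ 2 / 2) := by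
      rw [_root_.norm_neg, Complex.norm_real, Real.norm_eq_abs]
      have hp : ∀ s : ℝ, |s| = 1 → s * (σ ^ 2 * u * h) ≤
          δ * (σ ^ 2 * u ^ 2 / 2) + δ⁻¹ * (σ ^ 2 * h ^ 2 / 2) := by
        intro s hs
        have hs2 : s ^ 2 = 1 := by rw [← sq_abs, hs]; norm_num
        have h5 : δ * (σ ^ 2 * u ^ 2 / 2) + δ⁻¹ * (σ ^ 2 * h ^ 2 / 2) - s * (σ ^ 2 * u * h) =
            σ ^ 2 * (δ * u - s * h) ^ 2 / (2 * δ) := by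
          field_simp; linear_combination (-σ ^ 2 * h ^ 2) * hs2
        have h6 : 0 ≤ σ ^ 2 * (δ * u - s * h) ^ 2 / (2 * δ) := by positivity
        linarith
      refine abs_le'.2 ⟨?_, ?_⟩
      · have := hp 1 (by simp); linarith
      · have := hp (-1) (by simp); linarith
    rw [e1]
    refine (norm_add_le _ _).trans ?_
    calc _ ≤ δ * (σ ^ 2 * u ^ 2 / 2 + ∫ x, (1 - Real.cos (u * x)) ∂ν) +
          δ⁻¹ * (σ ^ 2 * h ^ 2 / 2 + ∫ x, (1 - Real.cos (h * x)) ∂ν) := by linarith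
      _ ≤ _ := by gcongr <;> exact hR _

end

section

variable {γ σ : ℝ} {ν : Measure ℝ}

/-! ### Truncated moments and tails -/

/-- The closed two-sided tail `ν {y : |y| ≥ x}`. -/
noncomputable def closedTail (ν : Measure ℝ) (x : ℝ) : ℝ := (ν {y | x ≤ |y|}).toReal

lemma measurableSet_le_abs (x : ℝ) : MeasurableSet {y : ℝ | x ≤ |y|} :=
  measurableSet_le measurable_const (by fun_prop)

lemma measurableSet_abs_lt (x : ℝ) : MeasurableSet {y : ℝ | |y| < x} :=
  measurableSet_lt (by fun_prop) measurable_const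

lemma measurableSet_shell (x z : ℝ) : MeasurableSet {y : ℝ | x ≤ |y| ∧ |y| < z} :=
  (measurableSet_le_abs x).inter (measurableSet_abs_lt z)

lemma closedTail_nonneg (x : ℝ) : 0 ≤ closedTail ν x := ENNReal.toReal_nonneg
lemma tailPos_nonneg (x : ℝ) : 0 ≤ tailPos ν x := ENNReal.toReal_nonneg
lemma tailNeg_nonneg (x : ℝ) : 0 ≤ tailNeg ν x := ENNReal.toReal_nonneg
lemma tail_nonneg (x : ℝ) : 0 ≤ tail ν x := add_nonneg (tailPos_nonneg x) (tailNeg_nonneg x)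

lemma IsLevyMeasure.closedTail_anti (hν : IsLevyMeasure ν) {x z : ℝ} (hx : 0 < x) (hxz : x ≤ z) :
    closedTail ν z ≤ closedTail ν x :=
  ENNReal.toReal_mono (hν.measure_abs_ge_lt_top hx).ne (measure_mono fun _ hy => hxz.trans hy)

lemma IsLevyMeasure.tailPos_anti (hν : IsLevyMeasure ν) {x z : ℝ} (hx : 0 < x) (hxz : x ≤ z) :
    tailPos ν z ≤ tailPos ν x :=
  ENNReal.toReal_mono (hν.Ioi_lt_top hx).ne (measure_mono (Ioi_subset_Ioi hxz))

lemma IsLevyMeasure.tailNeg_anti (hν : IsLevyMeasure ν) {x z : ℝ} (hx : 0 < x) (hxz : x ≤ z) :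
    tailNeg ν z ≤ tailNeg ν x :=
  ENNReal.toReal_mono (hν.Iio_lt_top hx).ne (measure_mono (Iio_subset_Iio (neg_le_neg hxz)))

lemma IsLevyMeasure.tail_anti (hν : IsLevyMeasure ν) {x z : ℝ} (hx : 0 < x) (hxz : x ≤ z) :
    tail ν z ≤ tail ν x :=
  add_le_add (hν.tailPos_anti hx hxz) (hν.tailNeg_anti hx hxz)

lemma IsLevyMeasure.tail_eq (hν : IsLevyMeasure ν) {x : ℝ} (hx : 0 < x) :
    tail ν x = (ν {y | x < |y|}).toReal := by
  have h : {y : ℝ | x < |y|} = Ioi x ∪ Iio (-x) := by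
    ext y; simp [lt_abs, lt_neg]
  rw [h, measure_union _ measurableSet_Iio, ENNReal.toReal_add (hν.Ioi_lt_top hx).ne
    (hν.Iio_lt_top hx).ne]
  · rfl
  · rw [Set.disjoint_left]
    intro y h1 h2
    simp only [mem_Ioi, mem_Iio] at h1 h2
    linarith

lemma IsLevyMeasure.tail_le_closedTail (hν : IsLevyMeasure ν) {x : ℝ} (hx : 0 < x) :
    tail ν x ≤ closedTail ν x := by
  rw [hν.tail_eq hx]
  exact ENNReal.toReal_mono (hν.measure_abs_ge_lt_top hx).ne
    (measure_mono fun y hy => (show x < |y| from hy).le)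

lemma IsLevyMeasure.closedTail_le_tail (hν : IsLevyMeasure ν) {x z : ℝ} (hx : 0 < x)
    (hxz : x < z) : closedTail ν z ≤ tail ν x := by
  rw [hν.tail_eq hx]
  exact ENNReal.toReal_mono (hν.measure_lt_top_of_subset hx fun y hy => (show x < |y| from hy).le).ne
    (measure_mono fun y hy => hxz.trans_le (show z ≤ |y| from hy))

lemma IsLevyMeasure.integrableOn_sq (hν : IsLevyMeasure ν) (x : ℝ) :
    IntegrableOn (fun y : ℝ => y ^ 2) {y | |y| < x} ν := by
  rw [← integrable_indicator_iff (measurableSet_abs_lt x)]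
  refine hν.integrable_of_le (C := max 1 (x ^ 2))
    ((by fun_prop : Measurable fun y : ℝ => y ^ 2).indicator
      (measurableSet_abs_lt x)).aestronglyMeasurable fun y => ?_
  by_cases hy : y ∈ {y : ℝ | |y| < x}
  · rw [indicator_of_mem hy, Real.norm_of_nonneg (sq_nonneg y)]
    have hy : |y| < x := hy
    have h2 : y ^ 2 ≤ x ^ 2 := by rw [← sq_abs]; have := abs_nonneg y; gcongr
    rcases le_total (y ^ 2) 1 with h | h
    · rw [min_eq_left h]; nlinarith [le_max_left 1 (x ^ 2), sq_nonneg y]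
    · rw [min_eq_right h, mul_one]; exact h2.trans (le_max_right _ _)
  · rw [indicator_of_notMem hy, norm_zero]; positivity

lemma IsLevyMeasure.truncVar_mono (hν : IsLevyMeasure ν) : Monotone (truncVar σ ν) := by
  intro x z hxz
  unfold truncVar
  gcongr 1
  exact setIntegral_mono_set (hν.integrableOn_sq z) (.of_forall fun y => sq_nonneg y)
    (LE.le.eventuallyLE fun y hy => lt_of_lt_of_le hy hxz)

lemma truncVar_nonneg (x : ℝ) : 0 ≤ truncVar σ ν x :=
  add_nonneg (sq_nonneg σ) (integral_nonneg fun y => sq_nonneg y)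

lemma IsLevyMeasure.truncVar_sub (hν : IsLevyMeasure ν) {x z : ℝ} (hxz : x ≤ z) :
    truncVar σ ν z - truncVar σ ν x = ∫ y in {y : ℝ | x ≤ |y| ∧ |y| < z}, y ^ 2 ∂ν := by
  have h : {y : ℝ | |y| < z} = {y | |y| < x} ∪ {y | x ≤ |y| ∧ |y| < z} := by
    ext y
    simp only [mem_ofPred_eq, mem_union]
    constructor
    · intro h; rcases lt_or_ge |y| x with h' | h'
      · exact Or.inl h'
      · exact Or.inr ⟨h', h⟩
    · rintro (h | h)
      · exact h.trans_le hxz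
      · exact h.2
  have hd : Disjoint {y : ℝ | |y| < x} {y | x ≤ |y| ∧ |y| < z} :=
    Set.disjoint_left.2 fun y h1 h2 => absurd (show |y| < x from h1) (not_lt.2 h2.1)
  unfold truncVar
  rw [h, setIntegral_union hd (measurableSet_shell x z) (hν.integrableOn_sq x)
    ((hν.integrableOn_sq z).mono_set fun y hy => hy.2)]
  ring

lemma IsLevyMeasure.shell_lt_top (hν : IsLevyMeasure ν) {x : ℝ} (hx : 0 < x) (z : ℝ) :
    ν {y | x ≤ |y| ∧ |y| < z} < ∞ := hν.measure_lt_top_of_subset hx fun _ hy => hy.1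

lemma IsLevyMeasure.integrableOn_shell (hν : IsLevyMeasure ν) {x : ℝ} (hx : 0 < x) (z : ℝ)
    {h : ℝ → ℝ} (hm : Measurable h) {C : ℝ} (hC : ∀ y, |y| < z → |h y| ≤ C) :
    IntegrableOn h {y | x ≤ |y| ∧ |y| < z} ν := by
  refine Measure.integrableOn_of_bounded (M := C) (hν.shell_lt_top hx z).ne
    hm.aestronglyMeasurable ?_
  exact (ae_restrict_iff' (measurableSet_shell x z)).2 (.of_forall fun y hy => hC y hy.2)

/-- The first absolute moment over the shell `x ≤ |y| < 1`. -/
noncomputable def absMoment (ν : Measure ℝ) (x : ℝ) : ℝ :=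
  ∫ y in {y : ℝ | x ≤ |y| ∧ |y| < 1}, |y| ∂ν

lemma absMoment_nonneg (x : ℝ) : 0 ≤ absMoment ν x := integral_nonneg fun y => abs_nonneg y

lemma IsLevyMeasure.absMoment_anti (hν : IsLevyMeasure ν) {x z : ℝ} (hx : 0 < x) (hxz : x ≤ z) :
    absMoment ν z ≤ absMoment ν x :=
  setIntegral_mono_set (hν.integrableOn_shell hx 1 (by fun_prop) fun y hy => by simpa using hy.le)
    (.of_forall fun y => abs_nonneg y)
    (LE.le.eventuallyLE fun _ hy => ⟨hxz.trans hy.1, hy.2⟩)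

lemma abs_truncMean_le (x : ℝ) : |truncMean γ ν x| ≤ |γ| + absMoment ν x := by
  unfold truncMean absMoment
  refine (abs_sub _ _).trans ?_
  gcongr
  exact abs_integral_le_integral_abs

lemma shell_union {x z w : ℝ} (h1 : x ≤ z) (h2 : z ≤ w) : {y : ℝ | x ≤ |y| ∧ |y| < w} =
    {y | x ≤ |y| ∧ |y| < z} ∪ {y | z ≤ |y| ∧ |y| < w} := by
  ext y
  simp only [mem_ofPred_eq, mem_union]
  constructor
  · intro h; rcases lt_or_ge |y| z with h' | h'
    · exact Or.inl ⟨h.1, h'⟩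
    · exact Or.inr ⟨h', h.2⟩
  · rintro (h | h)
    · exact ⟨h.1, h.2.trans_le h2⟩
    · exact ⟨h1.trans h.1, h.2⟩

lemma shell_disjoint {x z w : ℝ} :
    Disjoint {y : ℝ | x ≤ |y| ∧ |y| < z} {y | z ≤ |y| ∧ |y| < w} :=
  Set.disjoint_left.2 fun _ h1 h2 => absurd h1.2 (not_lt.2 h2.1)

lemma IsLevyMeasure.truncMean_sub (hν : IsLevyMeasure ν) {x z : ℝ} (hx : 0 < x) (hxz : x ≤ z)
    (hz : z ≤ 1) :
    truncMean γ ν z - truncMean γ ν x = ∫ y in {y : ℝ | x ≤ |y| ∧ |y| < z}, y ∂ν := by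
  unfold truncMean
  rw [shell_union hxz hz, setIntegral_union shell_disjoint (measurableSet_shell _ _)
    (hν.integrableOn_shell hx z (C := z) (by fun_prop) fun y hy => hy.le)
    (hν.integrableOn_shell (hx.trans_le hxz) 1 (C := 1) (by fun_prop) fun y hy => hy.le)]
  ring

lemma IsLevyMeasure.absMoment_sub (hν : IsLevyMeasure ν) {x z : ℝ} (hx : 0 < x) (hxz : x ≤ z)
    (hz : z ≤ 1) :
    absMoment ν x - absMoment ν z = ∫ y in {y : ℝ | x ≤ |y| ∧ |y| < z}, |y| ∂ν := by
  unfold absMoment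
  rw [shell_union hxz hz, setIntegral_union shell_disjoint (measurableSet_shell _ _)
    (hν.integrableOn_shell hx z (C := z) (by fun_prop) fun y hy => by simpa using hy.le)
    (hν.integrableOn_shell (hx.trans_le hxz) 1 (C := 1) (by fun_prop) fun y hy => by
      simpa using hy.le)]
  ring

lemma IsLevyMeasure.setIntegral_shell_le (hν : IsLevyMeasure ν) {x z : ℝ} (hx : 0 < x)
    {h : ℝ → ℝ} {C : ℝ} (hC0 : 0 ≤ C) (hC : ∀ y, |y| < z → |h y| ≤ C) :
    |∫ y in {y : ℝ | x ≤ |y| ∧ |y| < z}, h y ∂ν| ≤ C * closedTail ν x := by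
  have := norm_setIntegral_le_of_norm_le_const (f := h) (C := C) (hν.shell_lt_top hx z)
    fun y hy => hC y hy.2
  rw [Real.norm_eq_abs] at this
  refine this.trans ?_
  gcongr
  exact ENNReal.toReal_mono (hν.measure_abs_ge_lt_top hx).ne (measure_mono fun y hy => hy.1)

lemma IsLevyMeasure.integral_min (hν : IsLevyMeasure ν) :
    ∫ x, min (x ^ 2) 1 ∂ν = truncVar 0 ν 1 + closedTail ν 1 := by
  rw [← integral_add_compl (measurableSet_abs_lt 1) hν.integrable_min]
  have h1 : ∫ x in {y : ℝ | |y| < 1}, min (x ^ 2) 1 ∂ν = truncVar 0 ν 1 := by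
    rw [truncVar, zero_pow two_ne_zero, zero_add]
    refine setIntegral_congr_fun (measurableSet_abs_lt 1) fun x hx => min_eq_left ?_
    have hx : |x| < 1 := hx
    rw [← sq_abs]; nlinarith [abs_nonneg x]
  have hc : {y : ℝ | |y| < 1}ᶜ = {y | 1 ≤ |y|} := by ext; simp
  have h2 : ∫ x in {y : ℝ | |y| < 1}ᶜ, min (x ^ 2) 1 ∂ν = closedTail ν 1 := by
    rw [hc, setIntegral_congr_fun (g := fun _ => (1 : ℝ)) (measurableSet_le_abs 1) fun x hx => ?_]
    · simp [closedTail, Measure.real]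
    · have hx : 1 ≤ |x| := hx
      refine min_eq_right ?_
      rw [← sq_abs]; nlinarith [abs_nonneg x]
  rw [h1, h2]

/-- Dominated convergence with the dominating function `x² ∧ 1`. -/
lemma IsLevyMeasure.tendsto_integral_zero (hν : IsLevyMeasure ν) {h : ℝ → ℝ → ℝ}
    (hm : ∀ z, Measurable (h z))
    (hb : ∀ᶠ z in 𝓝[>] (0 : ℝ), ∀ x, |h z x| ≤ min (x ^ 2) 1)
    (hlim : ∀ x, Tendsto (fun z => h z x) (𝓝[>] 0) (𝓝 0)) :
    Tendsto (fun z => ∫ x, h z x ∂ν) (𝓝[>] 0) (𝓝 0) := by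
  have := tendsto_integral_filter_of_dominated_convergence (l := 𝓝[>] (0 : ℝ)) (F := h)
    (f := fun _ => (0 : ℝ)) (μ := ν) (fun x => min (x ^ 2) 1)
    (.of_forall fun z => (hm z).aestronglyMeasurable)
    (hb.mono fun z hz => .of_forall hz) hν.integrable_min
    (.of_forall hlim)
  simpa using this

lemma IsLevyMeasure.tendsto_sq_mul_closedTail (hν : IsLevyMeasure ν) :
    Tendsto (fun z => z ^ 2 * closedTail ν z) (𝓝[>] 0) (𝓝 0) := by
  have := hν.tendsto_integral_zero (h := fun z x => indicator {y : ℝ | z ≤ |y|} (fun _ => z ^ 2 * indicator (Ioo 0 1) 1 z) x)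
    (fun z => measurable_const.indicator (measurableSet_le_abs z)) ?_ ?_
  · refine this.congr' ?_
    filter_upwards [Ioo_mem_nhdsGT one_pos] with z hz
    rw [integral_indicator (measurableSet_le_abs z), setIntegral_const, indicator_of_mem hz,
      Pi.one_apply, mul_one, smul_eq_mul, mul_comm]
    rfl
  · filter_upwards [Ioo_mem_nhdsGT one_pos] with z hz x
    by_cases hx : x ∈ {y : ℝ | z ≤ |y|}
    · rw [indicator_of_mem hx, indicator_of_mem hz, Pi.one_apply, mul_one,
        abs_of_nonneg (sq_nonneg z)]
      have hx : z ≤ |x| := hx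
      refine le_min ?_ ?_
      · rw [← sq_abs x]; have := hz.1; gcongr
      · have := hz.1; have := hz.2; nlinarith
    · rw [indicator_of_notMem hx, abs_zero]; positivity
  · intro x
    have hlim : Tendsto (fun z : ℝ => z ^ 2) (𝓝[>] 0) (𝓝 0) := by
      have : Tendsto (fun z : ℝ => z ^ 2) (𝓝 0) (𝓝 (0 ^ 2)) := (continuous_pow 2).tendsto 0
      rw [zero_pow two_ne_zero] at this
      exact this.mono_left nhdsWithin_le_nhds
    refine squeeze_zero_norm' ?_ hlim
    filter_upwards [Ioo_mem_nhdsGT one_pos] with z hz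
    by_cases hx : x ∈ {y : ℝ | z ≤ |y|}
    · rw [indicator_of_mem hx, indicator_of_mem hz, Pi.one_apply, mul_one,
        Real.norm_of_nonneg (sq_nonneg z)]
    · rw [indicator_of_notMem hx, norm_zero]; positivity

lemma IsLevyMeasure.tendsto_mul_absMoment (hν : IsLevyMeasure ν) :
    Tendsto (fun z => z * absMoment ν z) (𝓝[>] 0) (𝓝 0) := by
  have := hν.tendsto_integral_zero (h := fun z x =>
    indicator {y : ℝ | z ≤ |y| ∧ |y| < 1} (fun y => z * |y| * indicator (Ioi 0) 1 z) x)
    (fun z => (by fun_prop : Measurable fun y : ℝ => z * |y| * indicator (Ioi 0) 1 z).indicator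
      (measurableSet_shell z 1)) ?_ ?_
  · refine this.congr' ?_
    filter_upwards [self_mem_nhdsWithin] with z hz
    rw [integral_indicator (measurableSet_shell z 1), absMoment, ← integral_const_mul]
    simp only [indicator_of_mem hz, Pi.one_apply, mul_one]
  · filter_upwards [self_mem_nhdsWithin] with z hz x
    have hz0 : 0 < z := hz
    by_cases hx : x ∈ {y : ℝ | z ≤ |y| ∧ |y| < 1}
    · rw [indicator_of_mem hx, indicator_of_mem hz, Pi.one_apply, mul_one,
        abs_of_nonneg (by positivity)]
      obtain ⟨h1, h2⟩ := hx
      refine le_min ?_ ?_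
      · rw [← sq_abs x]; nlinarith [abs_nonneg x]
      · nlinarith [abs_nonneg x]
    · rw [indicator_of_notMem hx, abs_zero]; positivity
  · intro x
    have hlim : Tendsto (fun z : ℝ => z * |x|) (𝓝[>] 0) (𝓝 0) := by
      have : Tendsto (fun z : ℝ => z * |x|) (𝓝 0) (𝓝 (0 * |x|)) :=
        (continuous_mul_const |x|).tendsto 0
      rw [zero_mul] at this
      exact this.mono_left nhdsWithin_le_nhds
    refine squeeze_zero_norm' ?_ hlim
    filter_upwards [self_mem_nhdsWithin] with z hz
    have hz0 : 0 < z := hz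
    by_cases hx : x ∈ {y : ℝ | z ≤ |y| ∧ |y| < 1}
    · rw [indicator_of_mem hx, indicator_of_mem hz, Pi.one_apply, mul_one,
        Real.norm_of_nonneg (by positivity)]
    · rw [indicator_of_notMem hx, norm_zero]; positivity

/-- A geometrically decaying bound on the tails at the scales `z, z / 2, z / 4, …` bounds the
truncated moment at `z`. -/
lemma IsLevyMeasure.lintegral_pow_le (hν : IsLevyMeasure ν) {p : ℕ} {G : ℝ → ℝ} {q d : ℝ}
    (hq0 : 0 ≤ q) (hq1 : q < 1) (hG : ∀ z ∈ Ioo 0 d, z ^ p * closedTail ν (z / 2) ≤ G z)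
    (hGq : ∀ z ∈ Ioo 0 d, G (z / 2) ≤ q * G z) {z : ℝ} (hz : z ∈ Ioo 0 d) :
    ∫⁻ y in {y : ℝ | |y| < z}, ENNReal.ofReal (|y| ^ p) ∂ν ≤ ENNReal.ofReal (G z / (1 - q)) := by
  have hG0 : ∀ z ∈ Ioo 0 d, 0 ≤ G z := fun z hz => le_trans
    (mul_nonneg (pow_nonneg hz.1.le _) (closedTail_nonneg _)) (hG z hz)
  have h1q : 0 < 1 - q := by linarith
  have hhalf : ∀ z ∈ Ioo 0 d, z / 2 ∈ Ioo 0 d := fun z hz =>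
    ⟨by linarith [hz.1], by linarith [hz.1, hz.2]⟩
  have hone : ∀ z ∈ Ioo 0 d, ∫⁻ y in {y : ℝ | z / 2 ≤ |y| ∧ |y| < z}, ENNReal.ofReal (|y| ^ p) ∂ν
      ≤ ENNReal.ofReal (G z) := by
    intro z hz
    have hz2 := (hhalf z hz).1
    calc _ ≤ ∫⁻ y in {y : ℝ | z / 2 ≤ |y| ∧ |y| < z}, ENNReal.ofReal (z ^ p) ∂ν := by
          refine setLIntegral_mono (by fun_prop) fun y hy => ENNReal.ofReal_le_ofReal ?_
          exact pow_le_pow_left₀ (abs_nonneg y) hy.2.le p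
      _ = ENNReal.ofReal (z ^ p) * ν {y : ℝ | z / 2 ≤ |y| ∧ |y| < z} := setLIntegral_const _ _
      _ ≤ ENNReal.ofReal (z ^ p) * ν {y : ℝ | z / 2 ≤ |y|} := by
          gcongr
          exact fun h => h.1
      _ = ENNReal.ofReal (z ^ p * closedTail ν (z / 2)) := by
          rw [ENNReal.ofReal_mul (pow_nonneg hz.1.le _), closedTail,
            ENNReal.ofReal_toReal (hν.measure_abs_ge_lt_top hz2).ne]
      _ ≤ _ := ENNReal.ofReal_le_ofReal (hG z hz)
  -- sum the geometric series over finitely many shells, by induction from the innermost one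
  have hsum : ∀ n : ℕ, ∀ z ∈ Ioo 0 d, ∫⁻ y in {y : ℝ | z / 2 ^ n ≤ |y| ∧ |y| < z},
      ENNReal.ofReal (|y| ^ p) ∂ν ≤ ENNReal.ofReal (G z / (1 - q)) := by
    intro n
    induction n with
    | zero =>
      intro z _
      have : {y : ℝ | z / 2 ^ 0 ≤ |y| ∧ |y| < z} = ∅ := by
        ext y; simp
      rw [this]; simp
    | succ n ih =>
      intro z hz
      have h2 : z / 2 ^ (n + 1) ≤ z / 2 := by
        have : (1 : ℝ) ≤ 2 ^ n := one_le_pow₀ (by norm_num)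
        rw [pow_succ, mul_comm, ← div_div]
        exact div_le_self (by linarith [hz.1]) this
      rw [shell_union h2 (by linarith [hz.1] : z / 2 ≤ z)]
      refine (lintegral_union_le _ _ _).trans ?_
      have h3 := ih (z / 2) (hhalf z hz)
      rw [div_div, ← pow_succ'] at h3
      have h4 : G (z / 2) / (1 - q) ≤ q * G z / (1 - q) := by
        have := hGq z hz
        gcongr
      calc _ ≤ ENNReal.ofReal (q * G z / (1 - q)) + ENNReal.ofReal (G z) :=
            add_le_add (h3.trans (ENNReal.ofReal_le_ofReal h4)) (hone z hz)
        _ = ENNReal.ofReal (G z / (1 - q)) := by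
            rw [← ENNReal.ofReal_add (div_nonneg (mul_nonneg hq0 (hG0 z hz)) h1q.le) (hG0 z hz)]
            congr 1
            field_simp; ring
  have hU : ⋃ n : ℕ, {y : ℝ | z / 2 ^ n ≤ |y| ∧ |y| < z} = {y : ℝ | 0 < |y| ∧ |y| < z} := by
    ext y
    simp only [mem_iUnion, mem_ofPred_eq, exists_and_right, and_congr_left_iff]
    intro _
    constructor
    · rintro ⟨n, hn⟩
      exact lt_of_lt_of_le (by have := hz.1; positivity) hn
    · intro hy
      have := ((tendsto_pow_atTop_atTop_of_one_lt (r := (2 : ℝ)) one_lt_two).const_div_atTop z).eventually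
        (gt_mem_nhds hy)
      obtain ⟨n, hn⟩ := this.exists
      exact ⟨n, le_of_lt hn⟩
  have hdir : Directed (· ⊆ ·) fun n : ℕ => {y : ℝ | z / 2 ^ n ≤ |y| ∧ |y| < z} := by
    refine Monotone.directed_le fun m n hmn y hy => ⟨le_trans ?_ hy.1, hy.2⟩
    have := hz.1
    gcongr
    norm_num
  -- `ν` does not charge `0`, so the shells exhaust the ball
  have hae : ∀ᵐ x ∂ν, x ≠ 0 := by
    rw [ae_iff]; simpa using hν.1
  have hset : ({y : ℝ | |y| < z} : Set ℝ) =ᵐ[ν] {y : ℝ | 0 < |y| ∧ |y| < z} := by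
    filter_upwards [hae] with y hy
    have : 0 < |y| := abs_pos.2 hy
    apply propext
    show |y| < z ↔ 0 < |y| ∧ |y| < z
    tauto
  rw [setLIntegral_congr hset, ← hU, setLIntegral_iUnion_of_directed _ hdir]
  exact iSup_le fun n => hsum n z hz

/-! ### Zooming in -/

/-- The Lévy measure after the space is divided by `z` and the time is multiplied by `e`. -/
noncomputable def zoom (e z : ℝ) (ν : Measure ℝ) : Measure ℝ :=
  ENNReal.ofReal e • ν.map (fun x => x / z)

variable {e z : ℝ}

lemma measurableEmbedding_div (hz : z ≠ 0) : MeasurableEmbedding (fun x : ℝ => x / z) := by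
  simpa [div_eq_mul_inv] using
    (Homeomorph.mulRight₀ z⁻¹ (inv_ne_zero hz)).measurableEmbedding

lemma zoom_apply (hz : z ≠ 0) (s : Set ℝ) :
    zoom e z ν s = ENNReal.ofReal e * ν {x | x / z ∈ s} := by
  rw [zoom, Measure.smul_apply, smul_eq_mul, (measurableEmbedding_div hz).map_apply]
  rfl

lemma integral_zoom {E : Type*} [NormedAddCommGroup E] [NormedSpace ℝ E] (he : 0 ≤ e) (hz : z ≠ 0)
    (g : ℝ → E) : ∫ x, g x ∂(zoom e z ν) = e • ∫ x, g (x / z) ∂ν := by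
  rw [zoom, integral_smul_measure, (measurableEmbedding_div hz).integral_map,
    ENNReal.toReal_ofReal he]

lemma setIntegral_zoom {E : Type*} [NormedAddCommGroup E] [NormedSpace ℝ E] (he : 0 ≤ e)
    (hz : z ≠ 0) (g : ℝ → E) {s : Set ℝ} (hs : MeasurableSet s) :
    ∫ x in s, g x ∂(zoom e z ν) = e • ∫ x in {x | x / z ∈ s}, g (x / z) ∂ν := by
  rw [← integral_indicator hs, integral_zoom he hz, ← integral_indicator]
  · rfl
  · exact (measurableEmbedding_div hz).measurable hs

lemma IsLevyMeasure.zoom (hν : IsLevyMeasure ν) (hz : 0 < z) : IsLevyMeasure (zoom e z ν) := by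
  constructor
  · rw [zoom_apply hz.ne']
    have : {x : ℝ | x / z ∈ ({0} : Set ℝ)} = {0} := by
      ext x; simp [hz.ne']
    rw [this, hν.1, mul_zero]
  · rw [ZoomingIn.zoom, lintegral_smul_measure, (measurableEmbedding_div hz.ne').lintegral_map]
    refine ENNReal.mul_lt_top ENNReal.ofReal_lt_top ?_
    have hi : Integrable (fun x : ℝ => min ((x / z) ^ 2) 1) ν := by
      refine hν.integrable_of_le (C := max 1 (1 / z ^ 2))
        (by fun_prop : Measurable fun x : ℝ => min ((x / z) ^ 2) 1).aestronglyMeasurable fun x => ?_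
      rw [Real.norm_of_nonneg (by positivity)]
      rcases le_total (x ^ 2) 1 with h | h
      · rw [min_eq_left h]
        calc min ((x / z) ^ 2) 1 ≤ (x / z) ^ 2 := min_le_left _ _
          _ = 1 / z ^ 2 * x ^ 2 := by field_simp
          _ ≤ _ := by gcongr; exact le_max_right _ _
      · rw [min_eq_right h, mul_one]
        exact (min_le_right _ _).trans (le_max_left _ _)
    have := hi.2
    rwa [hasFiniteIntegral_iff_ofReal (.of_forall fun x => by positivity)] at this

lemma abs_div_lt_iff (hz : 0 < z) (x w : ℝ) : |x / z| < w ↔ |x| < z * w := by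
  rw [abs_div, abs_of_pos hz, div_lt_iff₀ hz, mul_comm]

lemma le_abs_div_iff (hz : 0 < z) (x w : ℝ) : w ≤ |x / z| ↔ z * w ≤ |x| := by
  rw [abs_div, abs_of_pos hz, le_div_iff₀ hz, mul_comm]

lemma tailPos_zoom (he : 0 ≤ e) (hz : 0 < z) (x : ℝ) :
    tailPos (zoom e z ν) x = e * tailPos ν (z * x) := by
  have : {y : ℝ | y / z ∈ Ioi x} = Ioi (z * x) := by
    ext y; simp [lt_div_iff₀ hz, mul_comm]
  rw [tailPos, zoom_apply hz.ne', ENNReal.toReal_mul, ENNReal.toReal_ofReal he, this]; rfl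

lemma tailNeg_zoom (he : 0 ≤ e) (hz : 0 < z) (x : ℝ) :
    tailNeg (zoom e z ν) x = e * tailNeg ν (z * x) := by
  have : {y : ℝ | y / z ∈ Iio (-x)} = Iio (-(z * x)) := by
    ext y; simp [div_lt_iff₀ hz, mul_comm]
  rw [tailNeg, zoom_apply hz.ne', ENNReal.toReal_mul, ENNReal.toReal_ofReal he, this]; rfl

lemma closedTail_zoom (he : 0 ≤ e) (hz : 0 < z) (x : ℝ) :
    closedTail (zoom e z ν) x = e * closedTail ν (z * x) := by
  have : {y : ℝ | y / z ∈ {y : ℝ | x ≤ |y|}} = {y | z * x ≤ |y|} := by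
    ext y; exact le_abs_div_iff hz y x
  rw [closedTail, zoom_apply hz.ne', ENNReal.toReal_mul, ENNReal.toReal_ofReal he, this]; rfl

lemma truncVar_zoom (he : 0 ≤ e) (hz : 0 < z) (x : ℝ) :
    truncVar (√e * σ / z) (zoom e z ν) x = e * truncVar σ ν (z * x) / z ^ 2 := by
  have : {y : ℝ | y / z ∈ {y : ℝ | |y| < x}} = {y | |y| < z * x} := by
    ext y; exact abs_div_lt_iff hz y x
  rw [truncVar, setIntegral_zoom he hz.ne' _ (measurableSet_abs_lt x), this, truncVar]
  simp only [div_pow, mul_pow, Real.sq_sqrt he, smul_eq_mul]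
  rw [integral_div]
  ring

/-- Zooming in acts on Lévy exponents by a change of the triplet. The drift of the new triplet
collects the jumps between the old and the new truncation level. -/
lemma charExp_zoom (hν : IsLevyMeasure ν) (he : 0 ≤ e) (hz : 0 < z) (hz1 : z ≤ 1) (u : ℝ) :
    charExp (e * truncMean γ ν z / z) (√e * σ / z) (zoom e z ν) u =
      (e : ℂ) * charExp γ σ ν (u / z) := by
  set S := {y : ℝ | z ≤ |y| ∧ |y| < 1} with hS
  have hker : ∀ x : ℝ, levyKernel u (x / z) = levyKernel (u / z) x +
      S.indicator (fun y : ℝ => ((u / z : ℝ) : ℂ) * Complex.I * (y : ℂ)) x := by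
    intro x
    have h1 : (u : ℂ) * Complex.I * ((x / z : ℝ) : ℂ) = ((u / z : ℝ) : ℂ) * Complex.I * x := by
      push_cast; ring
    have h2 : |x / z| < 1 ↔ |x| < z := by rw [abs_div_lt_iff hz, mul_one]
    unfold levyKernel
    rw [h1, if_congr h2 rfl rfl]
    by_cases h3 : |x| < z
    · have h4 : x ∉ S := fun h => absurd h3 (not_lt.2 h.1)
      rw [if_pos h3, if_pos (h3.trans_le hz1), indicator_of_notMem h4, add_zero]
    · by_cases h5 : |x| < 1
      · have h4 : x ∈ S := ⟨not_lt.1 h3, h5⟩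
        rw [if_neg h3, if_pos h5, indicator_of_mem h4]; ring
      · have h4 : x ∉ S := fun h => h5 h.2
        rw [if_neg h3, if_neg h5, indicator_of_notMem h4, add_zero]
  have hSm : MeasurableSet S := measurableSet_shell z 1
  have hi : IntegrableOn (fun y : ℝ => y) S ν :=
    hν.integrableOn_shell hz 1 (C := 1) (by fun_prop) fun y hy => hy.le
  have hi2 : Integrable (S.indicator fun y : ℝ => ((u / z : ℝ) : ℂ) * Complex.I * (y : ℂ)) ν := by
    rw [integrable_indicator_iff hSm]
    exact (hi.ofReal (𝕜 := ℂ)).const_mul _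
  have hint : ∫ x, levyKernel u (x / z) ∂ν = ∫ x, levyKernel (u / z) x ∂ν +
      ((u / z : ℝ) : ℂ) * Complex.I * ((∫ y in S, y ∂ν : ℝ) : ℂ) := by
    simp only [hker]
    rw [integral_add (hν.integrable_levyKernel _) hi2, integral_indicator hSm,
      integral_const_mul, integral_complex_ofReal]
  have hz' : (z : ℂ) ≠ 0 := by exact_mod_cast hz.ne'
  rw [charExp_eq, charExp_eq, integral_zoom he hz.ne', hint, truncMean]
  simp only [div_pow, mul_pow, Real.sq_sqrt he, Complex.real_smul]
  push_cast
  field_simp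
  ring

end

section

variable {γ σ : ℝ} {ν : Measure ℝ}

/-! ### Bounds for the Lévy exponent -/

lemma isLevyMeasure_zero : IsLevyMeasure (0 : Measure ℝ) := ⟨by simp, by simp⟩

lemma charExp_zero_measure (γ σ u : ℝ) :
    charExp γ σ 0 u = γ * u * Complex.I - ((σ ^ 2 * u ^ 2 / 2 : ℝ) : ℂ) := by
  rw [charExp_eq, integral_zero_measure, add_zero]

/-- A Lévy exponent is close to its drift part if there is little Gaussian and jump activity. -/
lemma norm_charExp_sub_drift_le (hν : IsLevyMeasure ν) (u : ℝ) :
    ‖charExp γ σ ν u - γ * u * Complex.I‖ ≤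
      (3 * u ^ 2 + 2) * (truncVar σ ν 1 + closedTail ν 1) := by
  have h1 : ‖∫ x, levyKernel u x ∂ν‖ ≤ (3 * u ^ 2 + 2) * (truncVar 0 ν 1 + closedTail ν 1) := by
    rw [← hν.integral_min, ← integral_const_mul]
    exact norm_integral_le_of_norm_le (hν.integrable_min.const_mul _)
      (.of_forall fun x => norm_levyKernel_le u x)
  have h2 : truncVar σ ν 1 = σ ^ 2 + truncVar 0 ν 1 := by
    simp [truncVar]
  rw [charExp_eq, h2]
  have h3 : (γ * u * Complex.I - ((σ ^ 2 * u ^ 2 / 2 : ℝ) : ℂ) + ∫ x, levyKernel u x ∂ν) -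
      γ * u * Complex.I = ((-(σ ^ 2 * u ^ 2 / 2) : ℝ) : ℂ) + ∫ x, levyKernel u x ∂ν := by
    push_cast; ring
  rw [h3]
  refine (norm_add_le _ _).trans ?_
  rw [Complex.norm_real, Real.norm_eq_abs, abs_neg, abs_of_nonneg (by positivity)]
  nlinarith [sq_nonneg σ, sq_nonneg u, mul_nonneg (sq_nonneg σ) (sq_nonneg u)]

lemma norm_exp_sub_taylor_two_le (y : ℝ) :
    ‖Complex.exp (y * Complex.I) - 1 - y * Complex.I + ((y ^ 2 / 2 : ℝ) : ℂ)‖ ≤ 4 * |y| ^ 3 := by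
  have hn : ‖(y : ℂ) * Complex.I‖ = |y| := by simp
  have hy0 := abs_nonneg y
  rcases le_total |y| 1 with h | h
  · have := Complex.exp_bound (x := y * Complex.I) (by rw [hn]; exact h) (n := 3) (by norm_num)
    rw [hn] at this
    simp only [Finset.sum_range_succ, Finset.sum_range_zero, mul_pow, Complex.I_sq] at this
    have e : Complex.exp (y * Complex.I) - 1 - y * Complex.I + ((y ^ 2 / 2 : ℝ) : ℂ) =
        Complex.exp (y * Complex.I) - (0 + (y : ℂ) ^ 0 * Complex.I ^ 0 / (Nat.factorial 0 : ℂ) +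
          (y : ℂ) ^ 1 * Complex.I ^ 1 / (Nat.factorial 1 : ℂ) +
          (y : ℂ) ^ 2 * -1 / (Nat.factorial 2 : ℂ)) := by
      simp only [Nat.factorial]; push_cast; ring
    rw [e]
    refine this.trans ?_
    rw [mul_comm]
    refine mul_le_mul_of_nonneg_right ?_ (by positivity)
    norm_num [Nat.factorial]
  · calc _ ≤ ‖Complex.exp (y * Complex.I) - 1‖ + ‖(y : ℂ) * Complex.I‖ + ‖((y ^ 2 / 2 : ℝ) : ℂ)‖ :=
        (norm_add_le _ _).trans (by gcongr; exact norm_sub_le _ _)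
      _ ≤ 2 + |y| + y ^ 2 / 2 := by
          rw [hn, Complex.norm_real, Real.norm_of_nonneg (by positivity)]
          gcongr; exact norm_exp_sub_one_le_two y
      _ ≤ 4 * |y| ^ 3 := by
          rw [← sq_abs]
          nlinarith [mul_nonneg hy0 hy0, mul_nonneg (mul_nonneg hy0 hy0) (sub_nonneg.2 h),
            mul_nonneg hy0 (sub_nonneg.2 h)]

/-- A Lévy exponent is close to its Gaussian part if most of the truncated variance comes from
jumps below a small level `δ`. -/
lemma norm_charExp_add_gaussian_le (hν : IsLevyMeasure ν) (u : ℝ) {δ : ℝ} (hδ0 : 0 < δ)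
    (hδ1 : δ ≤ 1) :
    ‖charExp γ σ ν u + ((truncVar σ ν 1 * u ^ 2 / 2 : ℝ) : ℂ)‖ ≤
      |γ| * |u| + (4 * |u| ^ 3 * (δ * truncVar σ ν 1) +
        4 * u ^ 2 * (truncVar σ ν 1 - truncVar σ ν δ) + 2 * closedTail ν 1) := by
  set A := {y : ℝ | |y| < 1} with hA
  set B := {y : ℝ | δ ≤ |y| ∧ |y| < 1} with hB
  set D := {y : ℝ | 1 ≤ |y|} with hD
  have hAm : MeasurableSet A := measurableSet_abs_lt 1
  have hBm : MeasurableSet B := measurableSet_shell δ 1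
  have hDm : MeasurableSet D := measurableSet_le_abs 1
  set h : ℝ → ℂ := fun x => levyKernel u x + A.indicator (fun x : ℝ => ((u ^ 2 / 2 * x ^ 2 : ℝ) : ℂ)) x
    with hh
  have hsqA : IntegrableOn (fun y : ℝ => y ^ 2) A ν := hν.integrableOn_sq 1
  have hsqB : IntegrableOn (fun y : ℝ => y ^ 2) B ν := hsqA.mono_set fun y hy => hy.2
  have hcast : ∀ c : ℝ, Integrable (A.indicator fun x : ℝ => ((c * x ^ 2 : ℝ) : ℂ)) ν := fun c => by
    rw [integrable_indicator_iff hAm]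
    exact (hsqA.const_mul c).ofReal
  have hint : ∫ x, h x ∂ν = ∫ x, levyKernel u x ∂ν +
      ((u ^ 2 / 2 * ∫ y in A, y ^ 2 ∂ν : ℝ) : ℂ) := by
    rw [integral_add (hν.integrable_levyKernel u) (hcast _), integral_indicator hAm,
      integral_complex_ofReal, integral_const_mul]
  have e1 : charExp γ σ ν u + ((truncVar σ ν 1 * u ^ 2 / 2 : ℝ) : ℂ) =
      ((γ * u : ℝ) : ℂ) * Complex.I + ∫ x, h x ∂ν := by
    rw [hint, charExp_eq, truncVar]; push_cast; ring
  -- the cubic Taylor bound on `|x| < δ`, the quadratic one on `δ ≤ |x| < 1`, the trivial one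
  -- beyond
  set b : ℝ → ℝ := fun x => A.indicator (fun x => 4 * |u| ^ 3 * δ * x ^ 2) x +
    B.indicator (fun x => 4 * u ^ 2 * x ^ 2) x + D.indicator (fun _ => 2) x with hb
  have hbA : Integrable (A.indicator fun x : ℝ => 4 * |u| ^ 3 * δ * x ^ 2) ν :=
    (integrable_indicator_iff hAm).2 (hsqA.const_mul _)
  have hbB : Integrable (B.indicator fun x : ℝ => 4 * u ^ 2 * x ^ 2) ν :=
    (integrable_indicator_iff hBm).2 (hsqB.const_mul _)
  have hbD : Integrable (D.indicator fun _ : ℝ => (2 : ℝ)) ν :=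
    (integrable_indicator_iff hDm).2 (integrableOn_const (hν.measure_abs_ge_lt_top one_pos).ne)
  have hbint : ∫ x, b x ∂ν = 4 * |u| ^ 3 * δ * (truncVar σ ν 1 - σ ^ 2) +
      4 * u ^ 2 * (truncVar σ ν 1 - truncVar σ ν δ) + 2 * closedTail ν 1 := by
    have h0 : ∫ x, b x ∂ν = ∫ x, (A.indicator (fun x => 4 * |u| ^ 3 * δ * x ^ 2) x +
        B.indicator (fun x => 4 * u ^ 2 * x ^ 2) x) ∂ν + ∫ x, D.indicator (fun _ => (2 : ℝ)) x ∂ν :=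
      integral_add (hbA.add hbB) hbD
    rw [h0, integral_add hbA hbB, integral_indicator hAm, integral_indicator hBm,
      integral_indicator hDm, integral_const_mul, integral_const_mul, setIntegral_const,
      hν.truncVar_sub hδ1, truncVar]
    simp only [closedTail, Measure.real, smul_eq_mul]
    ring
  have hle : ∀ x, ‖h x‖ ≤ b x := by
    intro x
    simp only [hh, hb]
    rcases lt_or_ge |x| 1 with hx | hx
    · have hxA : x ∈ A := hx
      have hxD : x ∉ D := fun h => absurd hx (not_lt.2 h)
      rw [indicator_of_mem hxA, indicator_of_mem hxA, indicator_of_notMem hxD, levyKernel_of_lt hx]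
      have e2 : ((u ^ 2 / 2 * x ^ 2 : ℝ) : ℂ) = (((u * x) ^ 2 / 2 : ℝ) : ℂ) := by push_cast; ring
      rw [e2]
      rcases lt_or_ge |x| δ with hxδ | hxδ
      · have hxB : x ∉ B := fun h => absurd hxδ (not_lt.2 h.1)
        rw [indicator_of_notMem hxB]
        refine (norm_exp_sub_taylor_two_le _).trans ?_
        rw [abs_mul, mul_pow, ← sq_abs x]
        have : |x| ^ 3 ≤ δ * |x| ^ 2 := by
          rw [pow_succ, mul_comm]; gcongr
        have hu : 0 ≤ |u| ^ 3 := by positivity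
        nlinarith
      · have hxB : x ∈ B := ⟨hxδ, hx⟩
        rw [indicator_of_mem hxB]
        have h1 := norm_add_le (Complex.exp ((u * x : ℝ) * Complex.I) - 1 -
          ((u * x : ℝ) : ℂ) * Complex.I) (((u * x) ^ 2 / 2 : ℝ) : ℂ)
        have h2 := norm_exp_sub_one_sub_le (u * x)
        rw [Complex.norm_real, Real.norm_of_nonneg (by positivity)] at h1
        have h3 : 0 ≤ 4 * |u| ^ 3 * δ * x ^ 2 := by positivity
        have h4 : 0 ≤ (u * x) ^ 2 := by positivity
        have h5 : (u * x) ^ 2 = u ^ 2 * x ^ 2 := by ring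
        nlinarith
    · have hxA : x ∉ A := fun h => absurd hx (not_le.2 h)
      have hxB : x ∉ B := fun h => absurd hx (not_le.2 h.2)
      have hxD : x ∈ D := hx
      rw [indicator_of_notMem hxA, indicator_of_notMem hxA, indicator_of_notMem hxB,
        indicator_of_mem hxD, levyKernel_of_le hx, add_zero, add_zero, zero_add]
      exact norm_exp_sub_one_le_two _
  rw [e1]
  refine (norm_add_le _ _).trans ?_
  have h1 : ‖((γ * u : ℝ) : ℂ) * Complex.I‖ = |γ| * |u| := by simp
  have h2 : ‖∫ x, h x ∂ν‖ ≤ ∫ x, b x ∂ν :=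
    norm_integral_le_of_norm_le ((hbA.add hbB).add hbD) (.of_forall hle)
  rw [hbint] at h2
  have h3 : 4 * |u| ^ 3 * δ * (truncVar σ ν 1 - σ ^ 2) ≤ 4 * |u| ^ 3 * (δ * truncVar σ ν 1) := by
    have : 0 ≤ 4 * |u| ^ 3 * δ * σ ^ 2 := by positivity
    nlinarith
  rw [h1]
  linarith

/-! ### Slow variation of the truncated variance -/

/-- Jumps of size between `z` and `2z` contribute at least `z²` each to the truncated variance. -/
lemma IsLevyMeasure.mul_shell_le (hν : IsLevyMeasure ν) {z : ℝ} (hz : 0 < z) :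
    z ^ 2 * (closedTail ν z - closedTail ν (2 * z)) ≤ truncVar σ ν (2 * z) - truncVar σ ν z := by
  set S := {y : ℝ | z ≤ |y| ∧ |y| < 2 * z} with hS
  have hset : {y : ℝ | z ≤ |y|} = S ∪ {y | 2 * z ≤ |y|} := by
    ext y
    simp only [hS, mem_ofPred_eq, mem_union]
    constructor
    · intro h; rcases lt_or_ge |y| (2 * z) with h' | h'
      · exact Or.inl ⟨h, h'⟩
      · exact Or.inr h'
    · rintro (h | h)
      · exact h.1
      · linarith
  have hfin : ν S < ∞ := hν.shell_lt_top hz _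
  have h1 : closedTail ν z = (ν S).toReal + closedTail ν (2 * z) := by
    rw [closedTail, hset, measure_union _ (measurableSet_le_abs _), ENNReal.toReal_add hfin.ne
      (hν.measure_abs_ge_lt_top (by positivity)).ne]
    · rfl
    · exact Set.disjoint_left.2 fun y h1 h2 => absurd h1.2 (not_lt.2 h2)
  rw [hν.truncVar_sub (by linarith), h1]
  have h2 : ∫ y in S, z ^ 2 ∂ν ≤ ∫ y in S, y ^ 2 ∂ν := by
    refine setIntegral_mono_on (integrableOn_const hfin.ne)
      ((hν.integrableOn_sq (2 * z)).mono_set fun y hy => hy.2) (measurableSet_shell _ _) ?_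
    intro y hy
    rw [← sq_abs y]
    have := hy.1
    gcongr
  rw [setIntegral_const, smul_eq_mul, Measure.real] at h2
  linarith

lemma IsLevyMeasure.mul_absMoment_shell_le (hν : IsLevyMeasure ν) {z : ℝ} (hz : 0 < z)
    (hz1 : 2 * z ≤ 1) :
    z * (absMoment ν z - absMoment ν (2 * z)) ≤ truncVar σ ν (2 * z) - truncVar σ ν z := by
  rw [hν.truncVar_sub (by linarith), hν.absMoment_sub hz (by linarith) hz1, ← integral_const_mul]
  refine setIntegral_mono_on ?_ ((hν.integrableOn_sq (2 * z)).mono_set fun y hy => hy.2)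
    (measurableSet_shell _ _) ?_
  · exact hν.integrableOn_shell hz _ (C := z * (2 * z)) (by fun_prop) fun y hy => by
      rw [abs_mul, abs_abs, abs_of_pos hz]; gcongr
  · intro y hy
    rw [← sq_abs y]
    have := hy.1
    nlinarith [abs_nonneg y]

lemma RegVaryingAtZero.exists_pos {ρ : ℝ} {f : ℝ → ℝ} (h : RegVaryingAtZero ρ f) :
    ∃ d, 0 < d ∧ d ≤ 1 ∧ ∀ z ∈ Ioc 0 d, 0 < f z := by
  obtain ⟨⟨δ, hδ, hpos, -⟩, -⟩ := h
  refine ⟨min 1 (δ / 2), by positivity, min_le_left _ _, fun z hz => hpos z ⟨hz.1, ?_⟩⟩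
  have := hz.2.trans (min_le_right _ _)
  linarith

lemma RegVaryingAtZero.eventually_pos {ρ : ℝ} {f : ℝ → ℝ} (h : RegVaryingAtZero ρ f) :
    ∀ᶠ z in 𝓝[>] 0, 0 < f z := by
  obtain ⟨d, hd, -, h⟩ := h.exists_pos
  filter_upwards [Ioc_mem_nhdsGT hd] with z hz using h z hz

/-- If the truncated variance is slowly varying, then the tails and the truncated mean are of
smaller order. -/
lemma tendsto_div_truncVar_of_slowlyVarying (hν : IsLevyMeasure ν)
    (hv : RegVaryingAtZero 0 (truncVar σ ν)) :
    Tendsto (fun z => z ^ 2 * closedTail ν z / truncVar σ ν z) (𝓝[>] 0) (𝓝 0) ∧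
      Tendsto (fun z => z * truncMean γ ν z / truncVar σ ν z) (𝓝[>] 0) (𝓝 0) := by
  obtain ⟨d, hd, hd1, hpos⟩ := hv.exists_pos
  have hratio : Tendsto (fun z => truncVar σ ν (2 * z) / truncVar σ ν z) (𝓝[>] 0) (𝓝 1) := by
    have := hv.2 2 two_pos
    rwa [Real.rpow_zero] at this
  have hη : Tendsto (fun z => truncVar σ ν (2 * z) / truncVar σ ν z - 1) (𝓝[>] 0) (𝓝 0) := by
    have := hratio.sub_const 1
    rwa [sub_self] at this
  have hsmall : ∀ᶠ z in 𝓝[>] (0 : ℝ), z ∈ Ioo 0 (d / 2) := Ioo_mem_nhdsGT (by positivity)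
  constructor
  · refine tendsto_zero_of_tendsto_contraction (q₀ := 1 / 4)
        (q := fun z => 1 / 4 * (truncVar σ ν (2 * z) / truncVar σ ν z)) (by norm_num) (by norm_num) hd ?_
      (by have := hratio.const_mul (1 / 4 : ℝ); rwa [mul_one] at this) hη ?_ ?_
    · intro a ha
      refine ⟨d ^ 2 * closedTail ν a / truncVar σ ν a, fun z hz => ?_⟩
      have h1 := hν.closedTail_anti ha.1 hz.1
      have h2 := hν.truncVar_mono (σ := σ) hz.1
      have h3 := hpos a ⟨ha.1, ha.2.le⟩
      have h4 := closedTail_nonneg (ν := ν) a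
      have h7 := closedTail_nonneg (ν := ν) z
      have h5 := ha.1.trans_le hz.1
      have h6 := hz.2
      gcongr
    · filter_upwards [hsmall] with z hz
      exact div_nonneg (mul_nonneg (sq_nonneg _) (closedTail_nonneg _)) (truncVar_nonneg _)
    · filter_upwards [hsmall] with z hz
      have h1 := hpos z ⟨hz.1, by linarith [hz.2, hz.1]⟩
      have h2 := hpos (2 * z) ⟨by linarith [hz.1], by linarith [hz.2]⟩
      have h3 := hν.mul_shell_le (σ := σ) hz.1
      rw [div_le_iff₀ h1]
      have : (1 / 4 * (truncVar σ ν (2 * z) / truncVar σ ν z) *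
          ((2 * z) ^ 2 * closedTail ν (2 * z) / truncVar σ ν (2 * z)) +
          (truncVar σ ν (2 * z) / truncVar σ ν z - 1)) * truncVar σ ν z =
          z ^ 2 * closedTail ν (2 * z) + (truncVar σ ν (2 * z) - truncVar σ ν z) := by
        field_simp; ring
      rw [this]; linarith
  · have key : Tendsto (fun z => z * (|γ| + absMoment ν z) / truncVar σ ν z) (𝓝[>] 0) (𝓝 0) := by
      refine tendsto_zero_of_tendsto_contraction (q₀ := 1 / 2)
        (q := fun z => 1 / 2 * (truncVar σ ν (2 * z) / truncVar σ ν z)) (by norm_num) (by norm_num) hd ?_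
        (by have := hratio.const_mul (1 / 2 : ℝ); rwa [mul_one] at this) hη ?_ ?_
      · intro a ha
        refine ⟨d * (|γ| + absMoment ν a) / truncVar σ ν a, fun z hz => ?_⟩
        have h1 := hν.absMoment_anti ha.1 hz.1
        have h2 := hν.truncVar_mono (σ := σ) hz.1
        have h3 := hpos a ⟨ha.1, ha.2.le⟩
        have h4 := absMoment_nonneg (ν := ν) a
        have h7 := absMoment_nonneg (ν := ν) z
        have h5 := ha.1.trans_le hz.1
        have h6 := hz.2
        gcongr
      · filter_upwards [hsmall] with z hz
        exact div_nonneg (mul_nonneg hz.1.le (add_nonneg (abs_nonneg _) (absMoment_nonneg _)))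
          (truncVar_nonneg _)
      · filter_upwards [hsmall] with z hz
        have h1 := hpos z ⟨hz.1, by linarith [hz.2, hz.1]⟩
        have h2 := hpos (2 * z) ⟨by linarith [hz.1], by linarith [hz.2]⟩
        have h3 := hν.mul_absMoment_shell_le (σ := σ) hz.1 (by linarith [hz.2])
        rw [div_le_iff₀ h1]
        have : (1 / 2 * (truncVar σ ν (2 * z) / truncVar σ ν z) *
            (2 * z * (|γ| + absMoment ν (2 * z)) / truncVar σ ν (2 * z)) +
            (truncVar σ ν (2 * z) / truncVar σ ν z - 1)) * truncVar σ ν z =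
            z * (|γ| + absMoment ν (2 * z)) + (truncVar σ ν (2 * z) - truncVar σ ν z) := by
          field_simp
        rw [this]; linarith
    refine squeeze_zero_norm' ?_ key
    filter_upwards [self_mem_nhdsWithin] with z hz
    have hz : 0 < z := hz
    rw [Real.norm_eq_abs, abs_div, abs_mul, abs_of_pos hz, abs_of_nonneg (truncVar_nonneg _)]
    have := truncVar_nonneg (σ := σ) (ν := ν) z
    gcongr
    exact abs_truncMean_le z

lemma regVaryingAtZero_truncVar_of_tendsto (hν : IsLevyMeasure ν)
    (hpos : ∀ᶠ x in 𝓝[>] 0, 0 < truncVar σ ν x)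
    (h : ∀ x > 0, Tendsto (fun ε => truncVar σ ν (x * ε) / truncVar σ ν ε) (𝓝[>] 0) (𝓝 1)) :
    RegVaryingAtZero 0 (truncVar σ ν) := by
  obtain ⟨d, hd, hpos⟩ := (mem_nhdsGT_iff_exists_Ioo_subset).1 hpos
  refine ⟨⟨d, hd, fun x hx => hpos hx, ?_⟩, fun x hx => by rw [Real.rpow_zero]; exact h x hx⟩
  exact hν.truncVar_mono.measurable.comp measurable_subtype_coe

/-- Slow variation of the truncated variance is the tail condition: `v (xε) - v ε` is at most the
tail times `(xε)²`, and conversely `z² Π̄(z) / v(z)` contracts along halving. -/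
lemma regVaryingAtZero_truncVar_iff (hν : IsLevyMeasure ν) :
    RegVaryingAtZero 0 (truncVar σ ν) ↔ (∀ᶠ x in 𝓝[>] 0, 0 < truncVar σ ν x) ∧
      Tendsto (fun x => x ^ 2 * tail ν x / truncVar σ ν x) (𝓝[>] 0) (𝓝 0) := by
  constructor
  · intro h
    refine ⟨h.eventually_pos, squeeze_zero' ?_ ?_
      (tendsto_div_truncVar_of_slowlyVarying (γ := 0) hν h).1⟩
    · exact .of_forall fun z => div_nonneg (mul_nonneg (sq_nonneg _) (tail_nonneg _))
        (truncVar_nonneg _)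
    · filter_upwards [self_mem_nhdsWithin] with z hz
      have := truncVar_nonneg (σ := σ) (ν := ν) z
      gcongr
      exact hν.tail_le_closedTail hz
  · rintro ⟨hpos, h⟩
    -- factors `x ≥ 1` suffice, the others follow by substitution
    have hge : ∀ x ≥ 1, Tendsto (fun ε => truncVar σ ν (x * ε) / truncVar σ ν ε) (𝓝[>] 0)
        (𝓝 1) := by
      intro x hx
      have hx0 : 0 < x := by linarith
      have hlim : Tendsto (fun ε => 1 + 4 * x ^ 2 * ((1 / 2 * ε) ^ 2 * tail ν (1 / 2 * ε) /
          truncVar σ ν (1 / 2 * ε))) (𝓝[>] 0) (𝓝 1) := by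
        have := ((h.comp (tendsto_const_mul_nhdsGT_zero (show (0 : ℝ) < 1 / 2 by norm_num))).const_mul
          (4 * x ^ 2)).const_add 1
        simpa using this
      refine tendsto_of_tendsto_of_tendsto_of_le_of_le' tendsto_const_nhds hlim ?_ ?_
      · filter_upwards [hpos, self_mem_nhdsWithin] with ε hε hε0
        have hε0 : 0 < ε := hε0
        rw [le_div_iff₀ hε, one_mul]
        exact hν.truncVar_mono (by nlinarith)
      · filter_upwards [hpos, (tendsto_const_mul_nhdsGT_zero (show (0 : ℝ) < 1 / 2 by
          norm_num)).eventually hpos, self_mem_nhdsWithin] with ε hε hε2 hε0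
        have hε0 : 0 < ε := hε0
        have h1 : truncVar σ ν (x * ε) - truncVar σ ν ε ≤ (x * ε) ^ 2 * closedTail ν ε := by
          rw [hν.truncVar_sub (by nlinarith)]
          refine (le_abs_self _).trans (hν.setIntegral_shell_le hε0 (sq_nonneg _) fun y hy => ?_)
          rw [abs_of_nonneg (sq_nonneg y), ← sq_abs y]
          have := abs_nonneg y
          gcongr
        have h2 := hν.closedTail_le_tail (x := 1 / 2 * ε) (z := ε) (by positivity) (by linarith)
        have h3 : truncVar σ ν (1 / 2 * ε) ≤ truncVar σ ν ε := hν.truncVar_mono (by linarith)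
        have h4 := tail_nonneg (ν := ν) (1 / 2 * ε)
        have h5 : (x * ε) ^ 2 * tail ν (1 / 2 * ε) / truncVar σ ν ε ≤
            (x * ε) ^ 2 * tail ν (1 / 2 * ε) / truncVar σ ν (1 / 2 * ε) := by gcongr
        have h6 : truncVar σ ν (x * ε) ≤ truncVar σ ν ε + (x * ε) ^ 2 * tail ν (1 / 2 * ε) := by
          nlinarith [sq_nonneg (x * ε)]
        calc truncVar σ ν (x * ε) / truncVar σ ν ε
            ≤ (truncVar σ ν ε + (x * ε) ^ 2 * tail ν (1 / 2 * ε)) / truncVar σ ν ε := by gcongr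
          _ = 1 + (x * ε) ^ 2 * tail ν (1 / 2 * ε) / truncVar σ ν ε := by field_simp
          _ ≤ 1 + (x * ε) ^ 2 * tail ν (1 / 2 * ε) / truncVar σ ν (1 / 2 * ε) := by linarith
          _ = _ := by ring
    refine regVaryingAtZero_truncVar_of_tendsto hν hpos fun x hx => ?_
    rcases le_total 1 x with h1 | h1
    · exact hge x h1
    · have h2 := ((hge x⁻¹ ((one_le_inv₀ hx).2 h1)).comp (tendsto_const_mul_nhdsGT_zero hx)).inv₀
        one_ne_zero
      rw [inv_one] at h2
      refine h2.congr fun ε => ?_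
      simp only [Function.comp_apply, inv_div, inv_mul_cancel_left₀ hx.ne']

/-! ### Attraction to Brownian motion and to a linear drift: sufficiency -/

/-- Sufficiency in the Brownian case: after zooming, the triplet has a vanishing drift and tail,
and a truncated variance that tends to `σhat²` at every level, so that it concentrates at zero. -/
lemma tendsToUnder_gaussian (hν : IsLevyMeasure ν) {σhat : ℝ} (hσ : 0 < σhat)
    (hv : RegVaryingAtZero 0 (truncVar σ ν)) :
    TendsToUnder (fun z => σhat ^ 2 * z ^ 2 / truncVar σ ν z) (charExp γ σ ν)
      (charExp 0 σhat 0) := by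
  intro u
  obtain ⟨hT, hm⟩ := tendsto_div_truncVar_of_slowlyVarying (γ := γ) hν hv
  set e : ℝ → ℝ := fun z => σhat ^ 2 * z ^ 2 / truncVar σ ν z with he
  have hratio : ∀ x > 0, Tendsto (fun z => truncVar σ ν (z * x) / truncVar σ ν z) (𝓝[>] 0)
      (𝓝 1) := fun x hx => by
    have := hv.2 x hx
    rw [Real.rpow_zero] at this
    exact this.congr fun z => by rw [mul_comm]
  have hVar : ∀ x > 0, Tendsto (fun z => truncVar (√(e z) * σ / z) (zoom (e z) z ν) x) (𝓝[>] 0)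
      (𝓝 (σhat ^ 2)) := by
    intro x hx
    have h1 := (hratio x hx).const_mul (σhat ^ 2)
    rw [mul_one] at h1
    refine h1.congr' ?_
    filter_upwards [hv.eventually_pos, self_mem_nhdsWithin] with z hz hz0
    have hz0 : 0 < z := hz0
    rw [truncVar_zoom (by positivity) hz0]
    simp only [he]
    field_simp
  have hTail : Tendsto (fun z => closedTail (zoom (e z) z ν) 1) (𝓝[>] 0) (𝓝 0) := by
    have h1 := hT.const_mul (σhat ^ 2)
    rw [mul_zero] at h1
    refine h1.congr' ?_
    filter_upwards [hv.eventually_pos, self_mem_nhdsWithin] with z hz hz0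
    have hz0 : 0 < z := hz0
    rw [closedTail_zoom (by positivity) hz0, mul_one]
    simp only [he]
    ring
  have hMean : Tendsto (fun z => e z * truncMean γ ν z / z) (𝓝[>] 0) (𝓝 0) := by
    have h1 := hm.const_mul (σhat ^ 2)
    rw [mul_zero] at h1
    refine h1.congr' ?_
    filter_upwards [hv.eventually_pos, self_mem_nhdsWithin] with z hz hz0
    have hz0 : 0 < z := hz0
    simp only [he]
    field_simp
  -- the exponent of the zoomed triplet, compared with its Gaussian part
  have hbound : ∀ δ ∈ Ioc (0 : ℝ) 1, ∀ᶠ z in 𝓝[>] 0, ‖(e z : ℂ) * charExp γ σ ν (u / z) +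
      ((truncVar (√(e z) * σ / z) (zoom (e z) z ν) 1 * u ^ 2 / 2 : ℝ) : ℂ)‖ ≤
      |e z * truncMean γ ν z / z| * |u| +
      (4 * |u| ^ 3 * (δ * truncVar (√(e z) * σ / z) (zoom (e z) z ν) 1) +
        4 * u ^ 2 * (truncVar (√(e z) * σ / z) (zoom (e z) z ν) 1 -
          truncVar (√(e z) * σ / z) (zoom (e z) z ν) δ) + 2 * closedTail (zoom (e z) z ν) 1) := by
    intro δ hδ
    filter_upwards [hv.eventually_pos, Ioo_mem_nhdsGT one_pos] with z hz hz0
    have hz1 := hz0.1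
    have := norm_charExp_add_gaussian_le (γ := e z * truncMean γ ν z / z) (σ := √(e z) * σ / z)
      (hν.zoom (e := e z) hz0.1) u hδ.1 hδ.2
    rwa [charExp_zoom hν (by positivity) hz0.1 hz0.2.le] at this
  -- the limit in `z` is taken at fixed `δ`, which is then sent to zero
  have hzero : Tendsto (fun z => (e z : ℂ) * charExp γ σ ν (u / z) +
      ((truncVar (√(e z) * σ / z) (zoom (e z) z ν) 1 * u ^ 2 / 2 : ℝ) : ℂ)) (𝓝[>] 0) (𝓝 0) := by
    rw [tendsto_zero_iff_norm_tendsto_zero]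
    rw [tendsto_order]
    refine ⟨fun a ha => .of_forall fun z => ha.trans_le (norm_nonneg _), fun a ha => ?_⟩
    have hδ : Tendsto (fun δ : ℝ => 4 * |u| ^ 3 * (δ * σhat ^ 2)) (𝓝[>] 0) (𝓝 0) := by
      have : Tendsto (fun δ : ℝ => 4 * |u| ^ 3 * (δ * σhat ^ 2)) (𝓝 0)
          (𝓝 (4 * |u| ^ 3 * (0 * σhat ^ 2))) := Continuous.tendsto (by fun_prop) 0
      simp only [zero_mul, mul_zero] at this
      exact this.mono_left nhdsWithin_le_nhds
    obtain ⟨δ, hδa, hδ⟩ := ((hδ.eventually (gt_mem_nhds ha)).and (Ioc_mem_nhdsGT one_pos)).exists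
    have h1 := ((hMean.abs.mul_const |u|).add ((((hVar 1 one_pos).const_mul δ).const_mul
      (4 * |u| ^ 3)).add (((hVar 1 one_pos).sub (hVar δ hδ.1)).const_mul (4 * u ^ 2)) |>.add
      (hTail.const_mul 2)))
    simp only [abs_zero, zero_mul, sub_self, mul_zero, add_zero, zero_add] at h1
    filter_upwards [hbound δ hδ, h1.eventually (gt_mem_nhds hδa)] with z h2 h3
    exact h2.trans_lt h3
  have hV1 : Tendsto (fun z => ((truncVar (√(e z) * σ / z) (zoom (e z) z ν) 1 * u ^ 2 / 2 : ℝ) : ℂ))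
      (𝓝[>] 0) (𝓝 ((σhat ^ 2 * u ^ 2 / 2 : ℝ) : ℂ)) :=
    (Complex.continuous_ofReal.tendsto _).comp (((hVar 1 one_pos).mul_const _).div_const _)
  have := hzero.sub hV1
  rw [charExp_zero_measure]
  simp only [add_sub_cancel_right] at this
  convert this using 2
  simp

/-- The tail condition for attraction to a drift also holds with closed tails, because the truncated
mean is left-continuous. -/
lemma IsLevyMeasure.eventually_mul_closedTail_le (hν : IsLevyMeasure ν)
    (h : Tendsto (fun x => x * tail ν x / truncMean γ ν x) (𝓝[>] 0) (𝓝 0))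
    (hm : ∀ᶠ x in 𝓝[>] 0, truncMean γ ν x ≠ 0) {η : ℝ} (hη : 0 < η) :
    ∀ᶠ x in 𝓝[>] 0, x * closedTail ν x ≤ η * |truncMean γ ν x| := by
  have h1 : ∀ᶠ x in 𝓝[>] 0, x * tail ν x ≤ η * |truncMean γ ν x| := by
    filter_upwards [h.abs.eventually (gt_mem_nhds (show |(0 : ℝ)| < η by simpa)), hm,
      self_mem_nhdsWithin] with x h2 h3 hx
    have hx : 0 < x := hx
    rw [abs_div, div_lt_iff₀ (abs_pos.2 h3), abs_of_nonneg (mul_nonneg hx.le (tail_nonneg _))] at h2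
    exact h2.le
  obtain ⟨d, hd, h1⟩ := (mem_nhdsGT_iff_exists_Ioo_subset).1 h1
  have hd : 0 < d := hd
  filter_upwards [Ioo_mem_nhdsGT (lt_min hd one_pos)] with x hx
  have hx0 := hx.1
  have hxd := hx.2.trans_le (min_le_left _ _)
  have hx1 := hx.2.trans_le (min_le_right _ _)
  -- approach `x` from the left, where open tails dominate the closed tail at `x`
  set w : ℕ → ℝ := fun n => x * (1 - (1 / 2) ^ (n + 1)) with hw
  have hp : ∀ n : ℕ, (0 : ℝ) < (1 / 2) ^ (n + 1) ∧ (1 / 2 : ℝ) ^ (n + 1) ≤ 1 / 2 := fun n =>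
    ⟨by positivity, by
      rw [pow_succ]
      have : (1 / 2 : ℝ) ^ n ≤ 1 := pow_le_one₀ (by norm_num) (by norm_num)
      linarith⟩
  have hw0 : ∀ n, 0 < w n := fun n => mul_pos hx0 (by linarith [(hp n).2])
  have hwx : ∀ n, w n < x := fun n => by have := (hp n).1; simp only [hw]; nlinarith
  have hwlim : Tendsto w atTop (𝓝 x) := by
    have h2 := (tendsto_pow_atTop_nhds_zero_of_lt_one (show (0 : ℝ) ≤ 1 / 2 by norm_num)
      (by norm_num)).comp (tendsto_add_atTop_nat 1)
    have h3 := (h2.const_sub 1).const_mul x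
    simpa [hw] using h3
  have hwmono : Monotone w := by
    refine monotone_nat_of_le_succ fun n => ?_
    have h2 := (hp n).1
    have h3 : (1 / 2 : ℝ) ^ (n + 1 + 1) ≤ (1 / 2) ^ (n + 1) := by rw [pow_succ _ (n + 1)]; linarith
    simp only [hw]
    gcongr
  have hshell : Tendsto (fun n => ν {y : ℝ | w n ≤ |y| ∧ |y| < x}) atTop (𝓝 0) := by
    have h2 : ⋂ n, {y : ℝ | w n ≤ |y| ∧ |y| < x} = ∅ := by
      rw [eq_empty_iff_forall_notMem]
      intro y hy
      have hy := mem_iInter.1 hy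
      have : x ≤ |y| := le_of_tendsto' hwlim fun n => (hy n).1
      exact absurd (hy 0).2 (not_lt.2 this)
    have h3 := tendsto_measure_iInter_atTop (μ := ν) (s := fun n => {y : ℝ | w n ≤ |y| ∧ |y| < x})
      (fun n => (measurableSet_shell _ _).nullMeasurableSet)
      (fun m n hmn y hy => ⟨(hwmono hmn).trans hy.1, hy.2⟩) ⟨0, (hν.shell_lt_top (hw0 0) _).ne⟩
    rwa [h2, measure_empty] at h3
  have hmlim : Tendsto (fun n => truncMean γ ν (w n)) atTop (𝓝 (truncMean γ ν x)) := by
    rw [tendsto_iff_norm_sub_tendsto_zero]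
    have h2 := ((ENNReal.tendsto_toReal ENNReal.zero_ne_top).comp hshell).const_mul x
    simp only [ENNReal.toReal_zero, mul_zero] at h2
    refine squeeze_zero (fun n => norm_nonneg _) (fun n => ?_) h2
    rw [norm_sub_rev, hν.truncMean_sub (hw0 n) (hwx n).le hx1.le]
    exact norm_setIntegral_le_of_norm_le_const (hν.shell_lt_top (hw0 n) _) fun y hy => hy.2.le
  refine le_of_tendsto_of_tendsto' (hwlim.mul_const (closedTail ν x)) (hmlim.abs.const_mul η)
    fun n => ?_
  have h4 := h1 ⟨hw0 n, (hwx n).trans hxd⟩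
  refine le_trans ?_ h4
  have := hw0 n
  gcongr
  exact hν.closedTail_le_tail (hw0 n) (hwx n)

/-- Sufficiency in the drift case: the tail condition makes `m` vary so slowly that the truncated
variance is of smaller order than `z m(z)`, hence only the drift survives zooming in. -/
lemma tendsToUnder_drift (hν : IsLevyMeasure ν) {γhat : ℝ} (hγ : γhat ≠ 0) (hσ : σ = 0)
    (hm : ∀ᶠ x in 𝓝[>] 0, 0 < truncMean γ ν x / γhat)
    (h : Tendsto (fun x => x * tail ν x / truncMean γ ν x) (𝓝[>] 0) (𝓝 0)) :
    TendsToUnder (fun z => γhat * z / truncMean γ ν z) (charExp γ σ ν)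
      (charExp γhat 0 0) := by
  subst hσ
  intro u
  set e : ℝ → ℝ := fun z => γhat * z / truncMean γ ν z with he
  have hm0 : ∀ᶠ x in 𝓝[>] 0, truncMean γ ν x ≠ 0 := hm.mono fun x hx h0 => by
    rw [h0, zero_div] at hx; exact lt_irrefl _ hx
  have hepos : ∀ᶠ z in 𝓝[>] (0 : ℝ), 0 < e z := by
    filter_upwards [hm, self_mem_nhdsWithin] with z hz hz0
    have hz0 : 0 < z := hz0
    have : e z = z / (truncMean γ ν z / γhat) := by
      simp only [he]; field_simp
    rw [this]; positivity
  have heabs : ∀ᶠ z in 𝓝[>] (0 : ℝ), e z * |truncMean γ ν z| = |γhat| * z := by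
    filter_upwards [hepos, hm0, self_mem_nhdsWithin] with z h1 h2 hz0
    have hz0 : 0 < z := hz0
    calc e z * |truncMean γ ν z| = |e z * truncMean γ ν z| := by rw [abs_mul, abs_of_pos h1]
      _ = |γhat * z| := by simp only [he]; congr 1; field_simp
      _ = |γhat| * z := by rw [abs_mul, abs_of_pos hz0]
  have hγ' : 0 < |γhat| := abs_pos.2 hγ
  -- Halving the argument changes the truncated mean by a factor close to one.
  have key : ∀ η ∈ Ioo (0 : ℝ) (1 / 22), ∀ᶠ z in 𝓝[>] 0,
      truncVar 0 ν z ≤ 5 * η * (z * |truncMean γ ν z|) := by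
    intro η hη
    obtain ⟨d, hd, hsub⟩ := (mem_nhdsGT_iff_exists_Ioo_subset).1
      (hν.eventually_mul_closedTail_le h hm0 hη.1)
    have hd : 0 < d := hd
    have hhalf : ∀ z ∈ Ioo 0 (min d 1), |truncMean γ ν (z / 2)| ≤ 11 / 10 * |truncMean γ ν z| := by
      intro z hz
      have hz2 : 0 < z / 2 := by linarith [hz.1]
      have hzd := hz.2.trans_le (min_le_left _ _)
      have hz1 := hz.2.trans_le (min_le_right _ _)
      have h1 : |truncMean γ ν z - truncMean γ ν (z / 2)| ≤ z * closedTail ν (z / 2) := by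
        rw [hν.truncMean_sub hz2 (by linarith) hz1.le]
        exact hν.setIntegral_shell_le hz2 hz.1.le fun y hy => hy.le
      have h2 : z / 2 * closedTail ν (z / 2) ≤ η * |truncMean γ ν (z / 2)| :=
        hsub ⟨hz2, by linarith⟩
      have h3 := abs_sub_abs_le_abs_sub (truncMean γ ν (z / 2)) (truncMean γ ν z)
      rw [abs_sub_comm] at h3
      have h4 : η * |truncMean γ ν (z / 2)| ≤ 1 / 22 * |truncMean γ ν (z / 2)| := by
        have := hη.2.le; gcongr
      linarith
    filter_upwards [Ioo_mem_nhdsGT (lt_min hd one_pos)] with z hz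
    have hle := hν.lintegral_pow_le (p := 2) (G := fun z => 11 / 5 * η * (z * |truncMean γ ν z|))
      (q := 11 / 20) (d := min d 1) (by norm_num) (by norm_num) ?_ ?_ hz
    · have e1 : truncVar 0 ν z =
          (∫⁻ y in {y : ℝ | |y| < z}, ENNReal.ofReal (|y| ^ 2) ∂ν).toReal := by
        rw [truncVar, zero_pow two_ne_zero, zero_add, integral_eq_lintegral_of_nonneg_ae
          (.of_forall fun y => sq_nonneg y) (by fun_prop)]
        simp only [sq_abs]
      have h0 : 0 ≤ η * (z * |truncMean γ ν z|) :=
        mul_nonneg hη.1.le (mul_nonneg hz.1.le (abs_nonneg _))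
      rw [e1]
      refine (ENNReal.toReal_mono ENNReal.ofReal_ne_top hle).trans ?_
      rw [ENNReal.toReal_ofReal (by
        rw [mul_assoc]; exact div_nonneg (mul_nonneg (by norm_num) h0) (by norm_num))]
      rw [div_le_iff₀ (by norm_num)]
      nlinarith
    · intro w hw
      have h2 : w / 2 * closedTail ν (w / 2) ≤ η * |truncMean γ ν (w / 2)| :=
        hsub ⟨by linarith [hw.1], by linarith [hw.1, hw.2.trans_le (min_le_left _ _)]⟩
      have h3 := hhalf w hw
      have h4 : η * |truncMean γ ν (w / 2)| ≤ η * (11 / 10 * |truncMean γ ν w|) := by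
        have := hη.1; gcongr
      have hw0 := hw.1
      calc w ^ 2 * closedTail ν (w / 2) = 2 * w * (w / 2 * closedTail ν (w / 2)) := by ring
        _ ≤ 2 * w * (η * (11 / 10 * |truncMean γ ν w|)) := by
            exact mul_le_mul_of_nonneg_left (h2.trans h4) (by positivity)
        _ = _ := by ring
    · intro w hw
      have h3 := hhalf w hw
      have hw0 := hw.1
      have hη0 := hη.1
      calc 11 / 5 * η * (w / 2 * |truncMean γ ν (w / 2)|)
          ≤ 11 / 5 * η * (w / 2 * (11 / 10 * |truncMean γ ν w|)) := by gcongr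
        _ = _ := by ring
  have hVar : Tendsto (fun z => truncVar (√(e z) * 0 / z) (zoom (e z) z ν) 1) (𝓝[>] 0) (𝓝 0) := by
    rw [tendsto_order]
    refine ⟨fun a ha => .of_forall fun z => ha.trans_le (truncVar_nonneg _), fun a ha => ?_⟩
    have hη : 0 < min (1 / 44) (a / (10 * |γhat|)) := by positivity
    filter_upwards [key _ ⟨hη, (min_le_left _ _).trans_lt (by norm_num)⟩, hepos, heabs,
      self_mem_nhdsWithin] with z h1 h2 h3 hz
    have hz : 0 < z := hz
    rw [truncVar_zoom h2.le hz, mul_one, div_lt_iff₀ (by positivity)]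
    set η := min (1 / 44) (a / (10 * |γhat|))
    have h4 : η * (10 * |γhat|) ≤ a := (le_div_iff₀ (by positivity)).1 (min_le_right _ _)
    calc e z * truncVar 0 ν z ≤ e z * (5 * η * (z * |truncMean γ ν z|)) := by gcongr
      _ = 5 * η * z * (e z * |truncMean γ ν z|) := by ring
      _ = (η * (10 * |γhat|)) / 2 * z ^ 2 := by rw [h3]; ring
      _ ≤ a / 2 * z ^ 2 := by gcongr
      _ < a * z ^ 2 := by gcongr; linarith
  have hTail : Tendsto (fun z => closedTail (zoom (e z) z ν) 1) (𝓝[>] 0) (𝓝 0) := by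
    rw [tendsto_order]
    refine ⟨fun a ha => .of_forall fun z => ha.trans_le (closedTail_nonneg _), fun a ha => ?_⟩
    filter_upwards [hν.eventually_mul_closedTail_le h hm0 (show 0 < a / (2 * |γhat|) by positivity),
      hepos, heabs, self_mem_nhdsWithin] with z h1 h2 h3 hz
    have hz : 0 < z := hz
    rw [closedTail_zoom h2.le hz, mul_one]
    have h4 : z * (e z * closedTail ν z) ≤ z * (a / 2) := by
      calc z * (e z * closedTail ν z) = e z * (z * closedTail ν z) := by ring
        _ ≤ e z * (a / (2 * |γhat|) * |truncMean γ ν z|) := by gcongr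
        _ = a / (2 * |γhat|) * (e z * |truncMean γ ν z|) := by ring
        _ = z * (a / 2) := by rw [h3]; field_simp
    have := le_of_mul_le_mul_left h4 hz
    linarith
  have hlim := (hVar.add hTail).const_mul (3 * u ^ 2 + 2)
  rw [add_zero, mul_zero] at hlim
  rw [tendsto_iff_norm_sub_tendsto_zero]
  refine squeeze_zero' (.of_forall fun z => norm_nonneg _) ?_ hlim
  filter_upwards [hepos, hm0, Ioo_mem_nhdsGT one_pos] with z h1 h2 hz
  have h3 := norm_charExp_sub_drift_le (γ := e z * truncMean γ ν z / z) (σ := √(e z) * 0 / z)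
    (hν.zoom (e := e z) hz.1) u
  rw [charExp_zoom hν h1.le hz.1 hz.2.le] at h3
  have h4 : e z * truncMean γ ν z / z = γhat := by
    have := hz.1.ne'
    simp only [he]; field_simp
  rw [h4] at h3
  have h5 : charExp γhat 0 0 u = γhat * u * Complex.I := by rw [charExp_zero_measure]; simp
  rw [h5]
  exact h3

end

section

/-! ### Weak convergence and discontinuous test functions -/

/-- Weak convergence of probability measures allows bounded measurable test functions that are
continuous almost everywhere with respect to the limit. -/
lemma tendsto_integral_of_ae_continuousAt {ι : Type*} {l : Filter ι} [l.IsCountablyGenerated]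
    {μ : ι → ProbabilityMeasure ℝ} {μ₀ : ProbabilityMeasure ℝ} (h : Tendsto μ l (𝓝 μ₀))
    {g : ℝ → ℝ} (hg : Measurable g) {C : ℝ} (hC : ∀ x, |g x| ≤ C)
    (hc : ∀ᵐ x ∂(μ₀ : Measure ℝ), ContinuousAt g x) :
    Tendsto (fun i => ∫ x, g x ∂(μ i : Measure ℝ)) l (𝓝 (∫ x, g x ∂(μ₀ : Measure ℝ))) := by
  have hmap : Tendsto (fun i => (μ i).map hg.aemeasurable) l (𝓝 (μ₀.map hg.aemeasurable)) := by
    refine tendsto_of_forall_isOpen_le_liminf' fun G hG => ?_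
    simp only [ProbabilityMeasure.toMeasure_map]
    rw [Measure.map_apply hg hG.measurableSet]
    simp_rw [Measure.map_apply hg hG.measurableSet]
    have h1 : (μ₀ : Measure ℝ) (g ⁻¹' G) ≤ (μ₀ : Measure ℝ) (interior (g ⁻¹' G)) := by
      refine measure_mono_ae ?_
      filter_upwards [hc] with x hx hxG
      exact mem_interior_iff_mem_nhds.2 (hx (hG.mem_nhds hxG))
    refine h1.trans ((ProbabilityMeasure.le_liminf_measure_open_of_tendsto h
      isOpen_interior).trans ?_)
    exact liminf_le_liminf (.of_forall fun i => measure_mono interior_subset)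
  have hC0 : 0 ≤ C := (abs_nonneg _).trans (hC 0)
  let φ : BoundedContinuousFunction ℝ ℝ := BoundedContinuousFunction.ofNormedAddCommGroup
    (fun x => max (-C) (min x C)) (by fun_prop) C fun x => by
      rw [Real.norm_eq_abs, abs_le]
      exact ⟨le_max_left _ _, max_le (by linarith) (min_le_right _ _)⟩
  have hφ : ∀ x, φ (g x) = g x := fun x => by
    have := abs_le.1 (hC x)
    show max (-C) (min (g x) C) = g x
    rw [min_eq_left this.2, max_eq_right this.1]
  have h2 := (ProbabilityMeasure.tendsto_iff_forall_integral_tendsto.1 hmap) φ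
  have h3 : ∀ p : ProbabilityMeasure ℝ, ∫ x, φ x ∂((p.map hg.aemeasurable : ProbabilityMeasure ℝ) :
      Measure ℝ) = ∫ x, g x ∂(p : Measure ℝ) := fun p => by
    rw [ProbabilityMeasure.toMeasure_map, integral_map hg.aemeasurable
      φ.continuous.aestronglyMeasurable]
    simp only [hφ]
  simpa only [h3] using h2

lemma FiniteMeasure_integral_eq (μ : FiniteMeasure ℝ) (g : ℝ → ℝ) :
    ∫ x, g x ∂(μ : Measure ℝ) = μ.mass * ∫ x, g x ∂(μ.normalize : Measure ℝ) := by
  have h := congrArg (fun m : FiniteMeasure ℝ => ∫ x, g x ∂(m : Measure ℝ))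
    μ.self_eq_mass_smul_normalize
  refine h.trans ?_
  rw [FiniteMeasure.toMeasure_smul]
  show ∫ x, g x ∂((μ.mass : ℝ≥0) • (μ.normalize : Measure ℝ)) = _
  rw [integral_smul_nnreal_measure]
  rfl

/-- The version of `tendsto_integral_of_ae_continuousAt` for finite measures, where the convergence
is stated for the masses and for the normalized measures. -/
lemma tendsto_integral_of_normalize {ι : Type*} {l : Filter ι} [l.IsCountablyGenerated]
    {μ : ι → FiniteMeasure ℝ} {μ₀ : FiniteMeasure ℝ}
    (hmass : Tendsto (fun i => (μ i).mass) l (𝓝 μ₀.mass))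
    (h : μ₀ ≠ 0 → Tendsto (fun i => (μ i).normalize) l (𝓝 μ₀.normalize))
    {g : ℝ → ℝ} (hg : Measurable g) {C : ℝ} (hC : ∀ x, |g x| ≤ C)
    (hc : ∀ᵐ x ∂(μ₀ : Measure ℝ), ContinuousAt g x) :
    Tendsto (fun i => ∫ x, g x ∂(μ i : Measure ℝ)) l (𝓝 (∫ x, g x ∂(μ₀ : Measure ℝ))) := by
  have hmass' : Tendsto (fun i => ((μ i).mass : ℝ)) l (𝓝 μ₀.mass) :=
    (NNReal.continuous_coe.tendsto _).comp hmass
  simp only [FiniteMeasure_integral_eq]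
  by_cases h0 : μ₀ = 0
  · have hz : (μ₀.mass : ℝ) = 0 := by rw [h0]; simp
    rw [hz] at hmass' ⊢
    rw [zero_mul]
    refine squeeze_zero_norm (a := fun i => (μ i).mass * C) (fun i => ?_) (by
      simpa using hmass'.mul_const C)
    rw [norm_mul, Real.norm_of_nonneg (NNReal.coe_nonneg _)]
    gcongr
    calc _ ≤ C * ((μ i).normalize : Measure ℝ).real univ :=
          norm_integral_le_of_norm_le_const (.of_forall fun x => hC x)
      _ = C := by simp
  · refine hmass'.mul (tendsto_integral_of_ae_continuousAt (h h0) hg hC ?_)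
    rw [μ₀.toMeasure_normalize_eq_of_nonzero h0]
    exact Measure.ae_smul_measure hc _

/-- Convergence of characteristic functions of finite measures implies convergence of integrals of
almost everywhere continuous test functions. -/
lemma tendsto_integral_of_charFun {μ : ℕ → Measure ℝ} {μ₀ : Measure ℝ} [∀ n, IsFiniteMeasure (μ n)]
    [IsFiniteMeasure μ₀] (h : ∀ u : ℝ, Tendsto (fun n => charFun (μ n) u) atTop (𝓝 (charFun μ₀ u)))
    {g : ℝ → ℝ} (hg : Measurable g) {C : ℝ} (hC : ∀ x, |g x| ≤ C)
    (hc : ∀ᵐ x ∂μ₀, ContinuousAt g x) :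
    Tendsto (fun n => ∫ x, g x ∂(μ n)) atTop (𝓝 (∫ x, g x ∂μ₀)) := by
  let m : ℕ → FiniteMeasure ℝ := fun n => ⟨μ n, inferInstance⟩
  let m₀ : FiniteMeasure ℝ := ⟨μ₀, inferInstance⟩
  have hre : ∀ (ρ : Measure ℝ) [IsFiniteMeasure ρ], ‖charFun ρ (0 : ℝ)‖ = ρ.real univ := by
    intro ρ _
    rw [charFun_zero, Complex.norm_real, Real.norm_of_nonneg measureReal_nonneg]
  have hmass : Tendsto (fun n => (m n).mass) atTop (𝓝 m₀.mass) := by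
    have h1 := (h 0).norm
    simp only [hre] at h1
    rw [← NNReal.tendsto_coe]
    exact h1
  refine tendsto_integral_of_normalize (μ := m) (μ₀ := m₀) hmass (fun hm₀ => ?_) hg hC hc
  rw [ProbabilityMeasure.tendsto_iff_tendsto_charFun]
  intro u
  have hne : m₀.mass ≠ 0 := m₀.mass_nonzero_iff.2 hm₀
  have hcf : ∀ ρ : FiniteMeasure ℝ, ρ ≠ 0 → charFun (ρ.normalize : Measure ℝ) u =
      (((ρ.mass : ℝ)⁻¹ : ℝ) : ℂ) * charFun (ρ : Measure ℝ) u := by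
    intro ρ hρ
    rw [ρ.toMeasure_normalize_eq_of_nonzero hρ, charFun_apply_real, charFun_apply_real,
      integral_smul_nnreal_measure, NNReal.smul_def, Complex.real_smul, NNReal.coe_inv]
  rw [hcf m₀ hm₀]
  have hmass' : Tendsto (fun n => ((((m n).mass : ℝ)⁻¹ : ℝ) : ℂ)) atTop
      (𝓝 (((m₀.mass : ℝ)⁻¹ : ℝ) : ℂ)) :=
    (Complex.continuous_ofReal.tendsto _).comp
      ((NNReal.tendsto_coe.2 hmass).inv₀ (by exact_mod_cast hne))
  refine (hmass'.mul (h u)).congr' ?_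
  filter_upwards [hmass.eventually_ne hne] with n hn
  exact (hcf (m n) ((m n).mass_nonzero_iff.1 hn)).symm

/-! ### The finite measure attached to a Lévy triplet -/

/-- The finite measure `(1 - sinc x) ν(dx) + σ² / 6 δ₀`, which is Khintchine's canonical measure
up to a change of the density. Its characteristic function is `u ↦ f u - ½ ∫ f (u + s) ds` over
`s ∈ [-1, 1]`, where `f` is the Lévy exponent. -/
noncomputable def levyK (σ : ℝ) (ν : Measure ℝ) : Measure ℝ :=
  ν.withDensity (fun x => ENNReal.ofReal (1 - Real.sinc x)) +
    ENNReal.ofReal (σ ^ 2 / 6) • Measure.dirac 0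

lemma one_sub_sinc_nonneg (x : ℝ) : 0 ≤ 1 - Real.sinc x := by linarith [Real.sinc_le_one x]

/-- The Taylor expansion of `sinc` to second order. -/
lemma abs_one_sub_sinc_sub_le {x : ℝ} (hx : |x| ≤ 1) :
    |1 - Real.sinc x - x ^ 2 / 6| ≤ |x| ^ 3 * (5 / 96) := by
  rcases eq_or_ne x 0 with rfl | h0
  · simp
  have hb := Real.sin_bound hx
  have h1 : 1 - Real.sinc x - x ^ 2 / 6 = -(Real.sin x - (x - x ^ 3 / 6)) / x := by
    rw [Real.sinc_of_ne_zero h0]; field_simp; ring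
  rw [h1, abs_div, abs_neg, div_le_iff₀ (abs_pos.2 h0)]
  refine hb.trans ?_
  have h2 : |x| ^ 5 ≤ |x| ^ 4 := pow_le_pow_of_le_one (abs_nonneg x) hx (by norm_num)
  have h3 : 0 ≤ |x| ^ 4 := by positivity
  calc |x| ^ 5 / 100 ≤ |x| ^ 4 * (5 / 96) := by linarith
    _ = _ := by ring

/-- The density `1 - sinc x` of `levyK` is comparable to `x² ∧ 1`; the constants are not optimal.
-/
lemma min_le_one_sub_sinc (x : ℝ) : min (x ^ 2) 1 ≤ 16 * (1 - Real.sinc x) := by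
  rcases le_total |x| 1 with hx | hx
  · have h1 := (abs_le.1 (abs_one_sub_sinc_sub_le hx)).1
    have h2 : |x| ^ 3 ≤ x ^ 2 := by
      rw [← sq_abs, pow_succ]; nlinarith [sq_nonneg |x|]
    have := min_le_left (x ^ 2) 1
    nlinarith [sq_nonneg x]
  · have key : Real.sinc |x| ≤ 15 / 16 := by
      rw [Real.sinc_of_ne_zero (by linarith [abs_nonneg x]), div_le_iff₀ (by linarith)]
      rcases le_total |x| 2 with h2 | h2
      · have h3 : Real.sin |x| ≤ Real.sin 1 + (|x| - 1) := by
          have h4 := (le_abs_self _).trans (Real.abs_sin_sub_sin_le |x| 1)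
          rw [abs_of_nonneg (sub_nonneg.2 hx)] at h4
          linarith
        have h5 : Real.sin 1 ≤ 7 / 8 := by
          have := (abs_le.1 (Real.sin_bound (x := 1) (by simp))).2
          norm_num at this
          linarith
        linarith
      · linarith [Real.sin_le_one |x|]
    have h1 : Real.sinc |x| = Real.sinc x := by
      rcases abs_choice x with h | h <;> rw [h]
      exact Real.sinc_neg x
    rw [h1] at key
    have := min_le_right (x ^ 2) 1
    linarith

lemma one_sub_sinc_le (x : ℝ) : 1 - Real.sinc x ≤ 2 * min (x ^ 2) 1 := by
  rcases le_total |x| 1 with hx | hx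
  · have h1 := (abs_le.1 (abs_one_sub_sinc_sub_le hx)).2
    have h2 : |x| ^ 3 ≤ x ^ 2 := by
      rw [← sq_abs, pow_succ]; nlinarith [sq_nonneg |x|]
    have hx2 : x ^ 2 ≤ 1 := by rw [← sq_abs]; nlinarith [abs_nonneg x]
    rw [min_eq_left hx2]
    nlinarith [sq_nonneg x]
  · have hx2 : 1 ≤ x ^ 2 := by rw [← sq_abs]; nlinarith [abs_nonneg x]
    rw [min_eq_right hx2]
    linarith [Real.neg_one_le_sinc x]

variable {γ σ : ℝ} {ν : Measure ℝ}

lemma IsLevyMeasure.integrable_one_sub_sinc (hν : IsLevyMeasure ν) :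
    Integrable (fun x => 1 - Real.sinc x) ν :=
  hν.integrable_of_le (C := 2) (by
    exact (measurable_const.sub Real.measurable_sinc).aestronglyMeasurable) fun x => by
      rw [Real.norm_of_nonneg (one_sub_sinc_nonneg x)]; exact one_sub_sinc_le x

lemma IsLevyMeasure.isFiniteMeasure_levyK (hν : IsLevyMeasure ν) : IsFiniteMeasure (levyK σ ν) := by
  have h1 : IsFiniteMeasure (ν.withDensity (fun x => ENNReal.ofReal (1 - Real.sinc x))) :=
    isFiniteMeasure_withDensity_ofReal hν.integrable_one_sub_sinc.2
  have h2 : IsFiniteMeasure (ENNReal.ofReal (σ ^ 2 / 6) • Measure.dirac (0 : ℝ)) :=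
    Measure.smul_finite _ ENNReal.ofReal_ne_top
  unfold levyK
  infer_instance

lemma integral_levyK {E : Type*} [NormedAddCommGroup E] [NormedSpace ℝ E] [CompleteSpace E]
    (hν : IsLevyMeasure ν) {g : ℝ → E} (hg : StronglyMeasurable g) {C : ℝ} (hC : ∀ x, ‖g x‖ ≤ C) :
    ∫ x, g x ∂(levyK σ ν) = ∫ x, (1 - Real.sinc x) • g x ∂ν + (σ ^ 2 / 6) • g 0 := by
  have h1 : IsFiniteMeasure (ν.withDensity (fun x => ENNReal.ofReal (1 - Real.sinc x))) :=
    isFiniteMeasure_withDensity_ofReal hν.integrable_one_sub_sinc.2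
  have h2 : IsFiniteMeasure (ENNReal.ofReal (σ ^ 2 / 6) • Measure.dirac (0 : ℝ)) :=
    Measure.smul_finite _ ENNReal.ofReal_ne_top
  have hm : Measurable fun x : ℝ => ENNReal.ofReal (1 - Real.sinc x) :=
    (measurable_const.sub Real.measurable_sinc).ennreal_ofReal
  unfold levyK
  rw [integral_add_measure (.of_bound hg.aestronglyMeasurable C (.of_forall hC))
    (.of_bound hg.aestronglyMeasurable C (.of_forall hC)), integral_smul_measure,
    integral_dirac, ENNReal.toReal_ofReal (by positivity),
    integral_withDensity_eq_integral_toReal_smul hm (.of_forall fun x => ENNReal.ofReal_lt_top)]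
  simp only [ENNReal.toReal_ofReal (one_sub_sinc_nonneg _)]

lemma integral_exp_mul_I_segment (x : ℝ) :
    ∫ s in (-1 : ℝ)..1, Complex.exp ((s * x : ℝ) * Complex.I) = 2 * (Real.sinc x : ℂ) := by
  rcases eq_or_ne x 0 with rfl | hx
  · simp; norm_num
  · have h1 := intervalIntegral.integral_comp_mul_right (a := -1) (b := 1)
      (fun t : ℝ => Complex.exp ((t : ℂ) * Complex.I)) hx
    rw [h1, neg_one_mul, one_mul, integral_exp_mul_I_eq_sinc, Complex.real_smul]
    have : (x : ℂ) ≠ 0 := by exact_mod_cast hx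
    push_cast
    field_simp

/-- Averaging the exponent over `[-1, 1]` turns the jump part into a characteristic function. -/
lemma charFun_levyK (hν : IsLevyMeasure ν) (u : ℝ) :
    2 * charFun (levyK σ ν) u =
      ∫ s in (-1 : ℝ)..1, (charExp γ σ ν u - charExp γ σ ν (u + s)) := by
  have : SigmaFinite ν := hν.sigmaFinite
  set D : ℝ → ℝ → ℂ := fun s x => levyKernel u x - levyKernel (u + s) x with hD
  have hDm : Measurable (Function.uncurry D) := by
    simp only [hD, levyKernel, Function.uncurry_def]
    refine Measurable.sub (Measurable.sub (by fun_prop) (Measurable.ite ?_ (by fun_prop)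
      (by fun_prop))) (Measurable.sub (by fun_prop) (Measurable.ite ?_ (by fun_prop)
      (by fun_prop)))
    all_goals exact measurableSet_lt (by fun_prop) (by fun_prop)
  set B := (3 * u ^ 2 + 2) + (3 * (|u| + 1) ^ 2 + 2) with hB
  have hDb : ∀ s ∈ Set.uIoc (-1 : ℝ) 1, ∀ x, ‖D s x‖ ≤ B * min (x ^ 2) 1 := by
    intro s hs x
    rw [Set.uIoc_of_le (by norm_num)] at hs
    have h1 : |u + s| ≤ |u| + 1 :=
      (abs_add_le u s).trans (by gcongr; exact abs_le.2 ⟨hs.1.le, hs.2⟩)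
    have h2 : (u + s) ^ 2 ≤ (|u| + 1) ^ 2 := by rw [← sq_abs (u + s)]; gcongr
    refine (norm_sub_le _ _).trans ?_
    rw [hB, add_mul]
    refine add_le_add (norm_levyKernel_le u x) ((norm_levyKernel_le _ x).trans ?_)
    gcongr
  have hDint : Integrable (Function.uncurry D) ((volume.restrict (Set.uIoc (-1 : ℝ) 1)).prod ν) := by
    have hdom : Integrable (fun p : ℝ × ℝ => (1 : ℝ) * (B * min (p.2 ^ 2) 1))
        ((volume.restrict (Set.uIoc (-1 : ℝ) 1)).prod ν) := by
      have hfin : IsFiniteMeasure ((volume : Measure ℝ).restrict (Set.uIoc (-1 : ℝ) 1)) :=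
        ⟨by rw [Measure.restrict_apply_univ, Set.uIoc_of_le (by norm_num)]; simp⟩
      exact (integrable_const (1 : ℝ)).mul_prod (hν.integrable_min.const_mul B)
    refine hdom.mono' hDm.aestronglyMeasurable ?_
    have h3 : ∀ᵐ p ∂((volume.restrict (Set.uIoc (-1 : ℝ) 1)).prod ν), p.1 ∈ Set.uIoc (-1 : ℝ) 1 :=
      Measure.quasiMeasurePreserving_fst.ae (p := fun s => s ∈ Set.uIoc (-1 : ℝ) 1)
        (ae_restrict_mem measurableSet_uIoc)
    filter_upwards [h3] with p hp
    rw [one_mul]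
    exact hDb p.1 hp p.2
  have hswap := intervalIntegral_integral_swap hDint
  have hinner : ∀ x, ∫ s in (-1 : ℝ)..1, D s x =
      2 * ((1 - Real.sinc x) • Complex.exp (u * x * Complex.I)) := by
    intro x
    have hDs : ∀ s, D s x = Complex.exp (u * x * Complex.I) -
        Complex.exp (u * x * Complex.I) * Complex.exp ((s * x : ℝ) * Complex.I) +
        (if |x| < 1 then Complex.I * x else 0) * (s : ℂ) := by
      intro s
      have e1 : Complex.exp (((u + s : ℝ) : ℂ) * Complex.I * x) =
          Complex.exp (u * x * Complex.I) * Complex.exp ((s * x : ℝ) * Complex.I) := by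
        rw [← Complex.exp_add]; push_cast; ring_nf
      have e2 : Complex.exp ((u : ℂ) * Complex.I * x) = Complex.exp (u * x * Complex.I) := by
        ring_nf
      simp only [hD, levyKernel, e1, e2]
      split_ifs <;> push_cast <;> ring
    simp only [hDs]
    have hodd : ∫ s in (-1 : ℝ)..1, (s : ℂ) = 0 := by
      rw [intervalIntegral.integral_ofReal]; simp
    rw [intervalIntegral.integral_add (by exact Continuous.intervalIntegrable (by fun_prop) _ _)
      (by exact Continuous.intervalIntegrable (by fun_prop) _ _), intervalIntegral.integral_sub
      (by exact Continuous.intervalIntegrable (by fun_prop) _ _)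
      (by exact Continuous.intervalIntegrable (by fun_prop) _ _),
      intervalIntegral.integral_const_mul, intervalIntegral.integral_const_mul, hodd,
      integral_exp_mul_I_segment, intervalIntegral.integral_const, Complex.real_smul,
      Complex.real_smul]
    push_cast; ring
  have hdiff : ∀ s : ℝ, charExp γ σ ν u - charExp γ σ ν (u + s) =
      (-(γ * Complex.I) + σ ^ 2 * u) * s + (σ ^ 2 / 2) * s ^ 2 + ∫ x, D s x ∂ν := by
    intro s
    have h4 := integral_sub (hν.integrable_levyKernel u) (hν.integrable_levyKernel (u + s))
    simp only [hD]
    rw [h4, charExp_eq, charExp_eq]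
    push_cast; ring
  simp only [hdiff]
  have hcontD : Continuous (fun s => ∫ x, D s x ∂ν) := by
    have h5 : (fun s => ∫ x, D s x ∂ν) = fun s => (charExp γ σ ν u - charExp γ σ ν (u + s)) -
        ((-(γ * Complex.I) + σ ^ 2 * u) * s + (σ ^ 2 / 2) * s ^ 2) := by
      funext s; rw [hdiff s]; ring
    rw [h5]
    have := continuous_charExp (γ := γ) (σ := σ) hν
    fun_prop
  have hodd : ∫ s in (-1 : ℝ)..1, (s : ℂ) = 0 := by
    rw [intervalIntegral.integral_ofReal]; simp
  have heven : ∫ s in (-1 : ℝ)..1, (s : ℂ) ^ 2 = 2 / 3 := by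
    have : ∀ s : ℝ, (s : ℂ) ^ 2 = ((s ^ 2 : ℝ) : ℂ) := fun s => by push_cast; rfl
    simp only [this]
    rw [intervalIntegral.integral_ofReal, integral_pow]
    norm_num
  rw [intervalIntegral.integral_add (by exact Continuous.intervalIntegrable (by fun_prop) _ _)
    (hcontD.intervalIntegrable _ _), intervalIntegral.integral_add
    (by exact Continuous.intervalIntegrable (by fun_prop) _ _)
    (by exact Continuous.intervalIntegrable (by fun_prop) _ _),
    intervalIntegral.integral_const_mul, intervalIntegral.integral_const_mul, hodd, heven, hswap,
    charFun_apply_real, integral_levyK (C := 1) hν (Continuous.stronglyMeasurable (by fun_prop))]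
  · simp only [hinner]
    rw [integral_const_mul]
    simp only [Complex.ofReal_zero, mul_zero, zero_mul, Complex.exp_zero, Complex.real_smul]
    push_cast; ring
  · intro x
    rw [← Complex.ofReal_mul, Complex.norm_exp_ofReal_mul_I]

/-- Convergence of Lévy exponents implies weak convergence of the measures `levyK`. -/
lemma tendsto_integral_levyK {ι : Type*} {l : Filter ι} [l.IsCountablyGenerated]
    {γ σ : ι → ℝ} {ν : ι → Measure ℝ} {γ₀ σ₀ : ℝ} {ν₀ : Measure ℝ}
    (hν : ∀ᶠ i in l, IsLevyMeasure (ν i)) (hν₀ : IsLevyMeasure ν₀)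
    (h : ∀ u, Tendsto (fun i => charExp (γ i) (σ i) (ν i) u) l (𝓝 (charExp γ₀ σ₀ ν₀ u)))
    {g : ℝ → ℝ} (hg : Measurable g) {C : ℝ} (hC : ∀ x, |g x| ≤ C)
    (hc : ∀ᵐ x ∂(levyK σ₀ ν₀), ContinuousAt g x) :
    Tendsto (fun i => ∫ x, g x ∂(levyK (σ i) (ν i))) l (𝓝 (∫ x, g x ∂(levyK σ₀ ν₀))) := by
  -- sequences suffice, as `l` is countably generated; only a tail consists of Lévy measures
  refine tendsto_of_seq_tendsto fun y hy => ?_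
  obtain ⟨N, hN⟩ := eventually_atTop.1 (hy.eventually hν)
  rw [← tendsto_add_atTop_iff_nat N]
  set x : ℕ → ι := fun n => y (n + N) with hx
  have hxl : Tendsto x atTop l := hy.comp (tendsto_add_atTop_nat N)
  have hνx : ∀ n, IsLevyMeasure (ν (x n)) := fun n => hN _ (by omega)
  have hfin := fun n => (hνx n).isFiniteMeasure_levyK (σ := σ (x n))
  have hfin₀ := hν₀.isFiniteMeasure_levyK (σ := σ₀)
  -- Lévy's continuity theorem, as the characteristic functions are averages of the exponents
  refine tendsto_integral_of_charFun (μ := fun n => levyK (σ (x n)) (ν (x n))) (fun u => ?_) hg hC hc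
  set F : ℕ → ℝ → ℂ := fun n => charExp (γ (x n)) (σ (x n)) (ν (x n)) with hF
  set F₀ := charExp γ₀ σ₀ ν₀ with hF₀
  have hF₀c : Continuous F₀ := continuous_charExp hν₀
  have hFc : ∀ n, Continuous (F n) := fun n => continuous_charExp (hνx n)
  have hFlim : ∀ u, Tendsto (fun n => F n u) atTop (𝓝 (F₀ u)) := fun u => (h u).comp hxl
  have hloc : TendstoLocallyUniformly F F₀ atTop := tendstoLocallyUniformly_of_quasiAdditive
    (.of_forall fun n => isQuasiAdditive_charExp (hνx n)) hF₀c charExp_zero hFlim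
  have hunif := (tendstoLocallyUniformlyOn_iff_tendstoUniformlyOn_of_compact
    (isCompact_Icc (a := u - 1) (b := u + 1))).1 hloc.tendstoLocallyUniformlyOn
  rw [Metric.tendstoUniformlyOn_iff] at hunif
  have hint : Tendsto (fun n => ∫ s in (-1 : ℝ)..1, (F n u - F n (u + s))) atTop
      (𝓝 (∫ s in (-1 : ℝ)..1, (F₀ u - F₀ (u + s)))) := by
    refine intervalIntegral.tendsto_integral_filter_of_dominated_convergence
      (fun s => ‖F₀ u‖ + 1 + (‖F₀ (u + s)‖ + 1)) ?_ ?_ ?_ ?_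
    · exact .of_forall fun n => Continuous.aestronglyMeasurable (by have := hFc n; fun_prop)
    · filter_upwards [hunif 1 one_pos] with n hn
      refine .of_forall fun s hs => ?_
      rw [Set.uIoc_of_le (by norm_num)] at hs
      have hb : ∀ v ∈ Icc (u - 1) (u + 1), ‖F n v‖ ≤ ‖F₀ v‖ + 1 := fun v hv => by
        have h1 := hn v hv
        rw [dist_comm, dist_eq_norm] at h1
        have h2 := norm_sub_norm_le (F n v) (F₀ v)
        linarith
      exact (norm_sub_le _ _).trans (add_le_add (hb u ⟨by linarith, by linarith⟩)
        (hb (u + s) ⟨by linarith [hs.1], by linarith [hs.2]⟩))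
    · exact Continuous.intervalIntegrable (by fun_prop) _ _
    · exact .of_forall fun s _ => (hFlim u).sub (hFlim (u + s))
  have h2 := hint.const_mul (1 / 2 : ℂ)
  have e : ∀ (γ σ : ℝ) (ν : Measure ℝ), IsLevyMeasure ν → (1 / 2 : ℂ) *
      ∫ s in (-1 : ℝ)..1, (charExp γ σ ν u - charExp γ σ ν (u + s)) = charFun (levyK σ ν) u := by
    intro γ σ ν hν
    rw [← charFun_levyK hν]; ring
  rw [hF₀, e _ _ _ hν₀] at h2
  refine h2.congr fun n => ?_
  exact e _ _ _ (hνx n)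

/-- If Lévy exponents converge, then so do the integrals of every test function `h` of order
`O(x² ∧ 1)`, where the behaviour `h x ~ b x²` at `0` determines the contribution of the
Gaussian part. -/
theorem tendsto_integral_of_charExp {ι : Type*} {l : Filter ι} [l.IsCountablyGenerated]
    {γ σ : ι → ℝ} {ν : ι → Measure ℝ} {γ₀ σ₀ : ℝ} {ν₀ : Measure ℝ}
    (hν : ∀ᶠ i in l, IsLevyMeasure (ν i)) (hν₀ : IsLevyMeasure ν₀)
    (hlim : ∀ u, Tendsto (fun i => charExp (γ i) (σ i) (ν i) u) l (𝓝 (charExp γ₀ σ₀ ν₀ u)))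
    {h : ℝ → ℝ} (hm : Measurable h) {C : ℝ} (hC : ∀ x, |h x| ≤ C * min (x ^ 2) 1)
    (hc : ∀ᵐ x ∂ν₀, ContinuousAt h x) (b : ℝ)
    (hb : σ₀ ≠ 0 → Tendsto (fun x => h x / x ^ 2) (𝓝[≠] 0) (𝓝 b)) :
    Tendsto (fun i => ∫ x, h x ∂(ν i) + b * σ i ^ 2) l (𝓝 (∫ x, h x ∂ν₀ + b * σ₀ ^ 2)) := by
  classical
  -- divide by the density of `levyK`; `1 - sinc x ~ x² / 6` determines the value at `0`
  set g : ℝ → ℝ := Function.update (fun x => h x / (1 - Real.sinc x)) 0 (6 * b) with hg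
  have hC0 : 0 ≤ C := by
    have := (abs_nonneg _).trans (hC 1)
    simpa using this
  have hpos : ∀ x ≠ 0, 0 < 1 - Real.sinc x := fun x hx => by
    have h1 := min_le_one_sub_sinc x
    have h2 : 0 < min (x ^ 2) 1 := by positivity
    linarith
  have hgm : Measurable g := by
    have : g = fun x => if x = 0 then 6 * b else h x / (1 - Real.sinc x) := by
      funext x
      simp only [hg, Function.update_apply]
    rw [this]
    exact Measurable.ite (measurableSet_singleton 0) measurable_const
      (hm.div (measurable_const.sub Real.measurable_sinc))
  have hgne : ∀ x ≠ 0, g x = h x / (1 - Real.sinc x) := fun x hx => by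
    simp [hg, Function.update_of_ne hx]
  have hg0 : g 0 = 6 * b := by simp [hg]
  have hgC : ∀ x, |g x| ≤ max (16 * C) |6 * b| := fun x => by
    rcases eq_or_ne x 0 with rfl | hx
    · rw [hg0]; exact le_max_right _ _
    · rw [hgne x hx, abs_div, abs_of_pos (hpos x hx)]
      refine le_max_of_le_left ?_
      rw [div_le_iff₀ (hpos x hx)]
      have := mul_le_mul_of_nonneg_left (min_le_one_sub_sinc x) hC0
      have := hC x
      linarith
  have hgh : ∀ x, (1 - Real.sinc x) • g x = h x := fun x => by
    rcases eq_or_ne x 0 with rfl | hx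
    · have := hC 0
      simp at this
      simp [this]
    · rw [hgne x hx, smul_eq_mul, mul_div_cancel₀ _ (hpos x hx).ne']
  have hgint : ∀ (σ : ℝ) (ν : Measure ℝ), IsLevyMeasure ν →
      ∫ x, g x ∂(levyK σ ν) = ∫ x, h x ∂ν + b * σ ^ 2 := by
    intro σ ν hν
    rw [integral_levyK hν hgm.stronglyMeasurable hgC, hg0]
    simp only [hgh, smul_eq_mul]
    ring
  have hgcont : ∀ x ≠ 0, ContinuousAt h x → ContinuousAt g x := fun x hx hxc => by
    refine ContinuousAt.congr (f := fun x => h x / (1 - Real.sinc x)) (ContinuousAt.div hxc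
      (continuousAt_const.sub Real.continuous_sinc.continuousAt) (hpos x hx).ne') ?_
    filter_upwards [isOpen_ne.mem_nhds hx] with y hy
    exact (hgne y hy).symm
  have hgcont0 : σ₀ ≠ 0 → ContinuousAt g 0 := fun hσ => by
    have h1 : Tendsto (fun x => x ^ 2 / (1 - Real.sinc x)) (𝓝[≠] 0) (𝓝 6) := by
      have h2 : Tendsto (fun x : ℝ => (1 - Real.sinc x) / x ^ 2) (𝓝[≠] 0) (𝓝 (1 / 6)) := by
        rw [tendsto_iff_norm_sub_tendsto_zero]
        have h3 : Tendsto (fun x : ℝ => |x| * (5 / 96)) (𝓝[≠] 0) (𝓝 0) := by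
          have : Tendsto (fun x : ℝ => |x| * (5 / 96)) (𝓝 0) (𝓝 (|0| * (5 / 96))) :=
            Continuous.tendsto (by fun_prop) 0
          rw [abs_zero, zero_mul] at this
          exact this.mono_left nhdsWithin_le_nhds
        refine squeeze_zero' (.of_forall fun x => norm_nonneg _) ?_ h3
        filter_upwards [self_mem_nhdsWithin, nhdsWithin_le_nhds (Icc_mem_nhds
          (show (-1 : ℝ) < 0 by norm_num) one_pos)] with x hx hx1
        have hx : x ≠ 0 := hx
        have h4 := abs_one_sub_sinc_sub_le (abs_le.2 hx1)
        have h5 : (1 - Real.sinc x) / x ^ 2 - 1 / 6 = (1 - Real.sinc x - x ^ 2 / 6) / x ^ 2 := by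
          field_simp
        have hx2 : 0 < x ^ 2 := by positivity
        rw [Real.norm_eq_abs, h5, abs_div, abs_of_pos hx2, div_le_iff₀ hx2]
        refine h4.trans_eq ?_
        rw [← sq_abs x]
        ring
      have h3 := h2.inv₀ (by norm_num)
      simp only [inv_div] at h3
      simpa using h3
    have h2 := (hb hσ).mul h1
    rw [continuousAt_iff_punctured_nhds, hg0, mul_comm (6 : ℝ)]
    refine h2.congr' ?_
    filter_upwards [self_mem_nhdsWithin] with x hx
    have hx : x ≠ 0 := hx
    rw [hgne x hx]
    field_simp
  have h0 : ∀ᵐ x ∂ν₀, x ≠ 0 := by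
    rw [ae_iff]; simpa using hν₀.1
  have hgc : ∀ᵐ x ∂(levyK σ₀ ν₀), ContinuousAt g x := by
    unfold levyK
    rw [ae_add_measure_iff]
    constructor
    · refine (withDensity_absolutelyContinuous _ _).ae_le ?_
      filter_upwards [hc, h0] with x h1 h2 using hgcont x h2 h1
    · by_cases hσ : σ₀ = 0
      · simp [hσ]
      · refine Measure.ae_smul_measure ?_ _
        have : ∀ᵐ x ∂(Measure.dirac (0 : ℝ)), x = 0 := by
          rw [ae_dirac_iff (measurableSet_eq)]
        filter_upwards [this] with x hx
        rw [hx]; exact hgcont0 hσ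
  have key := tendsto_integral_levyK hν hν₀ hlim hgm hgC hgc
  rw [hgint _ _ hν₀] at key
  refine key.congr' ?_
  filter_upwards [hν] with i hi
  exact hgint _ _ hi

end

section

variable {γ σ γ₀ σ₀ : ℝ} {ν ν₀ : Measure ℝ} {e : ℝ → ℝ}

/-! ### What attraction says about the triplet -/

/-- Attraction is convergence of the exponents of the zoomed triplets. -/
lemma TendsToUnder.tendsto_charExp_zoom (hν : IsLevyMeasure ν) (he : ∀ᶠ z in 𝓝[>] 0, 0 < e z)
    (h : TendsToUnder e (charExp γ σ ν) (charExp γ₀ σ₀ ν₀)) (u : ℝ) :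
    Tendsto (fun z => charExp (e z * truncMean γ ν z / z) (√(e z) * σ / z) (zoom (e z) z ν) u)
      (𝓝[>] 0) (𝓝 (charExp γ₀ σ₀ ν₀ u)) := by
  refine (h u).congr' ?_
  filter_upwards [he, Ioc_mem_nhdsGT one_pos] with z hz hz1
  exact (charExp_zoom hν hz.le hz1.1 hz1.2 u).symm

lemma TendsToUnder.tendsto_integral (hν : IsLevyMeasure ν) (hν₀ : IsLevyMeasure ν₀)
    (he : ∀ᶠ z in 𝓝[>] 0, 0 < e z)
    (h : TendsToUnder e (charExp γ σ ν) (charExp γ₀ σ₀ ν₀)) {k : ℝ → ℝ} (hm : Measurable k)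
    {C : ℝ} (hC : ∀ x, |k x| ≤ C * min (x ^ 2) 1) (hc : ∀ᵐ x ∂ν₀, ContinuousAt k x) (b : ℝ)
    (hb : σ₀ ≠ 0 → Tendsto (fun x => k x / x ^ 2) (𝓝[≠] 0) (𝓝 b)) :
    Tendsto (fun z => ∫ x, k x ∂(zoom (e z) z ν) + b * (√(e z) * σ / z) ^ 2) (𝓝[>] 0)
      (𝓝 (∫ x, k x ∂ν₀ + b * σ₀ ^ 2)) := by
  refine tendsto_integral_of_charExp (γ := fun z => e z * truncMean γ ν z / z)
    (σ := fun z => √(e z) * σ / z) (ν := fun z => zoom (e z) z ν) ?_ hν₀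
    (h.tendsto_charExp_zoom hν he) hm hC hc b hb
  filter_upwards [self_mem_nhdsWithin] with z hz
  exact hν.zoom hz

lemma continuousAt_indicator_of_notMem {s t : Set ℝ} {k : ℝ → ℝ} (hk : Continuous k)
    (hs : frontier s ⊆ t) {x : ℝ} (hx : x ∉ t) : ContinuousAt (s.indicator k) x := by
  have hx' : x ∉ frontier s := fun h => hx (hs h)
  rw [frontier_eq_closure_inter_closure, mem_inter_iff, not_and_or] at hx'
  rcases hx' with h | h
  · refine (continuousAt_const (y := (0 : ℝ))).congr ?_
    filter_upwards [isClosed_closure.isOpen_compl.mem_nhds h] with y hy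
    rw [indicator_of_notMem fun hys => hy (subset_closure hys)]
  · refine hk.continuousAt.congr ?_
    filter_upwards [isClosed_closure.isOpen_compl.mem_nhds h] with y hy
    rw [indicator_of_mem (by_contra fun hys => hy (subset_closure hys))]

lemma TendsToUnder.tendsto_truncVar (hν : IsLevyMeasure ν) (hν₀ : IsLevyMeasure ν₀)
    (he : ∀ᶠ z in 𝓝[>] 0, 0 < e z)
    (h : TendsToUnder e (charExp γ σ ν) (charExp γ₀ σ₀ ν₀)) {x : ℝ} (hx : 0 < x)
    (hx₀ : ν₀ {x, -x} = 0) :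
    Tendsto (fun z => e z * truncVar σ ν (z * x) / z ^ 2) (𝓝[>] 0) (𝓝 (truncVar σ₀ ν₀ x)) := by
  have hset : {y : ℝ | |y| < x} = Ioo (-x) x := by ext y; simp [abs_lt]
  have hfr : frontier {y : ℝ | |y| < x} ⊆ {x, -x} := by
    rw [hset, frontier_Ioo (by linarith)]; exact (pair_comm _ _).le
  have key := h.tendsto_integral hν hν₀ he (k := {y : ℝ | |y| < x}.indicator fun y => y ^ 2)
    (C := max (x ^ 2) 1) ((by fun_prop : Measurable fun y : ℝ => y ^ 2).indicator
      (measurableSet_abs_lt x)) (fun y => ?_) ?_ 1 fun _ => ?_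
  · have hval : ∀ (s : ℝ) (ρ : Measure ℝ), ∫ y, {y : ℝ | |y| < x}.indicator (fun y => y ^ 2) y ∂ρ +
        1 * s ^ 2 = truncVar s ρ x := fun s ρ => by
      rw [integral_indicator (measurableSet_abs_lt x), truncVar]; ring
    rw [hval] at key
    refine key.congr' ?_
    filter_upwards [he, self_mem_nhdsWithin] with z hz hz0
    rw [hval, truncVar_zoom hz.le hz0]
  · by_cases hy : |y| < x
    · rw [indicator_of_mem (by exact hy), abs_of_nonneg (sq_nonneg y)]
      have hyx : y ^ 2 ≤ x ^ 2 := by rw [← sq_abs y]; gcongr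
      rcases le_total (y ^ 2) 1 with h1 | h1
      · rw [min_eq_left h1]
        nlinarith [le_max_right (x ^ 2) 1, sq_nonneg y]
      · rw [min_eq_right h1]
        linarith [le_max_left (x ^ 2) 1]
    · rw [indicator_of_notMem (by exact hy), abs_zero]
      positivity
  · have : ∀ᵐ y ∂ν₀, y ∉ ({x, -x} : Set ℝ) := measure_eq_zero_iff_ae_notMem.1 hx₀
    filter_upwards [this] with y hy
    exact continuousAt_indicator_of_notMem (by fun_prop) hfr hy
  · refine tendsto_const_nhds.congr' ?_
    filter_upwards [self_mem_nhdsWithin, nhdsWithin_le_nhds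
      (show {y : ℝ | |y| < x} ∈ 𝓝 0 by
        rw [hset]; exact Ioo_mem_nhds (by linarith) hx)] with y hy0 hy
    have hy0 : y ≠ 0 := hy0
    rw [indicator_of_mem (show y ∈ {y : ℝ | |y| < x} from hy)]
    field_simp

lemma TendsToUnder.tendsto_sigma (hν : IsLevyMeasure ν) (hν₀ : IsLevyMeasure ν₀)
    (he : ∀ᶠ z in 𝓝[>] 0, 0 < e z)
    (h : TendsToUnder e (charExp γ σ ν) (charExp γ₀ 0 ν₀)) :
    Tendsto (fun z => e z * σ ^ 2 / z ^ 2) (𝓝[>] 0) (𝓝 0) := by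
  have key := h.tendsto_integral hν hν₀ he (k := fun _ => 0) (C := 0) measurable_const
    (fun y => by simp) (.of_forall fun _ => continuousAt_const) 1 fun h => absurd rfl h
  simp only [integral_zero, zero_add, one_mul, ne_eq, OfNat.ofNat_ne_zero, not_false_eq_true,
    zero_pow] at key
  refine key.congr' ?_
  filter_upwards [he] with z hz
  rw [div_pow, mul_pow, Real.sq_sqrt hz.le]

/-- A set bounded away from `0` whose boundary is not charged by the limit. -/
lemma TendsToUnder.tendsto_measure (hν : IsLevyMeasure ν) (hν₀ : IsLevyMeasure ν₀)
    (he : ∀ᶠ z in 𝓝[>] 0, 0 < e z)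
    (h : TendsToUnder e (charExp γ σ ν) (charExp γ₀ 0 ν₀)) {s : Set ℝ} (hs : MeasurableSet s)
    {x : ℝ} (hx : 0 < x) (hsx : s ⊆ {y | x ≤ |y|}) (hs₀ : ν₀ (frontier s) = 0) :
    Tendsto (fun z => (zoom (e z) z ν).real s) (𝓝[>] 0) (𝓝 (ν₀.real s)) := by
  have key := h.tendsto_integral hν hν₀ he (k := s.indicator fun _ => 1)
    (C := 1 / min (x ^ 2) 1) (measurable_const.indicator hs) (fun y => ?_) ?_ 0
    fun h => absurd rfl h
  · simpa [integral_indicator_one hs, ← Pi.one_def] using key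
  · have hp : 0 < min (x ^ 2) 1 := by positivity
    by_cases hy : y ∈ s
    · rw [indicator_of_mem hy, abs_one, div_mul_eq_mul_div, one_mul, le_div_iff₀ hp, one_mul]
      have : x ≤ |y| := hsx hy
      rw [← sq_abs y]
      gcongr
    · rw [indicator_of_notMem hy, abs_zero]; positivity
  · filter_upwards [measure_eq_zero_iff_ae_notMem.1 hs₀] with y hy
    exact continuousAt_indicator_of_notMem continuous_const subset_rfl hy

lemma TendsToUnder.tendsto_tailPos (hν : IsLevyMeasure ν) (hν₀ : IsLevyMeasure ν₀)
    (he : ∀ᶠ z in 𝓝[>] 0, 0 < e z)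
    (h : TendsToUnder e (charExp γ σ ν) (charExp γ₀ 0 ν₀)) {x : ℝ} (hx : 0 < x)
    (hx₀ : ν₀ {x} = 0) :
    Tendsto (fun z => e z * tailPos ν (z * x)) (𝓝[>] 0) (𝓝 (tailPos ν₀ x)) := by
  refine (h.tendsto_measure hν hν₀ he measurableSet_Ioi hx
    (fun y hy => (le_of_lt hy).trans (le_abs_self y)) (by rwa [frontier_Ioi])).congr' ?_
  filter_upwards [he, self_mem_nhdsWithin] with z hz hz0
  exact tailPos_zoom hz.le hz0 x

lemma TendsToUnder.tendsto_tailNeg (hν : IsLevyMeasure ν) (hν₀ : IsLevyMeasure ν₀)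
    (he : ∀ᶠ z in 𝓝[>] 0, 0 < e z)
    (h : TendsToUnder e (charExp γ σ ν) (charExp γ₀ 0 ν₀)) {x : ℝ} (hx : 0 < x)
    (hx₀ : ν₀ {-x} = 0) :
    Tendsto (fun z => e z * tailNeg ν (z * x)) (𝓝[>] 0) (𝓝 (tailNeg ν₀ x)) := by
  refine (h.tendsto_measure hν hν₀ he measurableSet_Iio hx
    (fun y hy => (le_neg.1 (le_of_lt hy)).trans (neg_le_abs y)) (by rwa [frontier_Iio])).congr' ?_
  filter_upwards [he, self_mem_nhdsWithin] with z hz hz0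
  exact tailNeg_zoom hz.le hz0 x

lemma charExp_im (hν : IsLevyMeasure ν) (u : ℝ) :
    (charExp γ σ ν u).im = γ * u + ∫ x, (levyKernel u x).im ∂ν := by
  have h1 := integral_im (𝕜 := ℂ) (hν.integrable_levyKernel u)
  have h2 : ∫ x, (levyKernel u x).im ∂ν = (∫ x, levyKernel u x ∂ν).im := h1
  rw [charExp_eq, h2, Complex.add_im, Complex.sub_im, Complex.ofReal_im, sub_zero,
    ← Complex.ofReal_mul, Complex.im_ofReal_mul, Complex.I_im, mul_one]

lemma continuousAt_levyKernel {u x : ℝ} (hx : x ∉ ({1, -1} : Set ℝ)) :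
    ContinuousAt (levyKernel u) x := by
  have h1 : |x| ≠ 1 := fun h => hx (by rcases (abs_eq zero_le_one).1 h with h | h <;> simp [h])
  rcases lt_or_gt_of_ne h1 with h | h
  · refine ContinuousAt.congr (f := fun x : ℝ => Complex.exp ((u * x : ℝ) * Complex.I) - 1 -
      ((u * x : ℝ) : ℂ) * Complex.I) (by fun_prop) ?_
    filter_upwards [(isOpen_lt continuous_abs continuous_const).mem_nhds h] with y hy
    exact (levyKernel_of_lt hy).symm
  · refine ContinuousAt.congr (f := fun x : ℝ => Complex.exp ((u * x : ℝ) * Complex.I) - 1)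
      (by fun_prop) ?_
    filter_upwards [(isOpen_lt continuous_const continuous_abs).mem_nhds h] with y hy
    exact (levyKernel_of_le (le_of_lt hy)).symm

/-- Convergence of the exponents at a single frequency identifies the drift, as the integrals of
the imaginary part of the kernel converge. -/
lemma TendsToUnder.tendsto_truncMean (hν : IsLevyMeasure ν) (hν₀ : IsLevyMeasure ν₀)
    (he : ∀ᶠ z in 𝓝[>] 0, 0 < e z)
    (h : TendsToUnder e (charExp γ σ ν) (charExp γ₀ 0 ν₀)) (hx₀ : ν₀ {1, -1} = 0) :
    Tendsto (fun z => e z * truncMean γ ν z / z) (𝓝[>] 0) (𝓝 γ₀) := by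
  have key := h.tendsto_integral hν hν₀ he (k := fun x => (levyKernel 1 x).im) (C := 5)
    (Complex.measurable_im.comp (measurable_levyKernel 1)) (fun y => ?_) ?_ 0
    fun h => absurd rfl h
  · have h1 := ((Complex.continuous_im.tendsto _).comp (h.tendsto_charExp_zoom hν he 1)).sub key
    rw [charExp_im hν₀] at h1
    have h2 : γ₀ * 1 + ∫ x, (levyKernel 1 x).im ∂ν₀ -
        (∫ x, (levyKernel 1 x).im ∂ν₀ + 0 * 0 ^ 2) = γ₀ := by ring
    rw [h2] at h1
    refine h1.congr' ?_
    filter_upwards [self_mem_nhdsWithin] with z hz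
    simp only [Function.comp_apply]
    rw [charExp_im (hν.zoom hz)]
    ring
  · refine (Complex.abs_im_le_norm _).trans ((norm_levyKernel_le 1 y).trans_eq ?_)
    norm_num
  · filter_upwards [measure_eq_zero_iff_ae_notMem.1 hx₀] with y hy
    exact Complex.continuous_im.continuousAt.comp (continuousAt_levyKernel hy)

/-! ### From convergence along a scaling function to the criteria -/

lemma zoomsInTo_iff {a : ℝ → ℝ} : ZoomsInTo (levyExponent γ σ ν) (levyExponent γ₀ σ₀ ν₀) a ↔
    TendsToAlong a (charExp γ σ ν) (charExp γ₀ σ₀ ν₀) := by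
  have h : ∀ u ε : ℝ, (ε : ℂ) * levyExponent γ σ ν (u * Complex.I / a ε) =
      (ε : ℂ) * charExp γ σ ν (u / a ε) := fun u ε => by
    unfold charExp
    congr 2
    push_cast
    ring
  simp only [ZoomsInTo, TendsToAlong, h, charExp]

/-- The common shape of the criteria: `C` is the condition for attraction, `e₀` the time scale
that goes with the space scale `z`, and `R` is the asymptotic relation which says that the
scaling function inverts `e₀`. -/
lemma attraction_criterion (hν : IsLevyMeasure ν) {α : ℝ}
    (hg : IsHomogeneousExponent α (charExp γ₀ σ₀ ν₀)) {C : Prop} {R : (ℝ → ℝ) → Prop} {e₀ : ℝ → ℝ}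
    (hsuff : C → (∀ᶠ z in 𝓝[>] 0, 0 < e₀ z) ∧
      TendsToUnder e₀ (charExp γ σ ν) (charExp γ₀ σ₀ ν₀))
    (hnec : ∀ e : ℝ → ℝ, (∀ᶠ z in 𝓝[>] 0, 0 < e z) →
      TendsToUnder e (charExp γ σ ν) (charExp γ₀ σ₀ ν₀) → C)
    (hR : C → ∀ a, IsScaling a → ((Tendsto a (𝓝[>] 0) (𝓝[>] 0) ∧
      Tendsto (fun ε => e₀ (a ε) / ε) (𝓝[>] 0) (𝓝 1)) ↔ R a)) :
    (IsAttractedTo (levyExponent γ σ ν) (levyExponent γ₀ σ₀ ν₀) ↔ C) ∧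
      ∀ a, IsScaling a →
        (ZoomsInTo (levyExponent γ σ ν) (levyExponent γ₀ σ₀ ν₀) a ↔ C ∧ R a) := by
  have hC : ∀ a, IsScaling a → TendsToAlong a (charExp γ σ ν) (charExp γ₀ σ₀ ν₀) → C := by
    intro a ha h
    obtain ⟨e, he, h'⟩ := h.exists_tendsToUnder (isQuasiAdditive_charExp hν) hg ha
    exact hnec e he h'
  refine ⟨⟨fun ⟨a, ha, h⟩ => hC a ha (zoomsInTo_iff.1 h), fun h => ?_⟩, fun a ha => ?_⟩
  · obtain ⟨he, h'⟩ := hsuff h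
    obtain ⟨a, ha, h2⟩ := h'.exists_scaling (continuous_charExp hν) hg he
    exact ⟨a, ha, zoomsInTo_iff.2 h2⟩
  · have key : C → (TendsToAlong a (charExp γ σ ν) (charExp γ₀ σ₀ ν₀) ↔ R a) := fun h => by
      obtain ⟨he, h'⟩ := hsuff h
      exact (h'.tendsToAlong_iff (continuous_charExp hν) hg.map_one_ne_zero he ha).trans
        (hR h a ha)
    rw [zoomsInTo_iff]
    exact ⟨fun h => ⟨hC a ha h, (key (hC a ha h)).1 h⟩, fun h => (key h.1).2 h.2⟩

/-- A scaling function along which the time scale tends to zero must itself vanish, if the time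
scale is bounded away from zero at positive distances. The value `e₀ x = 0` is excluded as it only
arises from a division by zero. -/
lemma tendsto_scaling_of_tendsto_one {a e₀ : ℝ → ℝ} (ha : IsScaling a)
    (hb : ∀ c > 0, ∃ δ > 0, ∀ x ≥ c, e₀ x ≠ 0 → δ ≤ |e₀ x|)
    (h : Tendsto (fun ε => e₀ (a ε) / ε) (𝓝[>] 0) (𝓝 1)) : Tendsto a (𝓝[>] 0) (𝓝[>] 0) := by
  have h0 : Tendsto (fun ε => e₀ (a ε)) (𝓝[>] 0) (𝓝 0) := by
    have h1 := h.mul (tendsto_id.mono_left nhdsWithin_le_nhds : Tendsto id (𝓝[>] (0 : ℝ)) (𝓝 0))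
    rw [mul_zero] at h1
    refine h1.congr' ?_
    filter_upwards [self_mem_nhdsWithin] with ε hε
    have hε : 0 < ε := hε
    simp only [id]
    field_simp
  refine tendsto_nhdsWithin_iff.2 ⟨?_, by
    filter_upwards [self_mem_nhdsWithin] with ε hε using ha ε hε⟩
  rw [Metric.tendsto_nhds]
  intro c hc
  obtain ⟨δ, hδ, hδ'⟩ := hb c hc
  filter_upwards [(Metric.tendsto_nhds.1 h0) δ hδ, h.eventually_ne one_ne_zero,
    self_mem_nhdsWithin] with ε h1 h2 h3
  rw [Real.dist_eq, sub_zero, abs_of_pos (ha ε h3)]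
  by_contra! hcon
  rw [Real.dist_eq, sub_zero] at h1
  refine absurd (hδ' _ hcon fun h4 => h2 ?_) (not_le.2 h1)
  rw [h4, zero_div]

/-! ### The Brownian and the drift case -/

lemma isHomogeneousExponent_gaussian {σhat : ℝ} (hσ : 0 < σhat) :
    IsHomogeneousExponent 2 (charExp 0 σhat 0) where
  alpha_pos := two_pos
  continuous := continuous_charExp isLevyMeasure_zero
  map_mul w u hw := by
    rw [charExp_zero_measure, charExp_zero_measure, Real.rpow_two]
    push_cast
    ring
  map_one_ne_zero := by
    rw [charExp_zero_measure]
    have : σhat ^ 2 * 1 ^ 2 / 2 ≠ 0 := by positivity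
    have h2 : ((σhat ^ 2 * 1 ^ 2 / 2 : ℝ) : ℂ) ≠ 0 := by exact_mod_cast this
    simpa using hσ.ne'

lemma isHomogeneousExponent_drift {γhat : ℝ} (hγ : γhat ≠ 0) :
    IsHomogeneousExponent 1 (charExp γhat 0 0) where
  alpha_pos := one_pos
  continuous := continuous_charExp isLevyMeasure_zero
  map_mul w u hw := by
    rw [charExp_zero_measure, charExp_zero_measure, Real.rpow_one]
    push_cast
    ring
  map_one_ne_zero := by
    rw [charExp_zero_measure]
    simpa using hγ

lemma attraction_gaussian (hν : IsLevyMeasure ν) {σhat : ℝ} (hσ : 0 < σhat) :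
    (IsAttractedTo (levyExponent γ σ ν) (levyExponent 0 σhat 0) ↔
        RegVaryingAtZero 0 (truncVar σ ν)) ∧
      ∀ a : ℝ → ℝ, IsScaling a →
        (ZoomsInTo (levyExponent γ σ ν) (levyExponent 0 σhat 0) a ↔
          RegVaryingAtZero 0 (truncVar σ ν) ∧
          (fun ε => a ε ^ 2 / truncVar σ ν (a ε)) ~[𝓝[>] 0] (fun ε => ε / σhat ^ 2)) := by
  refine attraction_criterion hν (isHomogeneousExponent_gaussian hσ)
    (e₀ := fun z => σhat ^ 2 * z ^ 2 / truncVar σ ν z) (fun hv => ⟨?_, tendsToUnder_gaussian hν hσ hv⟩)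
    (fun e he h => ?_) fun hv a ha => ?_
  · filter_upwards [hv.eventually_pos, self_mem_nhdsWithin] with z hz hz0
    have hz0 : 0 < z := hz0
    positivity
  · have hlim : ∀ x > 0, Tendsto (fun z => e z * truncVar σ ν (z * x) / z ^ 2) (𝓝[>] 0)
        (𝓝 (σhat ^ 2)) := fun x hx => by
      have := h.tendsto_truncVar hν isLevyMeasure_zero he hx (by simp)
      simpa [truncVar] using this
    have h1 := hlim 1 one_pos
    simp only [mul_one] at h1
    have hσ2 : 0 < σhat ^ 2 := by positivity
    refine regVaryingAtZero_truncVar_of_tendsto hν ?_ fun x hx => ?_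
    · filter_upwards [h1.eventually (lt_mem_nhds hσ2), he, self_mem_nhdsWithin] with z hz hez hz0
      have hz0 : 0 < z := hz0
      refine (truncVar_nonneg z).lt_of_ne fun h0 => ?_
      rw [← h0, mul_zero, zero_div] at hz
      exact lt_irrefl _ hz
    · have h2 := (hlim x hx).div h1 hσ2.ne'
      rw [div_self hσ2.ne'] at h2
      refine h2.congr' ?_
      filter_upwards [he, self_mem_nhdsWithin] with z hez hz0
      have hz0 : 0 < z := hz0
      simp only [Pi.div_apply]
      rw [mul_comm x z, div_div_div_cancel_right₀ (by positivity),
        mul_div_mul_left _ _ hez.ne']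
  · have hiff : (fun ε => a ε ^ 2 / truncVar σ ν (a ε)) ~[𝓝[>] 0] (fun ε => ε / σhat ^ 2) ↔
        Tendsto (fun ε => σhat ^ 2 * a ε ^ 2 / truncVar σ ν (a ε) / ε) (𝓝[>] 0) (𝓝 1) := by
      rw [Asymptotics.isEquivalent_iff_tendsto_one]
      · refine tendsto_congr fun ε => ?_
        simp only [Pi.div_apply]
        rw [div_div_eq_mul_div]
        ring
      · filter_upwards [self_mem_nhdsWithin] with ε hε
        have hε : 0 < ε := hε
        positivity
    rw [hiff]
    refine ⟨fun h => h.2, fun h => ⟨?_, h⟩⟩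
    refine tendsto_scaling_of_tendsto_one (e₀ := fun z => σhat ^ 2 * z ^ 2 / truncVar σ ν z) ha
      (fun c hc => ?_) h
    have hB : 0 < truncVar σ ν c + c ^ 2 * closedTail ν c + 1 := by
      have := truncVar_nonneg (σ := σ) (ν := ν) c
      have := closedTail_nonneg (ν := ν) c
      positivity
    refine ⟨σhat ^ 2 * c ^ 2 / (truncVar σ ν c + c ^ 2 * closedTail ν c + 1), by positivity,
      fun x hx hne => ?_⟩
    have hx : c ≤ x := hx
    have hx0 : 0 < x := hc.trans_le hx
    have hv0 : 0 < truncVar σ ν x := (truncVar_nonneg x).lt_of_ne fun h0 => hne (by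
      simp only [← h0, div_zero])
    rw [abs_of_pos (by positivity), div_le_div_iff₀ hB hv0]
    -- `v x ≤ v c + x² Π(|y| ≥ c)`
    have h1 : truncVar σ ν x ≤ truncVar σ ν c + x ^ 2 * closedTail ν c := by
      have h2 := hν.truncVar_sub (σ := σ) hx
      have h3 := hν.setIntegral_shell_le hc (z := x) (h := fun y => y ^ 2) (C := x ^ 2)
        (sq_nonneg x) fun y hy => by
          rw [abs_of_nonneg (sq_nonneg y), ← sq_abs]; gcongr
      have h4 := (le_abs_self _).trans h3
      linarith
    have hT := closedTail_nonneg (ν := ν) c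
    have hV := truncVar_nonneg (σ := σ) (ν := ν) c
    have hcx : c ^ 2 ≤ x ^ 2 := by gcongr
    have h5 : c ^ 2 * truncVar σ ν x ≤ x ^ 2 * (truncVar σ ν c + c ^ 2 * closedTail ν c + 1) := by
      calc c ^ 2 * truncVar σ ν x ≤ c ^ 2 * (truncVar σ ν c + x ^ 2 * closedTail ν c) := by gcongr
        _ = c ^ 2 * truncVar σ ν c + x ^ 2 * (c ^ 2 * closedTail ν c) := by ring
        _ ≤ x ^ 2 * truncVar σ ν c + x ^ 2 * (c ^ 2 * closedTail ν c) := by gcongr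
        _ ≤ _ := by nlinarith [sq_nonneg x]
    calc σhat ^ 2 * c ^ 2 * truncVar σ ν x = σhat ^ 2 * (c ^ 2 * truncVar σ ν x) := by ring
      _ ≤ σhat ^ 2 * (x ^ 2 * (truncVar σ ν c + c ^ 2 * closedTail ν c + 1)) := by gcongr
      _ = _ := by ring

lemma IsLevyMeasure.tendsto_mul_truncMean (hν : IsLevyMeasure ν) :
    Tendsto (fun z => z * truncMean γ ν z) (𝓝[>] 0) (𝓝 0) := by
  have hid : Tendsto (fun z : ℝ => z) (𝓝[>] 0) (𝓝 0) := nhdsWithin_le_nhds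
  have h1 : Tendsto (fun z => z * |γ| + z * absMoment ν z) (𝓝[>] 0) (𝓝 0) := by
    simpa using (hid.mul_const |γ|).add hν.tendsto_mul_absMoment
  refine squeeze_zero_norm' ?_ h1
  filter_upwards [self_mem_nhdsWithin] with z hz
  have hz : 0 < z := hz
  rw [Real.norm_eq_abs, abs_mul, abs_of_pos hz, ← mul_add]
  gcongr
  exact abs_truncMean_le z

lemma attraction_drift (hν : IsLevyMeasure ν) {γhat : ℝ} (hγ : γhat ≠ 0) :
    (IsAttractedTo (levyExponent γ σ ν) (levyExponent γhat 0 0) ↔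
        σ = 0 ∧ (∀ᶠ x in 𝓝[>] 0, 0 < truncMean γ ν x / γhat) ∧
        Tendsto (fun x => x * tail ν x / truncMean γ ν x) (𝓝[>] 0) (𝓝 0)) ∧
      ∀ a : ℝ → ℝ, IsScaling a →
        (ZoomsInTo (levyExponent γ σ ν) (levyExponent γhat 0 0) a ↔
          (σ = 0 ∧ (∀ᶠ x in 𝓝[>] 0, 0 < truncMean γ ν x / γhat) ∧
            Tendsto (fun x => x * tail ν x / truncMean γ ν x) (𝓝[>] 0) (𝓝 0)) ∧
          (fun ε => a ε / truncMean γ ν (a ε)) ~[𝓝[>] 0] (fun ε => ε / γhat)) := by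
  refine attraction_criterion hν (isHomogeneousExponent_drift hγ)
    (e₀ := fun z => γhat * z / truncMean γ ν z)
    (fun hc => ⟨?_, tendsToUnder_drift hν hγ hc.1 hc.2.1 hc.2.2⟩) (fun e he h => ?_)
    fun hv a ha => ?_
  · filter_upwards [hc.2.1, self_mem_nhdsWithin] with z hz hz0
    have hz0 : 0 < z := hz0
    have : γhat * z / truncMean γ ν z = z / (truncMean γ ν z / γhat) := by
      rw [div_div_eq_mul_div, mul_comm]
    rw [this]
    positivity
  · have hmean := h.tendsto_truncMean hν isLevyMeasure_zero he (by simp)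
    have htail : Tendsto (fun z => e z * tail ν z) (𝓝[>] 0) (𝓝 0) := by
      have h1 := (h.tendsto_tailPos hν isLevyMeasure_zero he one_pos (by simp)).add
        (h.tendsto_tailNeg hν isLevyMeasure_zero he one_pos (by simp))
      simpa [tailPos, tailNeg, tail, mul_add] using h1
    refine ⟨?_, ?_, ?_⟩
    · -- `e m / z = (e / z²) (z m)` would vanish in the limit if `σ` did not
      by_contra hσ
      have h1 : Tendsto (fun z => e z * σ ^ 2 / z ^ 2 * (z * truncMean γ ν z) / σ ^ 2) (𝓝[>] 0)
          (𝓝 (0 * 0 / σ ^ 2)) :=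
        ((h.tendsto_sigma hν isLevyMeasure_zero he).mul hν.tendsto_mul_truncMean).div_const _
      rw [zero_mul, zero_div] at h1
      refine hγ (tendsto_nhds_unique hmean (h1.congr' ?_))
      filter_upwards [self_mem_nhdsWithin] with z hz
      have hz : 0 < z := hz
      field_simp
    · have h1 := hmean.div_const γhat
      rw [div_self hγ] at h1
      filter_upwards [h1.eventually (lt_mem_nhds one_pos), he, self_mem_nhdsWithin] with z h2 h3 hz
      have hz : 0 < z := hz
      have h4 : e z * truncMean γ ν z / z / γhat = truncMean γ ν z / γhat * (e z / z) := by ring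
      rw [h4] at h2
      exact pos_of_mul_pos_left h2 (by positivity)
    · have h1 := htail.div hmean hγ
      rw [zero_div] at h1
      refine h1.congr' ?_
      filter_upwards [he, self_mem_nhdsWithin] with z h3 hz
      have hz : 0 < z := hz
      simp only [Pi.div_apply]
      rw [div_div_eq_mul_div, mul_assoc, mul_div_mul_left _ _ h3.ne', mul_comm]
  · have hiff : (fun ε => a ε / truncMean γ ν (a ε)) ~[𝓝[>] 0] (fun ε => ε / γhat) ↔
        Tendsto (fun ε => γhat * a ε / truncMean γ ν (a ε) / ε) (𝓝[>] 0) (𝓝 1) := by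
      rw [Asymptotics.isEquivalent_iff_tendsto_one]
      · refine tendsto_congr fun ε => ?_
        simp only [Pi.div_apply]
        rw [div_div_eq_mul_div]
        ring
      · filter_upwards [self_mem_nhdsWithin] with ε hε
        have hε : ε ≠ 0 := ne_of_gt hε
        exact div_ne_zero hε hγ
    rw [hiff]
    refine ⟨fun h => h.2, fun h => ⟨?_, h⟩⟩
    refine tendsto_scaling_of_tendsto_one (e₀ := fun z => γhat * z / truncMean γ ν z) ha
      (fun c hc => ?_) h
    have hB : 0 < |γ| + absMoment ν c + 1 := by
      have := absMoment_nonneg (ν := ν) c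
      positivity
    have hγ' : 0 < |γhat| := abs_pos.2 hγ
    refine ⟨|γhat| * c / (|γ| + absMoment ν c + 1), by positivity, fun x hx hne => ?_⟩
    have hx : c ≤ x := hx
    have hx0 : 0 < x := hc.trans_le hx
    have hm0 : truncMean γ ν x ≠ 0 := fun h0 => hne (by simp only [h0, div_zero])
    rw [abs_div, abs_mul, abs_of_pos hx0]
    have h1 : |truncMean γ ν x| ≤ |γ| + absMoment ν c + 1 := by
      linarith [abs_truncMean_le (γ := γ) (ν := ν) x, hν.absMoment_anti hc hx]
    have h2 : 0 < |truncMean γ ν x| := abs_pos.2 hm0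
    gcongr

end

section

variable {α cp cn γhat : ℝ}

/-! ### The Lévy measure of a strictly stable process -/

/-- The Lebesgue density of `stableLevyMeasure α cp cn`. -/
noncomputable def stableDensity (α cp cn x : ℝ) : ℝ :=
  if 0 < x then cp * x ^ (-1 - α) else if x < 0 then cn * |x| ^ (-1 - α) else 0

lemma stableLevyMeasure_eq : stableLevyMeasure α cp cn =
    volume.withDensity fun x => ENNReal.ofReal (stableDensity α cp cn x) := rfl

lemma measurable_stableDensity : Measurable (stableDensity α cp cn) := by
  refine Measurable.ite measurableSet_Ioi (by fun_prop)
    (Measurable.ite measurableSet_Iio ?_ measurable_const)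
  have h : Measurable fun x : ℝ => x ^ (-1 - α) := by fun_prop
  exact (h.comp measurable_norm).const_mul cn

lemma stableDensity_nonneg (hp : 0 ≤ cp) (hn : 0 ≤ cn) (x : ℝ) : 0 ≤ stableDensity α cp cn x := by
  unfold stableDensity
  split_ifs <;> positivity

lemma stableDensity_of_pos {x : ℝ} (hx : 0 < x) : stableDensity α cp cn x = cp * x ^ (-1 - α) :=
  if_pos hx

lemma stableDensity_neg (x : ℝ) : stableDensity α cp cn (-x) = stableDensity α cn cp x := by
  unfold stableDensity
  rcases lt_trichotomy x 0 with h | h | h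
  · simp [h, h.not_gt, abs_of_neg h]
  · simp [h]
  · simp [h, h.not_gt, abs_of_pos h]

lemma stableDensity_mul {z : ℝ} (hz : 0 < z) (x : ℝ) :
    stableDensity α cp cn (z * x) = z ^ (-1 - α) * stableDensity α cp cn x := by
  unfold stableDensity
  rcases lt_trichotomy x 0 with h | h | h
  · have h1 := mul_neg_of_pos_of_neg hz h
    simp only [h1, h, h1.not_gt, h.not_gt, if_true, if_false, abs_mul, abs_of_pos hz]
    rw [Real.mul_rpow hz.le (abs_nonneg x)]
    ring
  · simp [h]
  · have h1 := mul_pos hz h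
    simp only [h1, h, if_true]
    rw [Real.mul_rpow hz.le h.le]
    ring

/-- Reflection exchanges the two intensities. -/
lemma stableLevyMeasure_preimage_neg {s : Set ℝ} (hs : MeasurableSet s) :
    stableLevyMeasure α cp cn (Neg.neg ⁻¹' s) = stableLevyMeasure α cn cp s := by
  rw [stableLevyMeasure_eq, stableLevyMeasure_eq, withDensity_apply _ (measurable_neg hs),
    withDensity_apply _ hs]
  rw [← (Measure.measurePreserving_neg (volume : Measure ℝ)).setLIntegral_comp_preimage hs
    measurable_stableDensity.ennreal_ofReal]
  simp only [stableDensity_neg]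

lemma stableLevyMeasure_map_neg :
    (stableLevyMeasure α cp cn).map Neg.neg = stableLevyMeasure α cn cp := by
  ext s hs
  rw [Measure.map_apply measurable_neg hs, stableLevyMeasure_preimage_neg hs]

lemma stableLevyMeasure_singleton (x : ℝ) : stableLevyMeasure α cp cn {x} = 0 :=
  withDensity_absolutelyContinuous _ _ (measure_singleton x)

lemma stableLevyMeasure_pair (x y : ℝ) : stableLevyMeasure α cp cn {x, y} = 0 :=
  withDensity_absolutelyContinuous _ _ (((finite_singleton y).insert x).measure_zero _)

lemma stableLevyMeasure_Ioi (hα : 0 < α) (hp : 0 ≤ cp) {x : ℝ} (hx : 0 < x) :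
    stableLevyMeasure α cp cn (Ioi x) = ENNReal.ofReal (cp * x ^ (-α) / α) := by
  have hint : IntegrableOn (fun t : ℝ => cp * t ^ (-1 - α)) (Ioi x) :=
    (integrableOn_Ioi_rpow_of_lt (by linarith) hx).const_mul cp
  have hval : ∫ t in Ioi x, cp * t ^ (-1 - α) = cp * x ^ (-α) / α := by
    rw [integral_const_mul, integral_Ioi_rpow_of_lt (by linarith) hx]
    have : -1 - α + 1 = -α := by ring
    rw [this]
    field_simp
  rw [stableLevyMeasure_eq, withDensity_apply _ measurableSet_Ioi, ← hval,
    ofReal_integral_eq_lintegral_ofReal hint]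
  · refine setLIntegral_congr_fun measurableSet_Ioi fun t ht => ?_
    rw [stableDensity_of_pos (hx.trans ht)]
  · filter_upwards [ae_restrict_mem measurableSet_Ioi] with t ht
    have : 0 < t := hx.trans ht
    simp only [Pi.zero_apply]
    positivity

lemma tailPos_stable (hα : 0 < α) (hp : 0 ≤ cp) {x : ℝ} (hx : 0 < x) :
    tailPos (stableLevyMeasure α cp cn) x = cp * x ^ (-α) / α := by
  rw [tailPos, stableLevyMeasure_Ioi hα hp hx, ENNReal.toReal_ofReal (by positivity)]

lemma tailNeg_stable (hα : 0 < α) (hn : 0 ≤ cn) {x : ℝ} (hx : 0 < x) :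
    tailNeg (stableLevyMeasure α cp cn) x = cn * x ^ (-α) / α := by
  have : Iio (-x) = Neg.neg ⁻¹' Ioi x := by ext y; simp
  rw [tailNeg, this, stableLevyMeasure_preimage_neg measurableSet_Ioi,
    stableLevyMeasure_Ioi hα hn hx, ENNReal.toReal_ofReal (by positivity)]

lemma tail_stable (hα : 0 < α) (hp : 0 ≤ cp) (hn : 0 ≤ cn) {x : ℝ} (hx : 0 < x) :
    tail (stableLevyMeasure α cp cn) x = (cp + cn) * x ^ (-α) / α := by
  rw [tail, tailPos_stable hα hp hx, tailNeg_stable hα hn hx]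
  ring

lemma stable_lintegral_Ioi_lt_top (hα : 0 < α) (hα2 : α < 2) (hp : 0 ≤ cp) :
    ∫⁻ x in Ioi 0, ENNReal.ofReal (min (x ^ 2) 1) ∂(stableLevyMeasure α cp cn) < ∞ := by
  have hu : Ioi (0 : ℝ) = Ioc 0 1 ∪ Ioi 1 := (Ioc_union_Ioi_eq_Ioi zero_le_one).symm
  rw [hu]
  refine (lintegral_union_le _ _ _).trans_lt (ENNReal.add_lt_top.2 ⟨?_, ?_⟩)
  · rw [stableLevyMeasure_eq, restrict_withDensity measurableSet_Ioc,
      lintegral_withDensity_eq_lintegral_mul _ measurable_stableDensity.ennreal_ofReal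
        (by fun_prop)]
    have hint : IntegrableOn (fun t : ℝ => cp * t ^ (1 - α)) (Ioc 0 1) := by
      have h1 := intervalIntegral.intervalIntegrable_rpow' (a := 0) (b := 1)
        (show -1 < 1 - α by linarith)
      exact ((intervalIntegrable_iff_integrableOn_Ioc_of_le zero_le_one).1 h1).const_mul cp
    refine lt_of_le_of_lt (setLIntegral_mono' measurableSet_Ioc fun t ht => ?_)
      hint.lintegral_lt_top
    have ht0 : 0 < t := ht.1
    simp only [Pi.mul_apply]
    rw [← ENNReal.ofReal_mul (by rw [stableDensity_of_pos ht0]; positivity)]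
    refine ENNReal.ofReal_le_ofReal ?_
    rw [stableDensity_of_pos ht0]
    have h2 : t ^ (-1 - α) * t ^ 2 = t ^ (1 - α) := by
      rw [← Real.rpow_two, ← Real.rpow_add ht0]; ring_nf
    calc cp * t ^ (-1 - α) * min (t ^ 2) 1 ≤ cp * t ^ (-1 - α) * t ^ 2 := by
          gcongr; exact min_le_left _ _
      _ = cp * t ^ (1 - α) := by rw [mul_assoc, h2]
  · calc _ ≤ ∫⁻ x in Ioi (1 : ℝ), 1 ∂(stableLevyMeasure α cp cn) := by
          refine lintegral_mono fun t => ?_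
          rw [← ENNReal.ofReal_one]
          exact ENNReal.ofReal_le_ofReal (min_le_right _ _)
      _ = ENNReal.ofReal (cp * 1 ^ (-α) / α) := by
          rw [setLIntegral_one, stableLevyMeasure_Ioi hα hp one_pos]
      _ < ∞ := ENNReal.ofReal_lt_top

lemma isLevyMeasure_stable (hα : 0 < α) (hα2 : α < 2) (hp : 0 ≤ cp) (hn : 0 ≤ cn) :
    IsLevyMeasure (stableLevyMeasure α cp cn) := by
  refine ⟨stableLevyMeasure_singleton 0, ?_⟩
  rw [← lintegral_add_compl _ (measurableSet_Ioi (a := (0 : ℝ)))]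
  refine ENNReal.add_lt_top.2 ⟨stable_lintegral_Ioi_lt_top hα hα2 hp, ?_⟩
  have h1 : ∫⁻ x in (Ioi (0 : ℝ))ᶜ, ENNReal.ofReal (min (x ^ 2) 1) ∂(stableLevyMeasure α cp cn) =
      ∫⁻ x in Iio (0 : ℝ), ENNReal.ofReal (min (x ^ 2) 1) ∂(stableLevyMeasure α cp cn) := by
    rw [compl_Ioi]
    refine setLIntegral_congr ?_
    have h0 : ∀ᵐ x ∂(stableLevyMeasure α cp cn), x ∉ ({0} : Set ℝ) :=
      measure_eq_zero_iff_ae_notMem.1 (stableLevyMeasure_singleton 0)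
    filter_upwards [h0] with x hx
    exact propext ⟨fun h => lt_of_le_of_ne h hx, fun h => le_of_lt h⟩
  have h2 : Iio (0 : ℝ) = Neg.neg ⁻¹' Ioi 0 := by ext y; simp
  rw [h1, h2]
  have h3 := setLIntegral_map (μ := stableLevyMeasure α cp cn) (measurableSet_Ioi (a := (0 : ℝ)))
    (f := fun x : ℝ => ENNReal.ofReal (min (x ^ 2) 1)) (by fun_prop) measurable_neg
  rw [stableLevyMeasure_map_neg] at h3
  have h4 := stable_lintegral_Ioi_lt_top (cn := cp) hα hα2 hn
  rw [h3] at h4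
  simpa only [neg_sq] using h4

/-- Self-similarity of the stable Lévy measure. -/
lemma zoom_stable {z : ℝ} (hz : 0 < z) :
    zoom (z ^ α) z (stableLevyMeasure α cp cn) = stableLevyMeasure α cp cn := by
  ext s hs
  have hs' : MeasurableSet {x : ℝ | x / z ∈ s} := (measurable_id.div_const z) hs
  rw [zoom_apply hz.ne', stableLevyMeasure_eq, withDensity_apply _ hs', withDensity_apply _ hs]
  have h1 : ∫⁻ x in {x : ℝ | x / z ∈ s}, ENNReal.ofReal (stableDensity α cp cn x) =
      ENNReal.ofReal z * ∫⁻ x in s, ENNReal.ofReal (stableDensity α cp cn (z * x)) := by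
    conv_lhs => rw [← Real.smul_map_volume_mul_left hz.ne', Measure.restrict_smul,
      lintegral_smul_measure, setLIntegral_map hs' measurable_stableDensity.ennreal_ofReal
        (measurable_const_mul z), abs_of_pos hz]
    have h2 : (fun x => z * x) ⁻¹' {x : ℝ | x / z ∈ s} = s := by
      ext x
      simp [mul_div_cancel_left₀ _ hz.ne']
    rw [h2, smul_eq_mul]
  simp only [stableDensity_mul hz, ENNReal.ofReal_mul (Real.rpow_nonneg hz.le _)] at h1
  rw [lintegral_const_mul _ measurable_stableDensity.ennreal_ofReal] at h1
  rw [h1, ← mul_assoc, ← mul_assoc, ← ENNReal.ofReal_mul (by positivity),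
    ← ENNReal.ofReal_mul (by positivity)]
  have h3 : z ^ α * z * z ^ (-1 - α) = 1 := by
    nth_rewrite 2 [← Real.rpow_one z]
    rw [← Real.rpow_add hz, ← Real.rpow_add hz]
    have : α + 1 + (-1 - α) = 0 := by ring
    rw [this, Real.rpow_zero]
  rw [h3, ENNReal.ofReal_one, one_mul]

lemma integral_shell_stable (hp : 0 ≤ cp) (hn : 0 ≤ cn) {z : ℝ} (hz : 0 < z) (hz1 : z ≤ 1) :
    ∫ y in {y : ℝ | z ≤ |y| ∧ |y| < 1}, y ∂(stableLevyMeasure α cp cn) =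
      (cp - cn) * ∫ y in z..1, y ^ (-α) := by
  set d := stableDensity α cp cn with hd
  have hpos : ∀ y > 0, d y * y = cp * y ^ (-α) := fun y hy => by
    rw [hd, stableDensity_of_pos hy, mul_assoc]
    congr 1
    nth_rewrite 2 [← Real.rpow_one y]
    rw [← Real.rpow_add hy]; ring_nf
  have hneg : ∀ y > 0, d (-y) * (-y) = -(cn * y ^ (-α)) := fun y hy => by
    rw [hd, stableDensity_neg, stableDensity_of_pos hy, mul_assoc, mul_neg, mul_neg]
    congr 2
    nth_rewrite 2 [← Real.rpow_one y]
    rw [← Real.rpow_add hy]; ring_nf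
  have hI : IntervalIntegrable (fun y : ℝ => y ^ (-α)) volume z 1 := by
    refine intervalIntegral.intervalIntegrable_rpow (Or.inr ?_)
    rw [uIcc_of_le hz1]
    exact fun h => absurd h.1 (not_le.2 hz)
  have hsh : {y : ℝ | z ≤ |y| ∧ |y| < 1} = Ico z 1 ∪ Ioc (-1) (-z) := by
    ext y
    simp only [mem_ofPred_eq, mem_union, mem_Ico, mem_Ioc, le_abs, abs_lt]
    constructor
    · rintro ⟨h | h, h1, h2⟩
      · exact Or.inl ⟨h, h2⟩
      · exact Or.inr ⟨h1, by linarith⟩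
    · rintro (⟨h, h1⟩ | ⟨h, h1⟩)
      · exact ⟨Or.inl h, by linarith, h1⟩
      · exact ⟨Or.inr (by linarith), h, by linarith⟩
  have hdisj : Disjoint (Ico z 1) (Ioc (-1) (-z)) := by
    rw [Set.disjoint_left]
    intro y h1 h2
    linarith [h1.1, h2.2]
  have hIoc : IntegrableOn (fun y => cp * y ^ (-α)) (Ioc z 1) :=
    ((intervalIntegrable_iff_integrableOn_Ioc_of_le hz1).1 hI).const_mul cp
  have h1 : ∫ y in Ico z 1, d y * y = cp * ∫ y in z..1, y ^ (-α) := by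
    rw [integral_Ico_eq_integral_Ioc, ← intervalIntegral.integral_of_le hz1,
      ← intervalIntegral.integral_const_mul]
    refine intervalIntegral.integral_congr fun y hy => ?_
    rw [uIcc_of_le hz1] at hy
    exact hpos y (hz.trans_le hy.1)
  have h2 : ∫ y in Ioc (-1) (-z), d y * y = -(cn * ∫ y in z..1, y ^ (-α)) := by
    rw [← intervalIntegral.integral_of_le (by linarith), ← intervalIntegral.integral_const_mul,
      ← intervalIntegral.integral_neg, ← intervalIntegral.integral_comp_neg]
    refine intervalIntegral.integral_congr fun y hy => ?_
    rw [uIcc_of_le hz1] at hy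
    exact hneg y (hz.trans_le hy.1)
  have hi1 : IntegrableOn (fun y => d y * y) (Ico z 1) := by
    rw [integrableOn_Ico_iff_integrableOn_Ioo, ← integrableOn_Ioc_iff_integrableOn_Ioo]
    exact hIoc.congr_fun (fun y hy => (hpos y (hz.trans hy.1)).symm) measurableSet_Ioc
  have hi2 : IntegrableOn (fun y => d y * y) (Ioc (-1) (-z)) := by
    have h3 : IntervalIntegrable (fun y => d (-y) * (-y)) volume z 1 := by
      refine (hI.const_mul cn).neg.congr fun y hy => ?_
      rw [uIoc_of_le hz1] at hy
      exact (hneg y (hz.trans hy.1)).symm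
    have h4 : IntervalIntegrable (fun y => d y * y) volume (-z) (-1) := by
      rw [IntervalIntegrable.iff_comp_neg]
      simpa only [neg_neg] using h3
    rw [← intervalIntegrable_iff_integrableOn_Ioc_of_le (by linarith)]
    exact h4.symm
  have hwd : ∫ y in {y : ℝ | z ≤ |y| ∧ |y| < 1}, y ∂(stableLevyMeasure α cp cn) =
      ∫ y in {y : ℝ | z ≤ |y| ∧ |y| < 1}, d y * y := by
    rw [stableLevyMeasure_eq, restrict_withDensity (measurableSet_shell z 1),
      integral_withDensity_eq_integral_toReal_smul measurable_stableDensity.ennreal_ofReal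
        (.of_forall fun _ => ENNReal.ofReal_lt_top)]
    refine integral_congr_ae (.of_forall fun y => ?_)
    simp only [smul_eq_mul, ENNReal.toReal_ofReal (stableDensity_nonneg hp hn y), hd]
  rw [hwd, hsh, setIntegral_union hdisj measurableSet_Ioc hi1 hi2, h1, h2]
  ring

/-- The truncated mean is self-similar; this is where strict stability enters. -/
lemma truncMean_stable (h : IsStrictlyStableParam α cp cn γhat) {z : ℝ} (hz : 0 < z)
    (hz1 : z ≤ 1) :
    truncMean γhat (stableLevyMeasure α cp cn) z = z ^ (1 - α) * γhat := by
  rw [truncMean, integral_shell_stable h.cpos_nonneg h.cneg_nonneg hz hz1]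
  rcases eq_or_ne α 1 with h1 | h1
  · rw [h.symmetric h1, h1]
    simp
  · rw [integral_rpow, h.gamma_eq h1, Real.one_rpow]
    · have h2 : -α + 1 = 1 - α := by ring
      have h3 : 1 - α ≠ 0 := sub_ne_zero.2 h1.symm
      rw [h2]
      field_simp
      ring
    · refine Or.inr ⟨fun h => h1 (by linarith), ?_⟩
      rw [uIcc_of_le hz1]
      exact fun h => absurd h.1 (not_le.2 hz)

lemma charExp_stable_rescale (h : IsStrictlyStableParam α cp cn γhat) {z : ℝ} (hz : 0 < z)
    (hz1 : z ≤ 1) (u : ℝ) : charExp γhat 0 (stableLevyMeasure α cp cn) u =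
      ((z ^ α : ℝ) : ℂ) * charExp γhat 0 (stableLevyMeasure α cp cn) (u / z) := by
  have h1 := charExp_zoom (e := z ^ α) (γ := γhat) (σ := 0)
    (isLevyMeasure_stable h.alpha_pos h.alpha_lt_two h.cpos_nonneg h.cneg_nonneg)
    (by positivity) hz hz1 u
  have h2 : z ^ α * (z ^ (1 - α) * γhat) / z = γhat := by
    rw [← mul_assoc, ← Real.rpow_add hz, add_sub_cancel, Real.rpow_one,
      mul_div_cancel_left₀ _ hz.ne']
  rw [zoom_stable hz, truncMean_stable h hz hz1, h2, mul_zero, zero_div] at h1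
  exact h1

lemma isHomogeneousExponent_stable (h : IsStrictlyStableParam α cp cn γhat) :
    IsHomogeneousExponent α (charExp γhat 0 (stableLevyMeasure α cp cn)) where
  alpha_pos := h.alpha_pos
  continuous := continuous_charExp
    (isLevyMeasure_stable h.alpha_pos h.alpha_lt_two h.cpos_nonneg h.cneg_nonneg)
  map_mul w u hw := by
    rcases le_total w 1 with h1 | h1
    · rw [charExp_stable_rescale h hw h1, mul_div_cancel_left₀ _ hw.ne']
    · rw [charExp_stable_rescale h (inv_pos.2 hw) (inv_le_one_of_one_le₀ h1) u, ← mul_assoc,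
        ← Complex.ofReal_mul, ← Real.mul_rpow hw.le (inv_nonneg.2 hw.le),
        mul_inv_cancel₀ hw.ne', Real.one_rpow, Complex.ofReal_one, one_mul, div_inv_eq_mul,
        mul_comm]
  map_one_ne_zero h0 := by
    -- otherwise `cos = 1` almost everywhere, although `{1 < |x| ≤ 2}` is charged
    set S := stableLevyMeasure α cp cn with hS
    have hL : IsLevyMeasure S :=
      isLevyMeasure_stable h.alpha_pos h.alpha_lt_two h.cpos_nonneg h.cneg_nonneg
    have h1 := congrArg Complex.re h0
    rw [charExp_re hL, Complex.zero_re] at h1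
    have h2 : ∫ x, (1 - Real.cos (1 * x)) ∂S = 0 := by linarith
    rw [integral_eq_zero_iff_of_nonneg (fun x => sub_nonneg.2 (Real.cos_le_one _))
      (integrable_one_sub_cos hL 1)] at h2
    have h3 : S {x | 1 < |x|} = S {x | 2 < |x|} := by
      refine measure_congr ?_
      filter_upwards [h2] with x hx
      simp only [one_mul, Pi.zero_apply, sub_eq_zero] at hx
      refine propext ⟨fun hx1 => ?_, fun hx2 => one_lt_two.trans hx2⟩
      have hx1 : 1 < |x| := hx1
      show 2 < |x|
      by_contra! hcon
      have hx' := abs_le.1 hcon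
      have hpi := Real.pi_gt_three
      have := (Real.cos_eq_one_iff_of_lt_of_lt (by linarith) (by linarith)).1 hx.symm
      rw [this, abs_zero] at hx1
      linarith
    have h4 : tail S 1 = tail S 2 := by rw [hL.tail_eq one_pos, hL.tail_eq two_pos, h3]
    rw [hS, tail_stable h.alpha_pos h.cpos_nonneg h.cneg_nonneg one_pos,
      tail_stable h.alpha_pos h.cpos_nonneg h.cneg_nonneg two_pos, Real.one_rpow] at h4
    have h5 : (2 : ℝ) ^ (-α) < 1 := Real.rpow_lt_one_of_one_lt_of_neg one_lt_two
      (neg_neg_of_pos h.alpha_pos)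
    have h6 := h.sum_pos
    have h7 := h.alpha_pos
    field_simp at h4
    linarith

end

section

/-! ### Convergence of the tails implies convergence of integrals -/

lemma measureReal_Ioc_eq {ρ : Measure ℝ} [IsFiniteMeasure ρ] {a b : ℝ} (hab : a ≤ b) :
    ρ.real (Ioc a b) = ρ.real (Ioi a) - ρ.real (Ioi b) := by
  have h : Ioi a = Ioc a b ∪ Ioi b := (Ioc_union_Ioi_eq_Ioi hab).symm
  rw [h, measureReal_union (show Disjoint (Ioc a b) (Ioi b) from
    Set.disjoint_left.2 fun x hx hx' => absurd hx.2 (not_le.2 hx')) measurableSet_Ioi]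
  ring

/-- Convergence of the right tails of finite measures on `(δ, ∞)` implies their weak
convergence. -/
lemma tendsto_setIntegral_Ioi {ι : Type*} {l : Filter ι} [l.IsCountablyGenerated]
    {ρ : ι → Measure ℝ} {ρ₀ : Measure ℝ} {δ : ℝ} (hfin : ∀ᶠ i in l, ρ i (Ioi δ) < ∞)
    (hfin₀ : ρ₀ (Ioi δ) < ∞)
    (hT : ∀ x ≥ δ, Tendsto (fun i => (ρ i).real (Ioi x)) l (𝓝 (ρ₀.real (Ioi x))))
    {g : ℝ → ℝ} (hg : Measurable g) {C : ℝ} (hC : ∀ x, |g x| ≤ C)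
    (hc : ∀ᵐ x ∂ρ₀, ContinuousAt g x) :
    Tendsto (fun i => ∫ x in Ioi δ, g x ∂(ρ i)) l (𝓝 (∫ x in Ioi δ, g x ∂ρ₀)) := by
  classical
  have hI : ∀ m : Measure ℝ, m (Ioi δ) < ∞ → IsFiniteMeasure (m.restrict (Ioi δ)) := fun m hm =>
    ⟨by rwa [Measure.restrict_apply_univ]⟩
  have hf₀ := hI ρ₀ hfin₀
  let m : ι → FiniteMeasure ℝ := fun i =>
    if h : ρ i (Ioi δ) < ∞ then ⟨(ρ i).restrict (Ioi δ), hI _ h⟩ else 0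
  let m₀ : FiniteMeasure ℝ := ⟨ρ₀.restrict (Ioi δ), hf₀⟩
  have hm : ∀ᶠ i in l, (m i : Measure ℝ) = (ρ i).restrict (Ioi δ) := by
    filter_upwards [hfin] with i hi
    exact congrArg (fun q : FiniteMeasure ℝ => (q : Measure ℝ)) (dif_pos hi)
  have hres : ∀ (r : Measure ℝ) (x : ℝ), (r.restrict (Ioi δ)).real (Ioi x) =
      r.real (Ioi (max x δ)) := fun r x => by
    rw [measureReal_restrict_apply measurableSet_Ioi, Ioi_inter_Ioi]
  have hIoi : ∀ x, Tendsto (fun i => (m i : Measure ℝ).real (Ioi x)) l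
      (𝓝 ((m₀ : Measure ℝ).real (Ioi x))) := fun x => by
    show Tendsto _ _ (𝓝 ((ρ₀.restrict (Ioi δ)).real (Ioi x)))
    rw [hres]
    refine (hT _ (le_max_right x δ)).congr' ?_
    filter_upwards [hm] with i hi
    rw [hi, hres]
  have hmassreal : Tendsto (fun i => ((m i).mass : ℝ)) l (𝓝 (m₀.mass : ℝ)) := by
    have huniv : ∀ r : Measure ℝ, (r.restrict (Ioi δ)).real univ = r.real (Ioi δ) := fun r => by
      rw [measureReal_restrict_apply MeasurableSet.univ, univ_inter]
    show Tendsto _ _ (𝓝 ((ρ₀.restrict (Ioi δ)).real univ))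
    rw [huniv]
    refine (hT δ le_rfl).congr' ?_
    filter_upwards [hm] with i hi
    rw [← huniv, ← hi]
    rfl
  have hmass : Tendsto (fun i => (m i).mass) l (𝓝 m₀.mass) := NNReal.tendsto_coe.1 hmassreal
  have key := tendsto_integral_of_normalize (μ := m) (μ₀ := m₀) hmass (fun hne => ?_) hg hC
    (ae_restrict_of_ae hc)
  · refine key.congr' ?_
    filter_upwards [hm] with i hi
    rw [hi]
  · have hne' : m₀.mass ≠ 0 := m₀.mass_nonzero_iff.2 hne
    refine (isPiSystem_Ioc (id : ℝ → ℝ) id).tendsto_probabilityMeasure_of_tendsto_of_mem ?_ ?_ ?_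
    · rintro s ⟨a, b, -, rfl⟩
      exact measurableSet_Ioc
    · intro u hu x hx
      obtain ⟨a, b, hab, hs⟩ := mem_nhds_iff_exists_Ioo_subset.1 (hu.mem_nhds hx)
      obtain ⟨c, hc1, hc2⟩ := exists_between hab.2
      exact ⟨Ioc a c, ⟨a, c, hab.1.trans hc1, rfl⟩, Ioc_mem_nhds hab.1 hc1,
        (fun y hy => hs ⟨hy.1, hy.2.trans_lt hc2⟩)⟩
    · rintro s ⟨a, b, hab, rfl⟩
      have h1 : Tendsto (fun i => m i (Ioc a b)) l (𝓝 (m₀ (Ioc a b))) := by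
        rw [← NNReal.tendsto_coe]
        have h2 := (hIoi a).sub (hIoi b)
        simp only [← measureReal_Ioc_eq (show a ≤ b from hab.le)] at h2
        exact h2
      have h3 := (hmass.inv₀ hne').mul h1
      rw [show m₀.normalize (Ioc (id a) (id b)) = m₀.mass⁻¹ * m₀ (Ioc a b) from
        m₀.normalize_eq_of_nonzero hne _]
      refine h3.congr' ?_
      filter_upwards [hmass.eventually_ne hne'] with i hi
      exact ((m i).normalize_eq_of_nonzero ((m i).mass_nonzero_iff.1 hi) _).symm

lemma setIntegral_Iio_eq (ρ : Measure ℝ) (g : ℝ → ℝ) (δ : ℝ) :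
    ∫ x in Iio (-δ), g x ∂ρ = ∫ x in Ioi δ, g (-x) ∂(ρ.map Neg.neg) := by
  have he : MeasurableEmbedding (Neg.neg : ℝ → ℝ) := (Homeomorph.neg ℝ).measurableEmbedding
  rw [he.setIntegral_map]
  simp only [neg_neg]
  congr 2
  ext x; simp

lemma tendsto_setIntegral_Iio {ι : Type*} {l : Filter ι} [l.IsCountablyGenerated]
    {ρ : ι → Measure ℝ} {ρ₀ : Measure ℝ} {δ : ℝ} (hfin : ∀ᶠ i in l, ρ i (Iio (-δ)) < ∞)
    (hfin₀ : ρ₀ (Iio (-δ)) < ∞)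
    (hT : ∀ x ≥ δ, Tendsto (fun i => (ρ i).real (Iio (-x))) l (𝓝 (ρ₀.real (Iio (-x)))))
    {g : ℝ → ℝ} (hg : Measurable g) {C : ℝ} (hC : ∀ x, |g x| ≤ C)
    (hc : ∀ᵐ x ∂ρ₀, ContinuousAt g x) :
    Tendsto (fun i => ∫ x in Iio (-δ), g x ∂(ρ i)) l (𝓝 (∫ x in Iio (-δ), g x ∂ρ₀)) := by
  have hmap : ∀ (r : Measure ℝ) (x : ℝ), r.map Neg.neg (Ioi x) = r (Iio (-x)) := fun r x => by
    rw [Measure.map_apply measurable_neg measurableSet_Ioi]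
    congr 1
    ext y; simp
  simp only [setIntegral_Iio_eq]
  refine tendsto_setIntegral_Ioi (hfin.mono fun i hi => by rwa [hmap]) (by rwa [hmap])
    (fun x hx => ?_) (hg.comp measurable_neg) (fun x => hC _) ?_
  · simp only [measureReal_def, hmap]
    exact hT x hx
  · have he : MeasurableEmbedding (Neg.neg : ℝ → ℝ) := (Homeomorph.neg ℝ).measurableEmbedding
    rw [he.ae_map_iff]
    filter_upwards [hc] with x hx
    refine ContinuousAt.comp (f := Neg.neg) ?_ continuous_neg.continuousAt
    rwa [neg_neg]

/-- The tails of `ν`, zoomed in with the time scale `e`, converge to those of `ν₀`. -/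
structure TailsTendTo (e : ℝ → ℝ) (ν ν₀ : Measure ℝ) : Prop where
  scale_pos : ∀ᶠ z in 𝓝[>] 0, 0 < e z
  tailPos_tendsto : ∀ x > 0, Tendsto (fun z => e z * tailPos ν (z * x)) (𝓝[>] 0)
    (𝓝 (tailPos ν₀ x))
  tailNeg_tendsto : ∀ x > 0, Tendsto (fun z => e z * tailNeg ν (z * x)) (𝓝[>] 0)
    (𝓝 (tailNeg ν₀ x))

variable {ν ν₀ ρ : Measure ℝ} {e : ℝ → ℝ} {α cp cn γhat : ℝ}

lemma tailsTendTo_stable_self : TailsTendTo (fun z => z ^ α) (stableLevyMeasure α cp cn)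
    (stableLevyMeasure α cp cn) := by
  refine ⟨?_, fun x hx => ?_, fun x hx => ?_⟩
  · filter_upwards [self_mem_nhdsWithin] with z hz
    exact Real.rpow_pos_of_pos hz _
  · refine tendsto_const_nhds.congr' ?_
    filter_upwards [self_mem_nhdsWithin] with z hz
    have hz : 0 < z := hz
    rw [← tailPos_zoom (by positivity) hz, zoom_stable hz]
  · refine tendsto_const_nhds.congr' ?_
    filter_upwards [self_mem_nhdsWithin] with z hz
    have hz : 0 < z := hz
    rw [← tailNeg_zoom (by positivity) hz, zoom_stable hz]

lemma TailsTendTo.tail_tendsto (h : TailsTendTo e ν ν₀) {x : ℝ} (hx : 0 < x) :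
    Tendsto (fun z => e z * tail ν (z * x)) (𝓝[>] 0) (𝓝 (tail ν₀ x)) := by
  simpa only [tail, mul_add] using (h.tailPos_tendsto x hx).add (h.tailNeg_tendsto x hx)

lemma TailsTendTo.tail_pos (h : TailsTendTo e ν ν₀) (h1 : 0 < tail ν₀ 1) :
    ∀ᶠ z in 𝓝[>] 0, 0 < tail ν z := by
  filter_upwards [h.scale_pos, (h.tail_tendsto one_pos).eventually (lt_mem_nhds h1)] with z h2 h3
  rw [mul_one] at h3
  exact pos_of_mul_pos_right h3 h2.le

lemma TailsTendTo.tail_ratio (h : TailsTendTo e ν ν₀) (h1 : 0 < tail ν₀ 1) {x : ℝ} (hx : 0 < x) :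
    Tendsto (fun z => tail ν (z * x) / tail ν z) (𝓝[>] 0) (𝓝 (tail ν₀ x / tail ν₀ 1)) := by
  have h2 := (h.tail_tendsto hx).div (h.tail_tendsto one_pos) h1.ne'
  refine h2.congr' ?_
  filter_upwards [h.scale_pos] with z hz
  simp only [Pi.div_apply, mul_one]
  rw [mul_div_mul_left _ _ hz.ne']

/-- The truncated moment of order `p > α` of a measure with regularly varying tail is of the order
given by Karamata's theorem. -/
lemma IsLevyMeasure.exists_lintegral_pow_le (hν : IsLevyMeasure ν)
    (hpos : ∀ᶠ z in 𝓝[>] 0, 0 < tail ν z)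
    (hR : Tendsto (fun z => tail ν (z * (1 / 2)) / tail ν z) (𝓝[>] 0) (𝓝 (2 ^ α))) {p : ℕ}
    (hp : α < p) : ∃ C ≥ 0, ∀ᶠ z in 𝓝[>] 0,
      ∫⁻ y in {y : ℝ | |y| < z}, ENNReal.ofReal (|y| ^ p) ∂ν ≤
        ENNReal.ofReal (C * (z ^ p * tail ν (z * (1 / 4)))) := by
  have h1 : (2 : ℝ) ^ α / 2 ^ p < 1 := by
    rw [div_lt_one (by positivity), ← Real.rpow_natCast]
    exact Real.rpow_lt_rpow_of_exponent_lt one_lt_two hp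
  obtain ⟨q, hq, hq1⟩ := exists_between h1
  have hq0 : 0 ≤ q := le_trans (by positivity) hq.le
  have hev : ∀ᶠ z in 𝓝[>] 0, tail ν (z * (1 / 2)) ≤ q * 2 ^ p * tail ν z := by
    rw [div_lt_iff₀ (by positivity)] at hq
    filter_upwards [hR.eventually (gt_mem_nhds hq), hpos] with z h2 h3
    rw [div_lt_iff₀ h3] at h2
    exact h2.le
  obtain ⟨d, hd0, hd⟩ := mem_nhdsGT_iff_exists_Ioo_subset.1 hev
  refine ⟨1 / (1 - q), by rw [ge_iff_le, one_div_nonneg]; linarith, ?_⟩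
  filter_upwards [Ioo_mem_nhdsGT hd0] with z hz
  rw [one_div, ← div_eq_inv_mul]
  refine hν.lintegral_pow_le (d := d) (G := fun z => z ^ p * tail ν (z * (1 / 4))) hq0 hq1
    (fun w hw => ?_) (fun w hw => ?_) hz
  · have hw0 : 0 < w := hw.1
    have := hν.closedTail_le_tail (x := w * (1 / 4)) (z := w / 2) (by positivity) (by linarith)
    gcongr
  · have hw0 : 0 < w := hw.1
    have h2 : tail ν (w * (1 / 4) * (1 / 2)) ≤ q * 2 ^ p * tail ν (w * (1 / 4)) :=
      hd (show w * (1 / 4) ∈ Ioo 0 d from ⟨by positivity, by linarith [hw.2]⟩)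
    have h3 : w / 2 * (1 / 4) = w * (1 / 4) * (1 / 2) := by ring
    rw [h3]
    calc (w / 2) ^ p * tail ν (w * (1 / 4) * (1 / 2)) ≤
          (w / 2) ^ p * (q * 2 ^ p * tail ν (w * (1 / 4))) := by gcongr
      _ = q * (w ^ p * tail ν (w * (1 / 4))) := by
          rw [div_pow]; field_simp

/-- Splitting off the small jumps. -/
lemma IsLevyMeasure.abs_integral_sub_le (hρ : IsLevyMeasure ρ) {h : ℝ → ℝ} (hm : Measurable h)
    {B δ k : ℝ} {p : ℕ} (hB : ∀ x, |h x| ≤ B) (hp : ∀ x, |x| ≤ 1 → |h x| ≤ B * |x| ^ p)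
    (hδ : 0 < δ) (hδ1 : δ ≤ 1) (hk : 0 ≤ k)
    (hs : ∫⁻ y in {y : ℝ | |y| < 2 * δ}, ENNReal.ofReal (|y| ^ p) ∂ρ ≤ ENNReal.ofReal k) :
    |∫ x, h x ∂ρ - (∫ x in Ioi δ, h x ∂ρ + ∫ x in Iio (-δ), h x ∂ρ)| ≤ B * k := by
  have hB0 : 0 ≤ B := (abs_nonneg _).trans (hB 0)
  have hms : MeasurableSet {y : ℝ | |y| ≤ δ} := measurableSet_le (by fun_prop) measurable_const
  have hle : ∫⁻ y in {y : ℝ | |y| ≤ δ}, ENNReal.ofReal (|y| ^ p) ∂ρ ≤ ENNReal.ofReal k := by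
    refine (lintegral_mono_set fun y hy => ?_).trans hs
    have hy : |y| ≤ δ := hy
    show |y| < 2 * δ
    linarith
  have hpow : IntegrableOn (fun y : ℝ => |y| ^ p) {y : ℝ | |y| ≤ δ} ρ := by
    refine ⟨by fun_prop, ?_⟩
    rw [hasFiniteIntegral_iff_ofReal (.of_forall fun y => by positivity)]
    exact hle.trans_lt ENNReal.ofReal_lt_top
  have hbd : ∀ᵐ y ∂(ρ.restrict {y : ℝ | |y| ≤ δ}), ‖h y‖ ≤ B * |y| ^ p := by
    filter_upwards [ae_restrict_mem hms] with y hy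
    exact hp y (le_trans hy hδ1)
  have hint0 : IntegrableOn h {y : ℝ | |y| ≤ δ} ρ :=
    (hpow.const_mul B).mono' hm.aestronglyMeasurable hbd
  have hfin : ∀ s ⊆ {x : ℝ | δ ≤ |x|}, IntegrableOn h s ρ := fun s hs => by
    have : IsFiniteMeasure (ρ.restrict s) :=
      ⟨by rw [Measure.restrict_apply_univ]; exact hρ.measure_lt_top_of_subset hδ hs⟩
    exact Integrable.of_bound hm.aestronglyMeasurable B (.of_forall hB)
  have hint1 : IntegrableOn h (Ioi δ) ρ := hfin _ fun y hy => (le_of_lt hy).trans (le_abs_self y)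
  have hint2 : IntegrableOn h (Iio (-δ)) ρ :=
    hfin _ fun y hy => (le_neg.1 (le_of_lt hy)).trans (neg_le_abs y)
  have hcompl : {y : ℝ | |y| ≤ δ}ᶜ = Ioi δ ∪ Iio (-δ) := by
    ext y
    simp only [mem_compl_iff, mem_ofPred_eq, not_le, lt_abs, mem_union, mem_Ioi, mem_Iio, lt_neg]
  have hdisj : Disjoint (Ioi δ) (Iio (-δ)) := Set.disjoint_left.2 fun y h1 h2 => by
    have h1 : δ < y := h1
    have h2 : y < -δ := h2
    linarith
  have hint : Integrable h ρ := by
    rw [← integrableOn_univ, ← union_compl_self {y : ℝ | |y| ≤ δ}, hcompl]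
    exact hint0.union (hint1.union hint2)
  have h1 := integral_add_compl hms hint
  rw [hcompl, setIntegral_union hdisj measurableSet_Iio hint1 hint2] at h1
  have h2 : ∫ x, h x ∂ρ - (∫ x in Ioi δ, h x ∂ρ + ∫ x in Iio (-δ), h x ∂ρ) =
      ∫ x in {y : ℝ | |y| ≤ δ}, h x ∂ρ := by linarith
  rw [h2]
  calc |∫ x in {y : ℝ | |y| ≤ δ}, h x ∂ρ| ≤ ∫ x in {y : ℝ | |y| ≤ δ}, B * |x| ^ p ∂ρ :=
        norm_integral_le_of_norm_le (hpow.const_mul B) hbd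
    _ = B * ∫ x in {y : ℝ | |y| ≤ δ}, |x| ^ p ∂ρ := integral_const_mul _ _
    _ ≤ B * k := by
        gcongr
        rw [integral_eq_lintegral_of_nonneg_ae (.of_forall fun y => by positivity) (by fun_prop)]
        exact ENNReal.toReal_le_of_le_ofReal hk hle

lemma lintegral_zoom_lt {z : ℝ} {a : ℝ} (hz : 0 < z) (ha : 0 ≤ a) (w : ℝ) (p : ℕ) :
    ∫⁻ y in {y : ℝ | |y| < w}, ENNReal.ofReal (|y| ^ p) ∂(zoom a z ν) =
      ENNReal.ofReal (a / z ^ p) * ∫⁻ y in {y : ℝ | |y| < z * w}, ENNReal.ofReal (|y| ^ p) ∂ν := by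
  have he := measurableEmbedding_div hz.ne'
  have h1 : (fun x : ℝ => x / z) ⁻¹' {y : ℝ | |y| < w} = {y : ℝ | |y| < z * w} := by
    ext x
    exact abs_div_lt_iff hz x w
  rw [zoom, Measure.restrict_smul, lintegral_smul_measure, he.restrict_map, he.lintegral_map, h1,
    smul_eq_mul, div_eq_mul_inv, ENNReal.ofReal_mul ha, mul_assoc]
  congr 1
  rw [← lintegral_const_mul _ (by fun_prop)]
  refine lintegral_congr fun x => ?_
  rw [abs_div, div_pow, abs_of_pos hz, ← ENNReal.ofReal_mul (by positivity), div_eq_inv_mul]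

/-- If the tails converge to those of a stable process, then so do the integrals of bounded
functions of order `O(|x|^p)` at zero, provided `p > α`. -/
theorem TailsTendTo.tendsto_integral (hT : TailsTendTo e ν (stableLevyMeasure α cp cn))
    (hν : IsLevyMeasure ν) (hs : IsStrictlyStableParam α cp cn γhat) {p : ℕ} (hpα : α < p)
    {h : ℝ → ℝ} (hm : Measurable h) {B : ℝ} (hB : ∀ x, |h x| ≤ B)
    (hp : ∀ x, |x| ≤ 1 → |h x| ≤ B * |x| ^ p)
    (hc : ∀ᵐ x ∂(stableLevyMeasure α cp cn), ContinuousAt h x) :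
    Tendsto (fun z => ∫ x, h x ∂(zoom (e z) z ν)) (𝓝[>] 0)
      (𝓝 (∫ x, h x ∂(stableLevyMeasure α cp cn))) := by
  set S := stableLevyMeasure α cp cn with hS
  have hα := hs.alpha_pos
  have hSL : IsLevyMeasure S :=
    isLevyMeasure_stable hα hs.alpha_lt_two hs.cpos_nonneg hs.cneg_nonneg
  have hB0 : 0 ≤ B := (abs_nonneg _).trans (hB 0)
  have hsum := hs.sum_pos
  have htail : ∀ x > 0, tail S x = (cp + cn) * x ^ (-α) / α := fun x hx =>
    tail_stable hα hs.cpos_nonneg hs.cneg_nonneg hx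
  have htpos : ∀ x > 0, 0 < tail S x := fun x hx => by rw [htail x hx]; positivity
  have hratio : tail S (1 / 2) / tail S 1 = 2 ^ α := by
    rw [htail _ (by norm_num), htail 1 one_pos, Real.one_rpow, one_div,
      Real.inv_rpow zero_le_two, Real.rpow_neg zero_le_two, inv_inv]
    field_simp
  have hself : TailsTendTo (fun z => z ^ α) S S := tailsTendTo_stable_self
  obtain ⟨C, hC0, hC⟩ := hν.exists_lintegral_pow_le (hT.tail_pos (htpos 1 one_pos))
    (by rw [← hratio]; exact hT.tail_ratio (htpos 1 one_pos) (by norm_num)) hpα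
  obtain ⟨D, hD0, hD⟩ := hSL.exists_lintegral_pow_le (hself.tail_pos (htpos 1 one_pos))
    (by rw [← hratio]; exact hself.tail_ratio (htpos 1 one_pos) (by norm_num)) hpα
  -- the small jumps are negligible uniformly in `z`
  have hsmall : ∀ K : ℝ, Tendsto (fun δ : ℝ => B * (K * ((2 * δ) ^ p * tail S (2 * δ * (1 / 4)))))
      (𝓝[>] 0) (𝓝 0) := fun K => by
    have h1 : Tendsto (fun δ : ℝ => B * (K * (2 ^ p * ((cp + cn) * (2⁻¹ : ℝ) ^ (-α) / α))) *
        δ ^ ((p : ℝ) - α)) (𝓝[>] 0) (𝓝 0) := by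
      have h2 : Tendsto (fun δ : ℝ => δ ^ ((p : ℝ) - α)) (𝓝 0) (𝓝 (0 ^ ((p : ℝ) - α))) :=
        (Real.continuousAt_rpow_const 0 _ (Or.inr (by linarith))).tendsto
      rw [Real.zero_rpow (by linarith)] at h2
      simpa using (h2.mono_left nhdsWithin_le_nhds).const_mul
        (B * (K * (2 ^ p * ((cp + cn) * (2⁻¹ : ℝ) ^ (-α) / α))))
    refine h1.congr' ?_
    filter_upwards [self_mem_nhdsWithin] with δ hδ
    have hδ : 0 < δ := hδ
    have h3 : 2 * δ * (1 / 4) = 2⁻¹ * δ := by ring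
    rw [htail _ (by positivity), h3, Real.mul_rpow (by norm_num) hδ.le, sub_eq_add_neg,
      Real.rpow_add hδ, Real.rpow_natCast, mul_pow]
    ring
  rw [Metric.tendsto_nhds]
  intro η hη
  have hη3 : 0 < η / 3 := by positivity
  obtain ⟨δ, ⟨hδ0, hδ1⟩, hδC, hδD, hδS⟩ := ((Ioc_mem_nhdsGT one_pos : Ioc (0 : ℝ) 1 ∈ 𝓝[>] 0) |>
    Filter.Eventually.and <| ((hsmall C).eventually (gt_mem_nhds hη3)).and
    (((hsmall D).eventually (gt_mem_nhds hη3)).and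
      ((tendsto_const_mul_nhdsGT_zero two_pos).eventually hD))).exists
  have hw : 0 < 2 * δ * (1 / 4) := by positivity
  have hbig := (tendsto_setIntegral_Ioi (l := 𝓝[>] 0) (ρ := fun z => zoom (e z) z ν) (ρ₀ := S)
    (δ := δ) (by
      filter_upwards [self_mem_nhdsWithin] with z hz
      exact (hν.zoom hz).Ioi_lt_top hδ0) (hSL.Ioi_lt_top hδ0) (fun x hx => by
      refine (hT.tailPos_tendsto x (hδ0.trans_le hx)).congr' ?_
      filter_upwards [self_mem_nhdsWithin, hT.scale_pos] with z hz hez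
      exact (tailPos_zoom hez.le hz x).symm) hm hB hc).add
    (tendsto_setIntegral_Iio (l := 𝓝[>] 0) (ρ := fun z => zoom (e z) z ν) (ρ₀ := S)
    (δ := δ) (by
      filter_upwards [self_mem_nhdsWithin] with z hz
      exact (hν.zoom hz).Iio_lt_top hδ0) (hSL.Iio_lt_top hδ0) (fun x hx => by
      refine (hT.tailNeg_tendsto x (hδ0.trans_le hx)).congr' ?_
      filter_upwards [self_mem_nhdsWithin, hT.scale_pos] with z hz hez
      exact (tailNeg_zoom hez.le hz x).symm) hm hB hc)
  have hkz : Tendsto (fun z => B * (C * ((2 * δ) ^ p * (e z * tail ν (z * (2 * δ * (1 / 4)))))))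
      (𝓝[>] 0) (𝓝 (B * (C * ((2 * δ) ^ p * tail S (2 * δ * (1 / 4)))))) :=
    (((hT.tail_tendsto hw).const_mul _).const_mul _).const_mul _
  have hzδ : Tendsto (fun z : ℝ => z * (2 * δ)) (𝓝[>] 0) (𝓝[>] 0) := by
    simpa only [mul_comm] using tendsto_const_mul_nhdsGT_zero (show 0 < 2 * δ by positivity)
  have hS3 := hSL.abs_integral_sub_le hm hB hp hδ0 hδ1
    (mul_nonneg hD0 (mul_nonneg (by positivity) (tail_nonneg _))) hδS
  filter_upwards [(Metric.tendsto_nhds.1 hbig) (η / 3) hη3, hkz.eventually (gt_mem_nhds hδC),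
    hzδ.eventually hC, self_mem_nhdsWithin, hT.scale_pos] with z h1 h2 h3 hz hez
  have hz : 0 < z := hz
  have hk : 0 ≤ C * ((2 * δ) ^ p * (e z * tail ν (z * (2 * δ * (1 / 4))))) := by
    have := tail_nonneg (ν := ν) (z * (2 * δ * (1 / 4)))
    positivity
  have h4 := (hν.zoom (e := e z) hz).abs_integral_sub_le hm hB hp hδ0 hδ1 hk (by
    rw [lintegral_zoom_lt hz hez.le]
    refine (mul_le_mul_right h3 _).trans_eq ?_
    rw [← ENNReal.ofReal_mul (by positivity), mul_assoc z (2 * δ) (1 / 4), mul_pow]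
    congr 1
    field_simp)
  rw [Real.dist_eq] at h1 ⊢
  set I := ∫ x, h x ∂(zoom (e z) z ν)
  set I₀ := ∫ x, h x ∂S
  have h5 := abs_le.1 h4
  have h6 := abs_le.1 hS3
  have h7 := abs_lt.1 h1
  rw [abs_lt]
  constructor <;> linarith [h5.1, h5.2, h6.1, h6.2, h7.1, h7.2]

end

section

variable {γ σ γhat α cp cn : ℝ} {ν ν₀ : Measure ℝ} {e : ℝ → ℝ}

/-! ### Jumps of finite variation -/

/-- When `|y|` is integrable near zero, `m(z) = γ' + ∫_{|y| < z} y ν(dy)`. -/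
lemma truncMean_eq_bvDrift_add (hi : IntegrableOn (fun y : ℝ => y) {y | |y| < 1} ν) {z : ℝ}
    (hz1 : z ≤ 1) : truncMean γ ν z = bvDrift γ ν + ∫ y in {y : ℝ | |y| < z}, y ∂ν := by
  have hu : {y : ℝ | |y| < 1} = {y | |y| < z} ∪ {y | z ≤ |y| ∧ |y| < 1} := by
    ext y
    simp only [mem_union, mem_ofPred_eq]
    constructor
    · intro h
      rcases lt_or_ge |y| z with h1 | h1
      · exact Or.inl h1
      · exact Or.inr ⟨h1, h⟩
    · rintro (h | h)
      · exact h.trans_le hz1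
      · exact h.2
  have hd : Disjoint {y : ℝ | |y| < z} {y | z ≤ |y| ∧ |y| < 1} :=
    Set.disjoint_left.2 fun y h1 h2 => absurd h2.1 (not_le.2 h1)
  have h1 := setIntegral_union hd (measurableSet_shell z 1)
    (hi.mono_set (by rw [hu]; exact subset_union_left))
    (hi.mono_set (by rw [hu]; exact subset_union_right))
  rw [← hu] at h1
  rw [truncMean, bvDrift, h1]
  ring

lemma tendsto_truncMean_bvDrift (hi : IntegrableOn (fun y : ℝ => y) {y | |y| < 1} ν) :
    Tendsto (truncMean γ ν) (𝓝[>] 0) (𝓝 (bvDrift γ ν)) := by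
  have h1 : Tendsto (fun z : ℝ => ∫ y in {y : ℝ | |y| < 1}, {y : ℝ | |y| < z}.indicator id y ∂ν)
      (𝓝[>] 0) (𝓝 (∫ y in {y : ℝ | |y| < 1}, (0 : ℝ) ∂ν)) := by
    refine tendsto_integral_filter_of_dominated_convergence (fun y => |y|)
      (.of_forall fun z => (measurable_id.indicator (measurableSet_abs_lt z)).aestronglyMeasurable)
      (.of_forall fun z => .of_forall fun y => ?_) hi.norm (.of_forall fun y => ?_)
    · exact norm_indicator_le_norm_self _ _
    · rcases eq_or_ne y 0 with rfl | hy
      · refine tendsto_const_nhds.congr fun z => ?_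
        by_cases h : (0 : ℝ) ∈ {y : ℝ | |y| < z}
        · rw [indicator_of_mem h]; rfl
        · rw [indicator_of_notMem h]
      · refine tendsto_const_nhds.congr' ?_
        filter_upwards [Ioo_mem_nhdsGT (abs_pos.2 hy)] with z hz
        rw [indicator_of_notMem]
        exact not_lt.2 hz.2.le
  rw [integral_zero] at h1
  have h2 := h1.const_add (bvDrift γ ν)
  rw [add_zero] at h2
  refine h2.congr' ?_
  filter_upwards [Ioc_mem_nhdsGT one_pos] with z hz
  rw [truncMean_eq_bvDrift_add hi hz.2, setIntegral_indicator (measurableSet_abs_lt z)]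
  congr 3
  refine inter_eq_right.2 fun y hy => ?_
  exact lt_of_lt_of_le hy hz.2

lemma IsLevyMeasure.integrable_min_abs (hν : IsLevyMeasure ν)
    (hi : IntegrableOn (fun y : ℝ => y) {y | |y| < 1} ν) :
    Integrable (fun y : ℝ => min |y| 1) ν := by
  have hm := measurableSet_abs_lt 1
  rw [← integrableOn_univ, ← union_compl_self {y : ℝ | |y| < 1}]
  refine IntegrableOn.union ?_ ?_
  · refine hi.norm.mono' (by fun_prop) (.of_forall fun y => ?_)
    rw [Real.norm_of_nonneg (by positivity)]
    exact min_le_left _ _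
  · have : IsFiniteMeasure (ν.restrict {y : ℝ | |y| < 1}ᶜ) := by
      refine ⟨?_⟩
      rw [Measure.restrict_apply_univ]
      exact hν.measure_lt_top_of_subset one_pos fun y hy => not_lt.1 (show ¬|y| < 1 from hy)
    refine Integrable.of_bound (by fun_prop) 1 (.of_forall fun y => ?_)
    rw [Real.norm_of_nonneg (by positivity)]
    exact min_le_right _ _

lemma IsLevyMeasure.tendsto_mul_tail (hν : IsLevyMeasure ν)
    (hi : IntegrableOn (fun y : ℝ => y) {y | |y| < 1} ν) :
    Tendsto (fun z => z * tail ν z) (𝓝[>] 0) (𝓝 0) := by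
  have h1 : Tendsto (fun z : ℝ => ∫ y, {y : ℝ | z ≤ |y|}.indicator (fun _ => z) y ∂ν)
      (𝓝[>] 0) (𝓝 (∫ _, (0 : ℝ) ∂ν)) := by
    refine tendsto_integral_filter_of_dominated_convergence (fun y => min |y| 1)
      (.of_forall fun z => (measurable_const.indicator (measurableSet_le_abs z)).aestronglyMeasurable)
      ?_ (hν.integrable_min_abs hi) (.of_forall fun y => ?_)
    · filter_upwards [Ioc_mem_nhdsGT one_pos] with z hz
      refine .of_forall fun y => ?_
      by_cases hy : z ≤ |y|
      · rw [indicator_of_mem (by exact hy), Real.norm_of_nonneg hz.1.le]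
        exact le_min hy hz.2
      · rw [indicator_of_notMem (by exact hy), norm_zero]
        positivity
    · refine squeeze_zero_norm' (a := fun z => z) ?_ nhdsWithin_le_nhds
      filter_upwards [self_mem_nhdsWithin] with z hz
      refine (norm_indicator_le_norm_self _ _).trans_eq ?_
      exact Real.norm_of_nonneg (le_of_lt hz)
  rw [integral_zero] at h1
  refine squeeze_zero' ?_ ?_ h1
  · filter_upwards [self_mem_nhdsWithin] with z hz
    exact mul_nonneg (le_of_lt hz) (tail_nonneg z)
  · filter_upwards [self_mem_nhdsWithin] with z hz
    have hz : 0 < z := hz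
    rw [integral_indicator (measurableSet_le_abs z), setIntegral_const, smul_eq_mul, mul_comm]
    have := hν.tail_le_closedTail hz
    exact mul_le_mul_of_nonneg_right this hz.le

/-! ### Attraction to a stable process: the conditions on the tails -/

lemma IsStrictlyStableParam.tail_one (hs : IsStrictlyStableParam α cp cn γhat) :
    tail (stableLevyMeasure α cp cn) 1 = (cp + cn) / α := by
  rw [tail_stable hs.alpha_pos hs.cpos_nonneg hs.cneg_nonneg one_pos, Real.one_rpow, mul_one]

lemma IsStrictlyStableParam.tail_one_pos (hs : IsStrictlyStableParam α cp cn γhat) :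
    0 < tail (stableLevyMeasure α cp cn) 1 := by
  rw [hs.tail_one]
  exact div_pos hs.sum_pos hs.alpha_pos

/-- A monotone function with a power as zooming limit is regularly varying; monotonicity makes it
measurable, and the positivity near zero follows from that of the limit. -/
lemma regVaryingAtZero_of_antitone {T : ℝ → ℝ} (hT : ∀ x z, 0 < x → x ≤ z → T z ≤ T x)
    (he : ∀ᶠ z in 𝓝[>] 0, 0 < e z) {c ρ : ℝ} (hc : 0 < c)
    (hlim : ∀ x > 0, Tendsto (fun z => e z * T (z * x)) (𝓝[>] 0) (𝓝 (c * x ^ ρ))) :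
    RegVaryingAtZero ρ T := by
  have h1 := hlim 1 one_pos
  simp only [Real.one_rpow, mul_one] at h1
  have hpos : ∀ᶠ z in 𝓝[>] 0, 0 < T z := by
    filter_upwards [h1.eventually (lt_mem_nhds hc), he] with z h2 h3
    exact pos_of_mul_pos_right h2 h3.le
  obtain ⟨d, hd0, hd⟩ := mem_nhdsGT_iff_exists_Ioo_subset.1 hpos
  refine ⟨⟨d, hd0, fun x hx => hd hx, ?_⟩, fun x hx => ?_⟩
  · refine Antitone.measurable fun x y hxy => ?_
    exact hT _ _ x.2.1 hxy
  · have h2 := (hlim x hx).div h1 hc.ne'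
    rw [mul_div_cancel_left₀ _ hc.ne'] at h2
    refine h2.congr' ?_
    filter_upwards [he] with z hz
    simp only [Pi.div_apply]
    rw [mul_div_mul_left _ _ hz.ne', mul_comm]

lemma TailsTendTo.regVaryingAtZero_tailPos (hν : IsLevyMeasure ν)
    (hT : TailsTendTo e ν (stableLevyMeasure α cp cn)) (hs : IsStrictlyStableParam α cp cn γhat)
    (hc : 0 < cp) : RegVaryingAtZero (-α) (tailPos ν) := by
  refine regVaryingAtZero_of_antitone (fun x z hx hxz => hν.tailPos_anti hx hxz) hT.scale_pos
    (div_pos hc hs.alpha_pos) fun x hx => ?_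
  have := hT.tailPos_tendsto x hx
  rwa [tailPos_stable hs.alpha_pos hs.cpos_nonneg hx, mul_div_right_comm] at this

lemma TailsTendTo.regVaryingAtZero_tailNeg (hν : IsLevyMeasure ν)
    (hT : TailsTendTo e ν (stableLevyMeasure α cp cn)) (hs : IsStrictlyStableParam α cp cn γhat)
    (hc : 0 < cn) : RegVaryingAtZero (-α) (tailNeg ν) := by
  refine regVaryingAtZero_of_antitone (fun x z hx hxz => hν.tailNeg_anti hx hxz) hT.scale_pos
    (div_pos hc hs.alpha_pos) fun x hx => ?_
  have := hT.tailNeg_tendsto x hx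
  rwa [tailNeg_stable hs.alpha_pos hs.cneg_nonneg hx, mul_div_right_comm] at this

/-- The balance of the tails is stated in `[0, ∞]`, where the limit `∞` stands for an absent
negative side. -/
lemma TailsTendTo.balance (hν : IsLevyMeasure ν)
    (hT : TailsTendTo e ν (stableLevyMeasure α cp cn))
    (hs : IsStrictlyStableParam α cp cn γhat) :
    Tendsto (fun x => ν (Ioi x) / ν (Iio (-x))) (𝓝[>] 0)
      (𝓝 (ENNReal.ofReal cp / ENNReal.ofReal cn)) := by
  have hα := hs.alpha_pos
  have hsum := hs.sum_pos
  have hp := hT.tailPos_tendsto 1 one_pos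
  have hn := hT.tailNeg_tendsto 1 one_pos
  rw [tailPos_stable hα hs.cpos_nonneg one_pos, Real.one_rpow] at hp
  rw [tailNeg_stable hα hs.cneg_nonneg one_pos, Real.one_rpow] at hn
  simp only [mul_one] at hp hn
  have h1 := ENNReal.Tendsto.div (ENNReal.tendsto_ofReal hp) (b := ENNReal.ofReal (cn / α)) ?_
    (ENNReal.tendsto_ofReal hn) (Or.inl ENNReal.ofReal_ne_top)
  · have h2 : ENNReal.ofReal (cp / α) / ENNReal.ofReal (cn / α) =
        ENNReal.ofReal cp / ENNReal.ofReal cn := by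
      rw [ENNReal.ofReal_div_of_pos hα, ENNReal.ofReal_div_of_pos hα, div_eq_mul_inv,
        div_eq_mul_inv _ (ENNReal.ofReal α)]
      exact ENNReal.mul_div_mul_right _ _ (by simp) (by simpa using hα)
    rw [h2] at h1
    refine h1.congr' ?_
    filter_upwards [hT.scale_pos, self_mem_nhdsWithin] with z hz hz0
    rw [ENNReal.ofReal_mul hz.le, ENNReal.ofReal_mul hz.le,
      ENNReal.mul_div_mul_left _ _ (by simpa using hz) ENNReal.ofReal_ne_top, tailPos, tailNeg,
      ENNReal.ofReal_toReal (hν.Ioi_lt_top hz0).ne, ENNReal.ofReal_toReal (hν.Iio_lt_top hz0).ne]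
  · rcases hs.cpos_nonneg.lt_or_eq with h | h
    · left
      have : 0 < cp / α := div_pos h hα
      simpa using this
    · right
      have : 0 < cn / α := div_pos (by linarith) hα
      simpa using this

/-- Two functions whose quotient converges, one of them regularly varying. -/
lemma tendsto_div_add_of_regVarying {T₁ T₂ : ℝ → ℝ} {ρ q : ℝ} (h₁ : RegVaryingAtZero ρ T₁)
    (hq : Tendsto (fun z => T₂ z / T₁ z) (𝓝[>] 0) (𝓝 q)) (hq0 : 0 ≤ q) {x : ℝ} (hx : 0 < x) :
    Tendsto (fun z => T₁ (z * x) / (T₁ z + T₂ z)) (𝓝[>] 0) (𝓝 (x ^ ρ / (1 + q))) ∧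
      Tendsto (fun z => T₂ (z * x) / (T₁ z + T₂ z)) (𝓝[>] 0) (𝓝 (q * (x ^ ρ / (1 + q)))) := by
  have hzx : Tendsto (fun z : ℝ => z * x) (𝓝[>] 0) (𝓝[>] 0) := by
    simpa only [mul_comm] using tendsto_const_mul_nhdsGT_zero hx
  have hA : Tendsto (fun z => T₁ (z * x) / (T₁ z + T₂ z)) (𝓝[>] 0) (𝓝 (x ^ ρ / (1 + q))) := by
    refine ((h₁.2 x hx).div (hq.const_add 1) (by positivity)).congr' ?_
    filter_upwards [h₁.eventually_pos] with z hz
    simp only [Pi.div_apply]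
    rw [mul_comm x z, div_div, mul_add, mul_one, mul_div_cancel₀ _ hz.ne']
  refine ⟨hA, ((hq.comp hzx).mul hA).congr' ?_⟩
  filter_upwards [hzx.eventually h₁.eventually_pos] with z hz
  simp only [Function.comp_apply]
  rw [div_mul_div_cancel₀ hz.ne']

/-- Regular variation and balance of the tails amount to their convergence when the time is the
inverse of the two-sided tail. -/
lemma tailsTendTo_of_regVarying (hs : IsStrictlyStableParam α cp cn γhat)
    (hp : 0 < cp → RegVaryingAtZero (-α) (tailPos ν))
    (hn : 0 < cn → RegVaryingAtZero (-α) (tailNeg ν))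
    (hb : Tendsto (fun x => ν (Ioi x) / ν (Iio (-x))) (𝓝[>] 0)
      (𝓝 (ENNReal.ofReal cp / ENNReal.ofReal cn))) :
    TailsTendTo (fun z => (cp + cn) / α / tail ν z) ν (stableLevyMeasure α cp cn) := by
  have hα := hs.alpha_pos
  have hsum := hs.sum_pos
  have hp0 := hs.cpos_nonneg
  have hn0 := hs.cneg_nonneg
  rcases hp0.lt_or_eq with hc | hc
  · have hq : Tendsto (fun z => tailNeg ν z / tailPos ν z) (𝓝[>] 0) (𝓝 (cn / cp)) := by
      have h1 := tendsto_inv_iff.2 hb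
      rw [ENNReal.inv_div (Or.inr ENNReal.ofReal_ne_top) (Or.inr (by simpa using hc))] at h1
      have h2 := (ENNReal.tendsto_toReal (ENNReal.div_lt_top ENNReal.ofReal_ne_top
        (by simpa using hc)).ne).comp h1
      rw [ENNReal.toReal_div, ENNReal.toReal_ofReal hp0, ENNReal.toReal_ofReal hn0] at h2
      refine h2.congr fun z => ?_
      simp only [Function.comp_apply, ENNReal.toReal_inv, ENNReal.toReal_div, inv_div]
      rfl
    have key := fun x hx => tendsto_div_add_of_regVarying (hp hc) hq (by positivity) (x := x) hx
    refine ⟨?_, fun x hx => ?_, fun x hx => ?_⟩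
    · filter_upwards [(hp hc).eventually_pos] with z hz
      have : 0 < tail ν z := add_pos_of_pos_of_nonneg hz (tailNeg_nonneg z)
      positivity
    · rw [tailPos_stable hα hp0 hx]
      have h3 : cp * x ^ (-α) / α = (cp + cn) / α * (x ^ (-α) / (1 + cn / cp)) := by field_simp
      rw [h3]
      refine ((key x hx).1.const_mul _).congr fun z => ?_
      rw [tail]; ring
    · rw [tailNeg_stable hα hn0 hx]
      have h3 : cn * x ^ (-α) / α =
          (cp + cn) / α * (cn / cp * (x ^ (-α) / (1 + cn / cp))) := by field_simp
      rw [h3]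
      refine ((key x hx).2.const_mul _).congr fun z => ?_
      rw [tail]; ring
  · have hc' : 0 < cn := by linarith
    have hq : Tendsto (fun z => tailPos ν z / tailNeg ν z) (𝓝[>] 0) (𝓝 (cp / cn)) := by
      have h2 := (ENNReal.tendsto_toReal (ENNReal.div_lt_top ENNReal.ofReal_ne_top
        (by simpa using hc')).ne).comp hb
      rw [ENNReal.toReal_div, ENNReal.toReal_ofReal hp0, ENNReal.toReal_ofReal hn0] at h2
      refine h2.congr fun z => ?_
      simp only [Function.comp_apply, ENNReal.toReal_div]
      rfl
    have key := fun x hx => tendsto_div_add_of_regVarying (hn hc') hq (by positivity) (x := x) hx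
    refine ⟨?_, fun x hx => ?_, fun x hx => ?_⟩
    · filter_upwards [(hn hc').eventually_pos] with z hz
      have : 0 < tail ν z := add_pos_of_nonneg_of_pos (tailPos_nonneg z) hz
      positivity
    · rw [tailPos_stable hα hp0 hx]
      have h3 : cp * x ^ (-α) / α =
          (cp + cn) / α * (cp / cn * (x ^ (-α) / (1 + cp / cn))) := by field_simp; ring
      rw [h3]
      refine ((key x hx).2.const_mul _).congr fun z => ?_
      rw [tail]; ring
    · rw [tailNeg_stable hα hn0 hx]
      have h3 : cn * x ^ (-α) / α = (cp + cn) / α * (x ^ (-α) / (1 + cp / cn)) := by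
        field_simp; ring
      rw [h3]
      refine ((key x hx).1.const_mul _).congr fun z => ?_
      rw [tail]; ring

/-! ### Attraction to a stable process: the drift -/

lemma isLevyMeasure_of_param (hs : IsStrictlyStableParam α cp cn γhat) :
    IsLevyMeasure (stableLevyMeasure α cp cn) :=
  isLevyMeasure_stable hs.alpha_pos hs.alpha_lt_two hs.cpos_nonneg hs.cneg_nonneg

lemma TailsTendTo.tail_ratio_stable (hT : TailsTendTo e ν (stableLevyMeasure α cp cn))
    (hs : IsStrictlyStableParam α cp cn γhat) {x : ℝ} (hx : 0 < x) :
    Tendsto (fun z => tail ν (z * x) / tail ν z) (𝓝[>] 0) (𝓝 (x ^ (-α))) := by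
  have h1 := hT.tail_ratio hs.tail_one_pos hx
  have h2 := hs.sum_pos
  have h3 := hs.alpha_pos
  have : tail (stableLevyMeasure α cp cn) x / tail (stableLevyMeasure α cp cn) 1 = x ^ (-α) := by
    rw [hs.tail_one, tail_stable hs.alpha_pos hs.cpos_nonneg hs.cneg_nonneg hx]
    field_simp
  rwa [this] at h1

/-- Regularly varying tails of index `-α` with `α < 1` make `|y|` integrable near zero. -/
lemma TailsTendTo.integrableOn_of_lt_one (hν : IsLevyMeasure ν)
    (hT : TailsTendTo e ν (stableLevyMeasure α cp cn)) (hs : IsStrictlyStableParam α cp cn γhat)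
    (hα : α < 1) : IntegrableOn (fun y : ℝ => y) {y | |y| < 1} ν := by
  have hR : Tendsto (fun z => tail ν (z * (1 / 2)) / tail ν z) (𝓝[>] 0) (𝓝 (2 ^ α)) := by
    have h1 : (1 / 2 : ℝ) ^ (-α) = 2 ^ α := by
      rw [one_div, Real.inv_rpow zero_le_two, Real.rpow_neg zero_le_two, inv_inv]
    rw [← h1]
    exact hT.tail_ratio_stable hs (by norm_num)
  obtain ⟨C, hC0, hC⟩ := hν.exists_lintegral_pow_le (p := 1) (hT.tail_pos hs.tail_one_pos) hR
    (by exact_mod_cast hα)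
  obtain ⟨z, hz, hz0, hz1⟩ := (hC.and (Ioc_mem_nhdsGT one_pos)).exists
  have h1 : IntegrableOn (fun y : ℝ => y) {y | |y| < z} ν := by
    refine ⟨by fun_prop, ?_⟩
    rw [hasFiniteIntegral_iff_norm]
    simp only [pow_one] at hz
    exact hz.trans_lt ENNReal.ofReal_lt_top
  have h2 := hν.integrableOn_shell (x := z) hz0 1 (h := fun y => y) measurable_id (C := 1)
    fun y hy => hy.le
  refine (h1.union h2).mono_set fun y hy => ?_
  rcases lt_or_ge |y| z with h | h
  · exact Or.inl h
  · exact Or.inr ⟨h, hy⟩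

lemma ae_stable_notMem_pair (x y : ℝ) :
    ∀ᵐ t ∂(stableLevyMeasure α cp cn), t ∉ ({x, y} : Set ℝ) :=
  measure_eq_zero_iff_ae_notMem.1 (stableLevyMeasure_pair x y)

lemma frontier_abs_lt_subset (x : ℝ) : frontier {y : ℝ | |y| < x} ⊆ {x, -x} := by
  intro y hy
  have h1 : |y| = x := frontier_lt_subset_eq continuous_abs continuous_const hy
  rcases abs_choice y with h | h
  · left; rw [← h1, h]
  · right
    rw [mem_singleton_iff, ← h1, h, neg_neg]

/-- For `α < 1` and zero drift, the truncated mean is the mean of the jumps smaller than `z`,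
whose zooming limit is known. -/
lemma TailsTendTo.tendsto_mean_of_lt_one (hν : IsLevyMeasure ν)
    (hT : TailsTendTo e ν (stableLevyMeasure α cp cn)) (hs : IsStrictlyStableParam α cp cn γhat)
    (hα : α < 1) (hd : bvDrift γ ν = 0) :
    Tendsto (fun z => e z * truncMean γ ν z / z) (𝓝[>] 0) (𝓝 γhat) := by
  set S := stableLevyMeasure α cp cn with hS
  have hi := hT.integrableOn_of_lt_one hν hs hα
  have hiS := tailsTendTo_stable_self.integrableOn_of_lt_one (isLevyMeasure_of_param hs) hs hα
  have hval : ∫ y in {y : ℝ | |y| < 1}, y ∂S = γhat := by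
    -- the drift of the stable process vanishes, by self-similarity of its truncated mean
    have h1 : Tendsto (fun z : ℝ => z ^ (1 - α) * γhat) (𝓝[>] 0) (𝓝 0) := by
      have h2 : Tendsto (fun z : ℝ => z ^ (1 - α)) (𝓝 0) (𝓝 (0 ^ (1 - α))) :=
        (Real.continuousAt_rpow_const 0 _ (Or.inr (by linarith))).tendsto
      rw [Real.zero_rpow (by linarith)] at h2
      simpa using (h2.mono_left nhdsWithin_le_nhds).mul_const γhat
    have h3 : bvDrift γhat S = 0 := by
      refine tendsto_nhds_unique (tendsto_truncMean_bvDrift hiS) (h1.congr' ?_)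
      filter_upwards [Ioc_mem_nhdsGT one_pos] with z hz
      exact (truncMean_stable hs hz.1 hz.2).symm
    rw [bvDrift] at h3
    linarith
  have key := hT.tendsto_integral hν hs (p := 1) (by exact_mod_cast hα)
    (h := {y : ℝ | |y| < 1}.indicator id) (measurable_id.indicator (measurableSet_abs_lt 1))
    (B := 1) (fun x => ?_) (fun x _ => ?_) ?_
  · rw [integral_indicator (measurableSet_abs_lt 1)] at key
    simp only [id] at key
    rw [hval] at key
    refine key.congr' ?_
    filter_upwards [hT.scale_pos, Ioc_mem_nhdsGT one_pos] with z hz hz1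
    rw [integral_indicator (measurableSet_abs_lt 1),
      setIntegral_zoom hz.le hz1.1.ne' _ (measurableSet_abs_lt 1),
      truncMean_eq_bvDrift_add hi hz1.2, hd, zero_add, smul_eq_mul, mul_div_assoc]
    have h1 : {x : ℝ | x / z ∈ {y : ℝ | |y| < 1}} = {y | |y| < z} := by
      ext x
      simp only [mem_ofPred_eq]
      rw [abs_div_lt_iff hz1.1, mul_one]
    simp only [id]
    rw [h1, integral_div]
  · by_cases hx : |x| < 1
    · rw [indicator_of_mem (by exact hx)]; exact hx.le
    · rw [indicator_of_notMem (by exact hx), abs_zero]; exact zero_le_one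
  · rw [pow_one, one_mul]
    exact norm_indicator_le_norm_self id x
  · filter_upwards [ae_stable_notMem_pair 1 (-1)] with x hx
    exact continuousAt_indicator_of_notMem continuous_id (frontier_abs_lt_subset 1) hx

/-- For `α > 1` the truncated mean is determined by the tails alone: its normalized deviation from
the limit contracts by the factor `2 ^ (1 - α)` when the argument is halved. -/
lemma TailsTendTo.tendsto_mean_of_one_lt (hν : IsLevyMeasure ν)
    (hT : TailsTendTo e ν (stableLevyMeasure α cp cn)) (hs : IsStrictlyStableParam α cp cn γhat)
    (hα : 1 < α) : Tendsto (fun z => e z * truncMean γ ν z / z) (𝓝[>] 0) (𝓝 γhat) := by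
  set S := stableLevyMeasure α cp cn with hS
  have hSL := isLevyMeasure_of_param hs
  set κ := tail S 1 with hκ
  have hκ0 : 0 < κ := hs.tail_one_pos
  set g := γhat / κ with hg
  have hκlim : Tendsto (fun z => e z * tail ν z) (𝓝[>] 0) (𝓝 κ) := by
    simpa only [mul_one] using hT.tail_tendsto one_pos
  have hpos := hT.tail_pos hs.tail_one_pos
  set s : ℝ → Set ℝ := fun z => {y : ℝ | z * (1 / 2) ≤ |y| ∧ |y| < z} with hsdef
  -- the mean of the jumps in one dyadic shell
  have hJ : Tendsto (fun z => (∫ y in s z, y ∂ν) / (z * tail ν z)) (𝓝[>] 0)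
      (𝓝 (g * (1 - 2 ^ (α - 1)))) := by
    have hval : ∫ y in s 1, y ∂S = γhat * (1 - 2 ^ (α - 1)) := by
      have h1 := hSL.truncMean_sub (γ := γhat) (x := 1 * (1 / 2)) (z := 1) (by norm_num)
        (by norm_num) le_rfl
      rw [truncMean_stable hs one_pos le_rfl, truncMean_stable hs (by norm_num) (by norm_num),
        Real.one_rpow, one_mul, one_mul, one_div, Real.inv_rpow zero_le_two,
        ← Real.rpow_neg zero_le_two, neg_sub] at h1
      simp only [hsdef, one_mul, one_div]
      rw [← h1]
      ring
    have hms : ∀ z, MeasurableSet (s z) := fun z => measurableSet_shell _ _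
    have key := hT.tendsto_integral hν hs (p := 2) (by exact_mod_cast hs.alpha_lt_two)
      (h := (s 1).indicator id) (measurable_id.indicator (hms 1)) (B := 2)
      (fun x => ?_) (fun x _ => ?_) ?_
    · rw [integral_indicator (hms 1)] at key
      simp only [id] at key
      rw [hval] at key
      have h2 := key.div hκlim hκ0.ne'
      rw [mul_div_right_comm, ← hg] at h2
      refine h2.congr' ?_
      filter_upwards [hT.scale_pos, self_mem_nhdsWithin] with z hz hz0
      have hz0 : 0 < z := hz0
      have h3 : {x : ℝ | x / z ∈ s 1} = s z := by
        ext x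
        simp only [hsdef, mem_ofPred_eq]
        rw [abs_div_lt_iff hz0, le_abs_div_iff hz0, mul_one, one_mul]
      simp only [Pi.div_apply]
      rw [integral_indicator (hms 1), setIntegral_zoom hz.le hz0.ne' _ (hms 1), h3, smul_eq_mul,
        mul_div_mul_left _ _ hz.ne']
      simp only [id]
      rw [integral_div, div_div]
    · by_cases hx : x ∈ s 1
      · rw [indicator_of_mem hx]
        exact hx.2.le.trans one_le_two
      · rw [indicator_of_notMem hx, abs_zero]; exact zero_le_two
    · by_cases hx : x ∈ s 1
      · rw [indicator_of_mem hx, id]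
        have h1 : 1 * (1 / 2) ≤ |x| := hx.1
        nlinarith
      · rw [indicator_of_notMem hx, abs_zero]; positivity
    · filter_upwards [ae_stable_notMem_pair 1 (-1), ae_stable_notMem_pair (1 / 2) (-(1 / 2))]
        with x hx1 hx2
      have hsub : s 1 = {y : ℝ | |y| < 1} ∩ {y : ℝ | |y| < 1 / 2}ᶜ := by
        ext y
        simp only [hsdef, mem_ofPred_eq, mem_inter_iff, mem_compl_iff, not_lt, one_mul]
        exact and_comm
      refine continuousAt_indicator_of_notMem (t := {1, -1} ∪ {1 / 2, -(1 / 2)}) continuous_id ?_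
        (fun h => h.elim hx1 hx2)
      rw [hsub]
      refine (frontier_inter_subset _ _).trans (union_subset ?_ ?_)
      · exact inter_subset_left.trans ((frontier_abs_lt_subset 1).trans subset_union_left)
      · rw [frontier_compl]
        exact inter_subset_right.trans ((frontier_abs_lt_subset _).trans subset_union_right)
  have h2z : Tendsto (fun z : ℝ => 2 * z) (𝓝[>] 0) (𝓝[>] 0) :=
    tendsto_const_mul_nhdsGT_zero two_pos
  set Q : ℝ → ℝ := fun z => 2 * (tail ν (z * 2) / tail ν z) with hQ
  have hQlim : Tendsto Q (𝓝[>] 0) (𝓝 (2 * 2 ^ (-α))) :=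
    (hT.tail_ratio_stable hs two_pos).const_mul 2
  have h2α : (2 : ℝ) * 2 ^ (-α) = 2 ^ (1 - α) := by
    rw [sub_eq_add_neg, Real.rpow_add two_pos, Real.rpow_one]
  set D : ℝ → ℝ := fun z => truncMean γ ν z / (z * tail ν z) - g with hD
  -- the error in the recursion `D z = Q z * D (2 z) ± η z` for the deviation `D`
  set η : ℝ → ℝ := fun z => |Q z * (g - (∫ y in s (2 * z), y ∂ν) / (2 * z * tail ν (2 * z))) - g|
    with hη
  have hηlim : Tendsto η (𝓝[>] 0) (𝓝 0) := by
    have h1 := ((hQlim.mul ((hJ.comp h2z).const_sub g)).sub_const g).abs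
    have h2 : (2 : ℝ) ^ (1 - α) * 2 ^ (α - 1) = 1 := by
      rw [← Real.rpow_add two_pos, sub_add_sub_cancel, sub_self, Real.rpow_zero]
    have h3 : 2 * 2 ^ (-α) * (g - g * (1 - 2 ^ (α - 1))) - g = 0 := by
      rw [h2α]
      linear_combination g * h2
    rw [h3, abs_zero] at h1
    exact h1
  obtain ⟨d₀, hd₀, hd⟩ := mem_nhdsGT_iff_exists_Ioo_subset.1 hpos
  have hd₀' : (0 : ℝ) < d₀ := hd₀
  have hD0 : Tendsto (fun z => |D z|) (𝓝[>] 0) (𝓝 0) := by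
    refine tendsto_zero_of_tendsto_contraction (q := Q) (η := η) (q₀ := 2 * 2 ^ (-α))
      (d₀ := d₀ / 2) (by positivity) ?_ (by positivity) (fun a ha => ?_) hQlim hηlim
      (.of_forall fun z => abs_nonneg _) ?_
    · rw [h2α]
      exact Real.rpow_lt_one_of_one_lt_of_neg one_lt_two (by linarith)
    · have ha0 : 0 < a := ha.1
      have ht : 0 < tail ν (d₀ / 2) := hd ⟨by positivity, by linarith⟩
      refine ⟨(|γ| + absMoment ν a) / (a * tail ν (d₀ / 2)) + |g|, fun z hz => ?_⟩
      have hz0 : 0 < z := ha0.trans_le hz.1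
      have h1 : tail ν (d₀ / 2) ≤ tail ν z := hν.tail_anti hz0 hz.2
      have h3 : |truncMean γ ν z| ≤ |γ| + absMoment ν a :=
        (abs_truncMean_le z).trans (by gcongr; exact hν.absMoment_anti ha0 hz.1)
      have h4 := absMoment_nonneg (ν := ν) a
      have h5 : a ≤ z := hz.1
      refine (abs_sub _ _).trans ?_
      rw [abs_div, abs_of_pos (mul_pos hz0 (ht.trans_le h1))]
      gcongr
    · filter_upwards [Ioc_mem_nhdsGT (show (0 : ℝ) < 1 / 2 by norm_num), hpos,
        h2z.eventually hpos] with z hz h1 h2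
      have hz0 : 0 < z := hz.1
      have h3 := hν.truncMean_sub (γ := γ) hz0 (show z ≤ 2 * z by linarith) (by linarith [hz.2])
      have hsz : s (2 * z) = {y : ℝ | z ≤ |y| ∧ |y| < 2 * z} := by
        simp only [hsdef]
        rw [show 2 * z * (1 / 2) = z by ring]
      have h4 : D z = Q z * D (2 * z) +
          (Q z * (g - (∫ y in s (2 * z), y ∂ν) / (2 * z * tail ν (2 * z))) - g) := by
        simp only [hD, hQ]
        rw [mul_comm] at h2
        rw [hsz, ← h3, mul_comm 2 z]
        field_simp
        ring
      have hQ0 : 0 ≤ Q z := mul_nonneg zero_le_two (div_nonneg (tail_nonneg _) h1.le)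
      calc |D z| ≤ |Q z * D (2 * z)| + η z := by rw [h4]; exact abs_add_le _ _
        _ = Q z * |D (2 * z)| + η z := by rw [abs_mul, abs_of_nonneg hQ0]
  have h1 : Tendsto (fun z => truncMean γ ν z / (z * tail ν z)) (𝓝[>] 0) (𝓝 g) := by
    have := ((tendsto_zero_iff_abs_tendsto_zero D).2 hD0).add_const g
    simpa only [hD, sub_add_cancel, zero_add] using this
  have h2 := hκlim.mul h1
  rw [hg, mul_div_cancel₀ _ hκ0.ne'] at h2
  refine h2.congr' ?_
  filter_upwards [hpos, self_mem_nhdsWithin] with z h3 hz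
  have hz : 0 < z := hz
  field_simp

/-- Convergence of the tails and of the mean is sufficient for attraction. -/
lemma TailsTendTo.tendsToUnder (hν : IsLevyMeasure ν)
    (hT : TailsTendTo e ν (stableLevyMeasure α cp cn)) (hs : IsStrictlyStableParam α cp cn γhat)
    (hm : Tendsto (fun z => e z * truncMean γ ν z / z) (𝓝[>] 0) (𝓝 γhat)) :
    TendsToUnder e (charExp γ 0 ν) (charExp γhat 0 (stableLevyMeasure α cp cn)) := by
  intro u
  set S := stableLevyMeasure α cp cn with hS
  have hSL := isLevyMeasure_of_param hs
  set B := 3 * u ^ 2 + 2 with hB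
  have hbd : ∀ x, ‖levyKernel u x‖ ≤ B := fun x => (norm_levyKernel_le u x).trans
    (mul_le_of_le_one_right (by positivity) (min_le_right _ _))
  have hbd2 : ∀ x : ℝ, ‖levyKernel u x‖ ≤ B * |x| ^ 2 := fun x => by
    rw [sq_abs]
    exact (norm_levyKernel_le u x).trans
      (mul_le_mul_of_nonneg_left (min_le_left _ _) (by positivity))
  have hp2 : α < (2 : ℕ) := by exact_mod_cast hs.alpha_lt_two
  have hre := hT.tendsto_integral hν hs hp2 (h := fun x => (levyKernel u x).re) (B := B)
    (Complex.measurable_re.comp (measurable_levyKernel u))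
    (fun x => (Complex.abs_re_le_norm _).trans (hbd x))
    (fun x _ => (Complex.abs_re_le_norm _).trans (hbd2 x)) (by
      filter_upwards [ae_stable_notMem_pair 1 (-1)] with x hx
      exact Complex.continuous_re.continuousAt.comp (continuousAt_levyKernel hx))
  have him := hT.tendsto_integral hν hs hp2 (h := fun x => (levyKernel u x).im) (B := B)
    (Complex.measurable_im.comp (measurable_levyKernel u))
    (fun x => (Complex.abs_im_le_norm _).trans (hbd x))
    (fun x _ => (Complex.abs_im_le_norm _).trans (hbd2 x)) (by
      filter_upwards [ae_stable_notMem_pair 1 (-1)] with x hx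
      exact Complex.continuous_im.continuousAt.comp (continuousAt_levyKernel hx))
  have hdec : ∀ (g : ℝ) (r : Measure ℝ), IsLevyMeasure r → charExp g 0 r u =
      (g : ℂ) * u * Complex.I + (((∫ x, (levyKernel u x).re ∂r : ℝ) : ℂ) +
        ((∫ x, (levyKernel u x).im ∂r : ℝ) : ℂ) * Complex.I) := by
    intro g r hr
    have h1 := integral_re_add_im (𝕜 := ℂ) (hr.integrable_levyKernel u)
    have h2 : ((∫ x, (levyKernel u x).re ∂r : ℝ) : ℂ) +
        ((∫ x, (levyKernel u x).im ∂r : ℝ) : ℂ) * Complex.I = ∫ x, levyKernel u x ∂r := h1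
    rw [h2, charExp_eq]
    simp
  rw [hdec γhat S hSL]
  have hlim := ((((Complex.continuous_ofReal.tendsto _).comp hm).mul_const (u : ℂ)).mul_const
    Complex.I).add (((Complex.continuous_ofReal.tendsto _).comp hre).add
      (((Complex.continuous_ofReal.tendsto _).comp him).mul_const Complex.I))
  refine hlim.congr' ?_
  filter_upwards [hT.scale_pos, Ioc_mem_nhdsGT one_pos] with z hz hz1
  have h1 := charExp_zoom (γ := γ) (σ := 0) hν hz.le hz1.1 hz1.2 u
  rw [mul_zero, zero_div, hdec _ _ (hν.zoom hz1.1)] at h1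
  exact h1

end

section

variable {γ σ γhat α cp cn : ℝ} {ν : Measure ℝ} {e : ℝ → ℝ}

/-! ### Attraction to a stable process: the criterion -/

lemma TendsToUnder.tailsTendTo (hν : IsLevyMeasure ν) (hs : IsStrictlyStableParam α cp cn γhat)
    (he : ∀ᶠ z in 𝓝[>] 0, 0 < e z)
    (h : TendsToUnder e (charExp γ σ ν) (charExp γhat 0 (stableLevyMeasure α cp cn))) :
    TailsTendTo e ν (stableLevyMeasure α cp cn) :=
  ⟨he, fun _ hx => h.tendsto_tailPos hν (isLevyMeasure_of_param hs) he hx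
    (stableLevyMeasure_singleton _), fun _ hx => h.tendsto_tailNeg hν (isLevyMeasure_of_param hs)
    he hx (stableLevyMeasure_singleton _)⟩

lemma TailsTendTo.tendsto_tail_one (hs : IsStrictlyStableParam α cp cn γhat)
    (hT : TailsTendTo e ν (stableLevyMeasure α cp cn)) :
    Tendsto (fun z => e z * tail ν z) (𝓝[>] 0) (𝓝 ((cp + cn) / α)) := by
  have := hT.tail_tendsto one_pos
  rw [hs.tail_one] at this
  simpa only [mul_one] using this

/-- A process attracted to a stable one with `α < 2` has no Gaussian part. -/
lemma TendsToUnder.sigma_eq_zero (hν : IsLevyMeasure ν)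
    (hs : IsStrictlyStableParam α cp cn γhat) (he : ∀ᶠ z in 𝓝[>] 0, 0 < e z)
    (h : TendsToUnder e (charExp γ σ ν) (charExp γhat 0 (stableLevyMeasure α cp cn))) :
    σ = 0 := by
  by_contra hσ
  have h0 : Tendsto (fun z => z ^ 2 * tail ν z) (𝓝[>] 0) (𝓝 0) := by
    refine squeeze_zero' (.of_forall fun z => mul_nonneg (sq_nonneg z) (tail_nonneg z)) ?_
      hν.tendsto_sq_mul_closedTail
    filter_upwards [self_mem_nhdsWithin] with z hz
    exact mul_le_mul_of_nonneg_left (hν.tail_le_closedTail hz) (sq_nonneg z)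
  have h1 : Tendsto (fun z => e z * σ ^ 2 / z ^ 2 * (z ^ 2 * tail ν z) / σ ^ 2) (𝓝[>] 0)
      (𝓝 (0 * 0 / σ ^ 2)) :=
    ((h.tendsto_sigma hν (isLevyMeasure_of_param hs) he).mul h0).div_const _
  rw [zero_mul, zero_div] at h1
  have hpos : 0 < (cp + cn) / α := div_pos hs.sum_pos hs.alpha_pos
  refine hpos.ne' (tendsto_nhds_unique (((h.tailsTendTo hν hs he).tendsto_tail_one hs)) ?_)
  refine h1.congr' ?_
  filter_upwards [self_mem_nhdsWithin] with z hz
  have hz : 0 < z := hz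
  field_simp

lemma isEquivalent_inv_mul_iff {T a : ℝ → ℝ} {c : ℝ} (hc : 0 < c) :
    ((fun ε => T (a ε)) ~[𝓝[>] 0] (fun ε => ε⁻¹ * c)) ↔
      Tendsto (fun ε => ε * T (a ε)) (𝓝[>] 0) (𝓝 c) := by
  rw [Asymptotics.isEquivalent_iff_tendsto_one]
  · constructor
    · intro h
      have h1 := h.mul_const c
      rw [one_mul] at h1
      refine h1.congr' ?_
      filter_upwards [self_mem_nhdsWithin] with ε hε
      have hε : 0 < ε := hε
      simp only [Pi.div_apply]
      field_simp
    · intro h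
      have h1 := h.div_const c
      rw [div_self hc.ne'] at h1
      refine h1.congr' ?_
      filter_upwards [self_mem_nhdsWithin] with ε hε
      have hε : 0 < ε := hε
      simp only [Pi.div_apply]
      field_simp
  · filter_upwards [self_mem_nhdsWithin] with ε hε
    have hε : 0 < ε := hε
    positivity

/-- A nonincreasing tail along a scaling function can only blow up if that function vanishes. -/
lemma tendsto_scaling_of_tail {T a : ℝ → ℝ} (hT : ∀ x z, 0 < x → x ≤ z → T z ≤ T x)
    (ha : IsScaling a) {c : ℝ} (hc : 0 < c)
    (h : Tendsto (fun ε => ε * T (a ε)) (𝓝[>] 0) (𝓝 c)) : Tendsto a (𝓝[>] 0) (𝓝[>] 0) := by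
  refine tendsto_nhdsWithin_iff.2 ⟨?_, by
    filter_upwards [self_mem_nhdsWithin] with ε hε using ha ε hε⟩
  rw [Metric.tendsto_nhds]
  intro d hd
  have h1 : Tendsto (fun ε : ℝ => ε * T d) (𝓝[>] 0) (𝓝 0) := by
    simpa using (tendsto_id.mono_left nhdsWithin_le_nhds : Tendsto id (𝓝[>] (0 : ℝ)) (𝓝 0)).mul_const
      (T d)
  filter_upwards [h.eventually (lt_mem_nhds (half_lt_self hc)),
    h1.eventually (gt_mem_nhds (half_pos hc)), self_mem_nhdsWithin] with ε h2 h3 hε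
  have hε : 0 < ε := hε
  rw [Real.dist_eq, sub_zero, abs_of_pos (ha ε hε)]
  by_contra! hcon
  have := mul_le_mul_of_nonneg_left (hT d (a ε) hd hcon) hε.le
  linarith

lemma tendsto_time_scale {T a e₀ : ℝ → ℝ} {c : ℝ} (hc : 0 < c)
    (he : Tendsto (fun z => e₀ z * T z) (𝓝[>] 0) (𝓝 c)) (ha : Tendsto a (𝓝[>] 0) (𝓝[>] 0)) :
    Tendsto (fun ε => e₀ (a ε) / ε) (𝓝[>] 0) (𝓝 1) ↔
      Tendsto (fun ε => ε * T (a ε)) (𝓝[>] 0) (𝓝 c) := by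
  have h1 : Tendsto (fun ε => e₀ (a ε) * T (a ε)) (𝓝[>] 0) (𝓝 c) := he.comp ha
  constructor
  · intro h
    have h2 := h1.div h one_ne_zero
    rw [div_one] at h2
    refine h2.congr' ?_
    filter_upwards [h1.eventually_ne hc.ne', self_mem_nhdsWithin] with ε h3 hε
    have hε : 0 < ε := hε
    have h4 : e₀ (a ε) ≠ 0 := left_ne_zero_of_mul h3
    simp only [Pi.div_apply]
    field_simp
  · intro h
    have h2 := h1.div h hc.ne'
    rw [div_self hc.ne'] at h2
    refine h2.congr' ?_
    filter_upwards [h1.eventually_ne hc.ne', self_mem_nhdsWithin] with ε h3 hε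
    have hε : 0 < ε := hε
    have h4 : T (a ε) ≠ 0 := right_ne_zero_of_mul h3
    simp only [Pi.div_apply]
    field_simp

/-- The asymptotic relations for the one-sided tails say that the scaling function inverts the
time scale; the relation for a side without jumps in the limit is void. -/
lemma TailsTendTo.scaling_iff (hν : IsLevyMeasure ν) (hs : IsStrictlyStableParam α cp cn γhat)
    (hT : TailsTendTo e ν (stableLevyMeasure α cp cn)) {a : ℝ → ℝ} (ha : IsScaling a) :
    (Tendsto a (𝓝[>] 0) (𝓝[>] 0) ∧ Tendsto (fun ε => e (a ε) / ε) (𝓝[>] 0) (𝓝 1)) ↔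
      (0 < cp → (fun ε => tailPos ν (a ε)) ~[𝓝[>] 0] (fun ε => ε⁻¹ * (cp / α))) ∧
      (0 < cn → (fun ε => tailNeg ν (a ε)) ~[𝓝[>] 0] (fun ε => ε⁻¹ * (cn / α))) := by
  have hα := hs.alpha_pos
  have hp : Tendsto (fun z => e z * tailPos ν z) (𝓝[>] 0) (𝓝 (cp / α)) := by
    have h := hT.tailPos_tendsto 1 one_pos
    rw [tailPos_stable hα hs.cpos_nonneg one_pos, Real.one_rpow] at h
    simpa only [mul_one] using h
  have hn : Tendsto (fun z => e z * tailNeg ν z) (𝓝[>] 0) (𝓝 (cn / α)) := by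
    have h := hT.tailNeg_tendsto 1 one_pos
    rw [tailNeg_stable hα hs.cneg_nonneg one_pos, Real.one_rpow] at h
    simpa only [mul_one] using h
  constructor
  · rintro ⟨h0, h1⟩
    refine ⟨fun hc => ?_, fun hc => ?_⟩
    · rw [isEquivalent_inv_mul_iff (div_pos hc hα)]
      exact (tendsto_time_scale (div_pos hc hα) hp h0).1 h1
    · rw [isEquivalent_inv_mul_iff (div_pos hc hα)]
      exact (tendsto_time_scale (div_pos hc hα) hn h0).1 h1
  · rintro ⟨h1, h2⟩
    rcases hs.cpos_nonneg.lt_or_eq with hc | hc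
    · have h3 := (isEquivalent_inv_mul_iff (div_pos hc hα)).1 (h1 hc)
      have h4 := tendsto_scaling_of_tail (fun x z hx hxz => hν.tailPos_anti hx hxz) ha
        (div_pos hc hα) h3
      exact ⟨h4, (tendsto_time_scale (div_pos hc hα) hp h4).2 h3⟩
    · have hc : 0 < cn := by linarith [hs.sum_pos]
      have h3 := (isEquivalent_inv_mul_iff (div_pos hc hα)).1 (h2 hc)
      have h4 := tendsto_scaling_of_tail (fun x z hx hxz => hν.tailNeg_anti hx hxz) ha
        (div_pos hc hα) h3
      exact ⟨h4, (tendsto_time_scale (div_pos hc hα) hn h4).2 h3⟩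

variable {Ω : Type*} [MeasurableSpace Ω] {P : Measure Ω} {X : ℝ≥0 → Ω → ℝ}

lemma StableConditions.tailsTendTo (hs : IsStrictlyStableParam α cp cn γhat)
    (h : StableConditions P X γ σ ν α cp cn γhat) :
    TailsTendTo (fun z => (cp + cn) / α / tail ν z) ν (stableLevyMeasure α cp cn) :=
  tailsTendTo_of_regVarying hs h.regVarying_pos h.regVarying_neg h.balance

/-- Sufficiency of the conditions: the three cases `α < 1`, `α = 1` and `α > 1` differ in what
identifies the limit of the truncated mean. -/
lemma StableConditions.tendsToUnder (hν : IsLevyMeasure ν)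
    (hs : IsStrictlyStableParam α cp cn γhat)
    (hBV : IntegrableOn (fun y : ℝ => y) {y | |y| < 1} ν → IsBVProcess P X)
    (h : StableConditions P X γ σ ν α cp cn γhat) :
    TendsToUnder (fun z => (cp + cn) / α / tail ν z) (charExp γ σ ν)
      (charExp γhat 0 (stableLevyMeasure α cp cn)) := by
  have hT := h.tailsTendTo hs
  rw [h.sigma_eq_zero]
  refine hT.tendsToUnder hν hs ?_
  rcases lt_trichotomy α 1 with h1 | h1 | h1
  · exact hT.tendsto_mean_of_lt_one hν hs h1
      (h.drift_eq_zero (hBV (hT.integrableOn_of_lt_one hν hs h1)))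
  · have hc : 0 < cp := by
      have := hs.symmetric h1
      linarith [hs.sum_pos]
    have h2 := hT.tailPos_tendsto 1 one_pos
    rw [tailPos_stable hs.alpha_pos hs.cpos_nonneg one_pos, Real.one_rpow, h1, mul_one,
      div_one] at h2
    have h3 := h2.mul (h.mean_of_alpha_eq_one h1)
    rw [div_one, mul_div_cancel₀ _ hc.ne'] at h3
    refine h3.congr' ?_
    filter_upwards [(h.regVarying_pos hc).eventually_pos, self_mem_nhdsWithin] with z h4 hz
    have hz : 0 < z := hz
    simp only [mul_one, h1, div_one]
    field_simp
  · exact hT.tendsto_mean_of_one_lt hν hs h1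

/-- Necessity of the conditions. For `α ≥ 1` the condition on the drift of a b.v. process also
follows from the convergence of the truncated means. -/
lemma TendsToUnder.stableConditions (hν : IsLevyMeasure ν)
    (hs : IsStrictlyStableParam α cp cn γhat)
    (hBV : σ = 0 → IsBVProcess P X → IntegrableOn (fun y : ℝ => y) {y | |y| < 1} ν)
    (he : ∀ᶠ z in 𝓝[>] 0, 0 < e z)
    (h : TendsToUnder e (charExp γ σ ν) (charExp γhat 0 (stableLevyMeasure α cp cn))) :
    StableConditions P X γ σ ν α cp cn γhat := by
  have hσ := h.sigma_eq_zero hν hs he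
  have hT := h.tailsTendTo hν hs he
  have hm := h.tendsto_truncMean hν (isLevyMeasure_of_param hs) he (stableLevyMeasure_pair 1 (-1))
  refine ⟨hσ, fun hbv => ?_, hT.regVaryingAtZero_tailPos hν hs, hT.regVaryingAtZero_tailNeg hν hs,
    hT.balance hν hs, fun h1 => ?_⟩
  · -- `m(z) = (e m / z) (z Π) / (e Π)` tends to `0` and to `γ'`
    have hi := hBV hσ hbv
    have hκ : 0 < (cp + cn) / α := div_pos hs.sum_pos hs.alpha_pos
    have h1 := (hm.mul (hν.tendsto_mul_tail hi)).div (hT.tendsto_tail_one hs) hκ.ne'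
    rw [mul_zero, zero_div] at h1
    refine tendsto_nhds_unique (tendsto_truncMean_bvDrift hi) (h1.congr' ?_)
    filter_upwards [he, hT.tail_pos hs.tail_one_pos, self_mem_nhdsWithin] with z h2 h3 hz
    have hz : 0 < z := hz
    simp only [Pi.div_apply]
    field_simp
  · have hc : 0 < cp := by
      have := hs.symmetric h1
      linarith [hs.sum_pos]
    have h2 := hT.tailPos_tendsto 1 one_pos
    rw [tailPos_stable hs.alpha_pos hs.cpos_nonneg one_pos, Real.one_rpow, h1, mul_one,
      div_one] at h2
    refine (hm.div h2 hc.ne').congr' ?_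
    filter_upwards [he, self_mem_nhdsWithin] with z h4 hz
    have hz : 0 < z := hz
    simp only [Pi.div_apply, mul_one]
    rw [mul_div_assoc, mul_div_mul_left _ _ h4.ne', div_div]

lemma attraction_stable (hν : IsLevyMeasure ν) (hs : IsStrictlyStableParam α cp cn γhat)
    (hBV : σ = 0 → (IsBVProcess P X ↔ IntegrableOn (fun y : ℝ => y) {y | |y| < 1} ν)) :
    (IsAttractedTo (levyExponent γ σ ν) (levyExponent γhat 0 (stableLevyMeasure α cp cn)) ↔
        StableConditions P X γ σ ν α cp cn γhat) ∧
      ∀ a : ℝ → ℝ, IsScaling a →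
        (ZoomsInTo (levyExponent γ σ ν) (levyExponent γhat 0 (stableLevyMeasure α cp cn)) a ↔
          StableConditions P X γ σ ν α cp cn γhat ∧
          (0 < cp → (fun ε => tailPos ν (a ε)) ~[𝓝[>] 0] (fun ε => ε⁻¹ * (cp / α))) ∧
          (0 < cn → (fun ε => tailNeg ν (a ε)) ~[𝓝[>] 0] (fun ε => ε⁻¹ * (cn / α)))) :=
  attraction_criterion hν (isHomogeneousExponent_stable hs)
    (R := fun a => (0 < cp → (fun ε => tailPos ν (a ε)) ~[𝓝[>] 0] (fun ε => ε⁻¹ * (cp / α))) ∧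
      (0 < cn → (fun ε => tailNeg ν (a ε)) ~[𝓝[>] 0] (fun ε => ε⁻¹ * (cn / α))))
    (fun h => ⟨(h.tailsTendTo hs).scale_pos,
      h.tendsToUnder hν hs (hBV h.sigma_eq_zero).2⟩)
    (fun _ he h => h.stableConditions hν hs (fun h0 => (hBV h0).1) he)
    fun h _ ha => (h.tailsTendTo hs).scaling_iff hν hs ha

end

section

/-! ### The Cauchy distribution and first absolute moments -/

lemma cauchyPDFReal_zero_one (s : ℝ) : cauchyPDFReal 0 1 s = Real.pi⁻¹ * (1 + s ^ 2)⁻¹ := by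
  rw [cauchyPDFReal_def']
  simp

lemma integral_cauchyMeasure {E : Type*} [NormedAddCommGroup E] [NormedSpace ℝ E] (g : ℝ → E) :
    ∫ s, g s ∂(cauchyMeasure 0 1) = ∫ s, (Real.pi⁻¹ * (1 + s ^ 2)⁻¹) • g s := by
  have hm : Measurable (cauchyPDF 0 1) := by fun_prop
  rw [cauchyMeasure_of_scale_ne_zero 0 one_ne_zero, integral_withDensity_eq_integral_toReal_smul hm
    (.of_forall fun s => ENNReal.ofReal_lt_top)]
  refine integral_congr_ae (.of_forall fun s => ?_)
  simp only
  rw [cauchyPDF_def, ENNReal.toReal_ofReal (cauchyPDF_pos 0 one_ne_zero s).le,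
    cauchyPDFReal_zero_one]

/-- The characteristic function of the Cauchy distribution, by inversion of the Fourier transform
of `exp (-2π|x|)`. -/
lemma integral_exp_cauchyMeasure (y : ℝ) :
    ∫ s, Complex.exp ((s * y : ℝ) * Complex.I) ∂(cauchyMeasure 0 1) = Real.exp (-|y|) := by
  set f : ℝ → ℂ := fun x => ((Real.exp (-(2 * Real.pi * |x|)) : ℝ) : ℂ) with hf
  have hpi := Real.pi_pos
  have hpos : ∀ a : ℂ, ∀ x ∈ Ioi (0 : ℝ), Complex.exp (a * x) * f x =
      Complex.exp ((a - 2 * Real.pi) * x) := fun a x hx => by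
    have hx : 0 < x := hx
    simp only [hf]
    rw [abs_of_pos hx, Complex.ofReal_exp, ← Complex.exp_add]
    push_cast
    ring_nf
  have hneg : ∀ a : ℂ, ∀ x ∈ Iic (0 : ℝ), Complex.exp (a * x) * f x =
      Complex.exp ((a + 2 * Real.pi) * x) := fun a x hx => by
    have hx : x ≤ 0 := hx
    simp only [hf]
    rw [abs_of_nonpos hx, Complex.ofReal_exp, ← Complex.exp_add]
    push_cast
    ring_nf
  -- the Fourier transform of `f` is the Cauchy density
  have key : ∀ w : ℝ, Integrable (fun x : ℝ => Complex.exp (-(2 * Real.pi * w * Complex.I) * x) * f x) ∧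
      ∫ x : ℝ, Complex.exp (-(2 * Real.pi * w * Complex.I) * x) * f x =
        ((Real.pi⁻¹ * (1 + w ^ 2)⁻¹ : ℝ) : ℂ) := by
    intro w
    set a : ℂ := -(2 * Real.pi * w * Complex.I) with ha
    have hre1 : (a - 2 * Real.pi).re < 0 := by simp [ha]; positivity
    have hre2 : 0 < (a + 2 * Real.pi).re := by simp [ha]; positivity
    have hi1 : IntegrableOn (fun x : ℝ => Complex.exp (a * x) * f x) (Ioi 0) :=
      (integrableOn_exp_mul_complex_Ioi hre1 0).congr_fun (fun x hx => (hpos a x hx).symm)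
        measurableSet_Ioi
    have hi2 : IntegrableOn (fun x : ℝ => Complex.exp (a * x) * f x) (Iic 0) :=
      (integrableOn_exp_mul_complex_Iic hre2 0).congr_fun (fun x hx => (hneg a x hx).symm)
        measurableSet_Iic
    refine ⟨by rw [← integrableOn_univ, ← Iic_union_Ioi (a := (0 : ℝ))]; exact hi2.union hi1, ?_⟩
    rw [← intervalIntegral.integral_Iic_add_Ioi hi2 hi1, setIntegral_congr_fun measurableSet_Iic
      (hneg a), setIntegral_congr_fun measurableSet_Ioi (hpos a), integral_exp_mul_complex_Iic hre2,
      integral_exp_mul_complex_Ioi hre1]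
    have h1 : a + 2 * Real.pi ≠ 0 := fun h => by rw [h] at hre2; simp at hre2
    have h2 : a - 2 * Real.pi ≠ 0 := fun h => by rw [h] at hre1; simp at hre1
    have h3 : (1 + (w : ℂ) ^ 2) ≠ 0 := by
      have : (1 + w ^ 2 : ℝ) ≠ 0 := by positivity
      exact_mod_cast this
    have h4 : (Real.pi : ℂ) ≠ 0 := by exact_mod_cast hpi.ne'
    have h5 : (a + 2 * Real.pi) * (a - 2 * Real.pi) = -4 * Real.pi ^ 2 * (1 + (w : ℂ) ^ 2) := by
      rw [ha]
      linear_combination (4 * (Real.pi : ℂ) ^ 2 * w ^ 2) * Complex.I_sq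
    simp only [Complex.ofReal_zero, mul_zero, Complex.exp_zero]
    have h6 : 1 / (a + 2 * Real.pi) + -1 / (a - 2 * Real.pi) =
        -4 * Real.pi / ((a + 2 * Real.pi) * (a - 2 * Real.pi)) := by
      field_simp
      ring
    rw [h6, h5]
    push_cast
    field_simp
  have hint : Integrable f := by
    have h := (key 0).1
    simpa using h
  have hF : FourierTransform.fourier f = fun w : ℝ => ((Real.pi⁻¹ * (1 + w ^ 2)⁻¹ : ℝ) : ℂ) := by
    ext w
    rw [Real.fourier_real_eq_integral_exp_smul, ← (key w).2]
    refine integral_congr_ae (.of_forall fun x => ?_)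
    simp only [smul_eq_mul]
    congr 2
    push_cast
    ring
  have hFi : Integrable (FourierTransform.fourier f) := by
    rw [hF]
    exact (integrable_inv_one_add_sq.const_mul _).ofReal
  have hfc : Continuous f := by
    simp only [hf]
    fun_prop
  have hinv := congrFun (hfc.fourierInv_fourier_eq hint hFi) (y / (2 * Real.pi))
  rw [Real.fourierInv_eq', hF] at hinv
  rw [integral_cauchyMeasure]
  have hval : f (y / (2 * Real.pi)) = Real.exp (-|y|) := by
    simp only [hf]
    rw [abs_div, abs_of_pos (by positivity : (0 : ℝ) < 2 * Real.pi)]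
    field_simp
  rw [← hval, ← hinv]
  refine integral_congr_ae (.of_forall fun s => ?_)
  simp only [smul_eq_mul, RCLike.inner_apply, conj_trivial, Complex.real_smul]
  rw [mul_comm]
  congr 3
  field_simp

lemma integral_cos_cauchyMeasure (y : ℝ) :
    ∫ s, Real.cos (s * y) ∂(cauchyMeasure 0 1) = Real.exp (-|y|) := by
  have h := congrArg Complex.re (integral_exp_cauchyMeasure y)
  rw [Complex.ofReal_re] at h
  rw [← h, ← Complex.reCLM_apply, ← ContinuousLinearMap.integral_comp_comm]
  · refine integral_congr_ae (.of_forall fun s => ?_)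
    simp only [Complex.reCLM_apply]
    rw [Complex.exp_ofReal_mul_I_re]
  · refine Integrable.of_bound (C := 1) (by fun_prop) (.of_forall fun s => ?_)
    rw [Complex.norm_exp_ofReal_mul_I]

/-- `1 - e^{-|y|}` is an average of the functions `1 - cos (s y)`. -/
lemma lintegral_one_sub_cos_cauchyMeasure (y : ℝ) :
    ∫⁻ s, ENNReal.ofReal (1 - Real.cos (s * y)) ∂(cauchyMeasure 0 1) =
      ENNReal.ofReal (1 - Real.exp (-|y|)) := by
  have hi : Integrable (fun s => Real.cos (s * y)) (cauchyMeasure 0 1) :=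
    Integrable.of_bound (C := 1) (by fun_prop) (.of_forall fun s => Real.abs_cos_le_one _)
  have hi' : Integrable (fun s => 1 - Real.cos (s * y)) (cauchyMeasure 0 1) :=
    (integrable_const 1).sub hi
  rw [← ofReal_integral_eq_lintegral_ofReal hi' (.of_forall fun s => sub_nonneg.2 (Real.cos_le_one _)), integral_sub (integrable_const _) hi,
    integral_cos_cauchyMeasure]
  simp

/-- Tonelli's theorem for `lintegral_one_sub_cos_cauchyMeasure`: first moments, cut off smoothly,
are averages of quantities that the characteristic function determines. -/
lemma lintegral_one_sub_exp_neg_abs_eq {E : Type*} [MeasurableSpace E] (ρ : Measure E) [SFinite ρ]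
    {Y : E → ℝ} (hY : Measurable Y) (l : ℝ) :
    ∫⁻ x, ENNReal.ofReal (1 - Real.exp (-|l * Y x|)) ∂ρ =
      ∫⁻ s, ∫⁻ x, ENNReal.ofReal (1 - Real.cos (l * s * Y x)) ∂ρ ∂(cauchyMeasure 0 1) := by
  rw [lintegral_lintegral_swap (by fun_prop)]
  refine lintegral_congr fun x => ?_
  rw [← lintegral_one_sub_cos_cauchyMeasure]
  refine lintegral_congr fun s => ?_
  ring_nf

/-- The bound is linear in `b`, although the integrand is quadratic, because the Cauchy
distribution has heavy tails. -/
lemma lintegral_min_sq_cauchyMeasure_le {b : ℝ} (hb : 0 < b) :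
    ∫⁻ s, ENNReal.ofReal (min ((b * s) ^ 2) 1) ∂(cauchyMeasure 0 1) ≤ ENNReal.ofReal (2 * b) := by
  have hpi := Real.pi_pos
  have hi : Integrable (fun s => min ((b * s) ^ 2) 1) (cauchyMeasure 0 1) := by
    refine Integrable.of_bound (C := 1) (by fun_prop) (.of_forall fun s => ?_)
    rw [Real.norm_of_nonneg (by positivity)]
    exact min_le_right _ _
  rw [← ofReal_integral_eq_lintegral_ofReal hi (.of_forall fun s => by positivity)]
  refine ENNReal.ofReal_le_ofReal ?_
  rw [integral_cauchyMeasure]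
  have hI : Integrable fun s : ℝ => (1 + (b * s) ^ 2)⁻¹ :=
    integrable_inv_one_add_sq.comp_mul_left' hb.ne'
  calc ∫ s, (Real.pi⁻¹ * (1 + s ^ 2)⁻¹) • min ((b * s) ^ 2) 1
      ≤ ∫ s, (2 * b ^ 2 * Real.pi⁻¹) * (1 + (b * s) ^ 2)⁻¹ := by
        refine integral_mono_of_nonneg (.of_forall fun s => ?_) (hI.const_mul _)
          (.of_forall fun s => ?_)
        · simp only [Pi.zero_apply, smul_eq_mul]
          positivity
        · simp only [smul_eq_mul]
          have h1 : min ((b * s) ^ 2) 1 * (1 + (b * s) ^ 2) ≤ 2 * (b * s) ^ 2 := by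
            rcases le_total ((b * s) ^ 2) 1 with h | h
            · rw [min_eq_left h]; nlinarith [sq_nonneg (b * s)]
            · rw [min_eq_right h]; linarith
          have h2 : min ((b * s) ^ 2) 1 ≤ 2 * (b * s) ^ 2 * (1 + (b * s) ^ 2)⁻¹ := by
            rw [← div_eq_mul_inv, le_div_iff₀ (by positivity)]
            exact h1
          have h3 : (1 + s ^ 2)⁻¹ * s ^ 2 ≤ 1 := by
            rw [inv_mul_le_iff₀ (by positivity)]
            linarith
          calc Real.pi⁻¹ * (1 + s ^ 2)⁻¹ * min ((b * s) ^ 2) 1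
              ≤ Real.pi⁻¹ * (1 + s ^ 2)⁻¹ * (2 * (b * s) ^ 2 * (1 + (b * s) ^ 2)⁻¹) := by gcongr
            _ = (2 * b ^ 2 * Real.pi⁻¹) * (1 + (b * s) ^ 2)⁻¹ * ((1 + s ^ 2)⁻¹ * s ^ 2) := by ring
            _ ≤ (2 * b ^ 2 * Real.pi⁻¹) * (1 + (b * s) ^ 2)⁻¹ * 1 := by gcongr
            _ = _ := mul_one _
    _ = 2 * b := by
        rw [integral_const_mul, Measure.integral_comp_mul_left (fun s : ℝ => (1 + s ^ 2)⁻¹) b,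
          integral_univ_inv_one_add_sq, abs_of_pos (inv_pos.2 hb), smul_eq_mul]
        field_simp

end

section

/-! ### Absolute increments and small jumps -/

variable {γ : ℝ} {ν : Measure ℝ}

/-- When the small jumps are summable, the imaginary part of the exponent grows at most linearly.
-/
lemma exists_abs_charExp_im_le (hν : IsLevyMeasure ν)
    (hi : IntegrableOn (fun y : ℝ => y) {y | |y| < 1} ν) :
    ∃ K > 0, ∃ K₂ ≥ 0, ∀ u, |(charExp γ 0 ν u).im| ≤ K * |u| + K₂ := by
  have h1 := hν.integrable_min_abs hi
  have h2 := hν.integrable_min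
  have h3 : 0 ≤ ∫ x, min |x| 1 ∂ν := integral_nonneg fun x => by positivity
  refine ⟨|γ| + 2 * ∫ x, min |x| 1 ∂ν + 1, by positivity, ∫ x, min (x ^ 2) 1 ∂ν,
    integral_nonneg fun x => by positivity, fun u => ?_⟩
  rw [charExp_im hν]
  have h4 : |∫ x, (levyKernel u x).im ∂ν| ≤
      2 * |u| * (∫ x, min |x| 1 ∂ν) + ∫ x, min (x ^ 2) 1 ∂ν := by
    rw [← integral_const_mul, ← integral_add (h1.const_mul _) h2, ← Real.norm_eq_abs]
    refine norm_integral_le_of_norm_le ((h1.const_mul _).add h2) (.of_forall fun x => ?_)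
    rw [Real.norm_eq_abs]
    rcases lt_or_ge |x| 1 with hx | hx
    · have h5 : (levyKernel u x).im = Real.sin (u * x) - u * x := by
        rw [levyKernel_of_lt hx, Complex.sub_im, Complex.sub_im, Complex.exp_ofReal_mul_I_im,
          Complex.im_ofReal_mul]
        simp
      have h6 : |Real.sin (u * x)| ≤ |u * x| := Real.abs_sin_le_abs
      have h7 : 0 ≤ min (x ^ 2) 1 := by positivity
      rw [h5, min_eq_left hx.le]
      calc |Real.sin (u * x) - u * x| ≤ |Real.sin (u * x)| + |u * x| := abs_sub _ _
        _ ≤ 2 * |u| * |x| + min (x ^ 2) 1 := by rw [abs_mul] at *; linarith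
    · have h5 : (levyKernel u x).im = Real.sin (u * x) := by
        rw [levyKernel_of_le hx, Complex.sub_im, Complex.exp_ofReal_mul_I_im]
        simp
      have h7 : 1 ≤ x ^ 2 := by rw [← sq_abs]; nlinarith
      rw [h5, min_eq_right hx, min_eq_right h7]
      have := Real.abs_sin_le_one (u * x)
      have := abs_nonneg u
      linarith
  calc |γ * u + ∫ x, (levyKernel u x).im ∂ν| ≤ |γ * u| + _ := abs_add_le _ _
    _ ≤ |γ| * |u| + (2 * |u| * (∫ x, min |x| 1 ∂ν) + ∫ x, min (x ^ 2) 1 ∂ν) := by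
        rw [abs_mul]; gcongr
    _ ≤ _ := by have := abs_nonneg u; linarith

lemma charExp_re_nonpos (hν : IsLevyMeasure ν) (σ u : ℝ) : (charExp γ σ ν u).re ≤ 0 := by
  have h : 0 ≤ ∫ x, (1 - Real.cos (u * x)) ∂ν :=
    integral_nonneg fun x => sub_nonneg.2 (Real.cos_le_one _)
  rw [charExp_re hν]
  have : 0 ≤ σ ^ 2 * u ^ 2 / 2 := by positivity
  linarith

lemma lintegral_one_sub_cos_eq (hν : IsLevyMeasure ν) (u : ℝ) :
    ∫⁻ x, ENNReal.ofReal (1 - Real.cos (u * x)) ∂ν = ENNReal.ofReal (-(charExp γ 0 ν u).re) := by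
  rw [charExp_re hν, ← ofReal_integral_eq_lintegral_ofReal (integrable_one_sub_cos hν u)
    (.of_forall fun x => sub_nonneg.2 (Real.cos_le_one _))]
  congr 1
  ring

/-- The failure of `e^w` to be close to `1` costs `Re w` linearly and `Im w` quadratically. -/
lemma one_sub_re_exp_le {w : ℂ} (hw : w.re ≤ 0) {b c : ℝ} (h : |w.im| ≤ b + c) :
    1 - (Complex.exp w).re ≤ -w.re + (4 * min (b ^ 2) 1 + 4 * c ^ 2) := by
  have h1 : 1 - Real.cos w.im ≤ 4 * min (b ^ 2) 1 + 4 * c ^ 2 := by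
    have h2 := Real.one_sub_sq_div_two_le_cos (x := w.im)
    have h3 := Real.neg_one_le_cos w.im
    have h4 : w.im ^ 2 ≤ (b + c) ^ 2 := by
      rw [← sq_abs]; exact pow_le_pow_left₀ (abs_nonneg _) h 2
    have h5 : (b + c) ^ 2 ≤ 2 * b ^ 2 + 2 * c ^ 2 := by nlinarith [sq_nonneg (b - c)]
    rcases le_total (b ^ 2) 1 with hb | hb
    · rw [min_eq_left hb]; nlinarith [sq_nonneg b, sq_nonneg c]
    · rw [min_eq_right hb]; nlinarith [sq_nonneg c]
  have h6 := Real.add_one_le_exp w.re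
  have h7 : Real.exp w.re ≤ 1 := Real.exp_le_one_iff.2 hw
  have h8 : 0 ≤ 1 - Real.cos w.im := sub_nonneg.2 (Real.cos_le_one _)
  rw [Complex.exp_re]
  nlinarith [Real.exp_pos w.re]

variable {Ω : Type*} [MeasurableSpace Ω] {P : Measure Ω} [IsProbabilityMeasure P]
  {X : ℝ≥0 → Ω → ℝ}

lemma HasLevyTriplet.lintegral_one_sub_cos (hX : IsLevyProcess P X) (hT : HasLevyTriplet P X γ 0 ν)
    (t : ℝ≥0) (u : ℝ) : ∫⁻ ω, ENNReal.ofReal (1 - Real.cos (u * X t ω)) ∂P =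
      ENNReal.ofReal (1 - (Complex.exp ((t : ℝ) * charExp γ 0 ν u)).re) := by
  have hm := hX.measurable t
  have hi : Integrable (fun ω => Real.cos (u * X t ω)) P :=
    Integrable.of_bound (C := 1) (by fun_prop) (.of_forall fun s => Real.abs_cos_le_one _)
  have hi' : Integrable (fun ω => 1 - Real.cos (u * X t ω)) P := (integrable_const 1).sub hi
  have hie : Integrable (fun ω => Complex.exp (u * Complex.I * X t ω)) P := by
    refine Integrable.of_bound (C := 1) (by fun_prop) (.of_forall fun s => ?_)
    rw [show (u : ℂ) * Complex.I * X t s = ((u * X t s : ℝ) : ℂ) * Complex.I by push_cast; ring,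
      Complex.norm_exp_ofReal_mul_I]
  rw [← ofReal_integral_eq_lintegral_ofReal hi' (.of_forall fun s =>
    sub_nonneg.2 (Real.cos_le_one _)), integral_sub (integrable_const _) hi]
  congr 1
  simp only [integral_const, probReal_univ, one_smul]
  congr 1
  rw [charExp, ← hT.exponent t u, ← Complex.reCLM_apply,
    ← ContinuousLinearMap.integral_comp_comm _ hie]
  refine integral_congr_ae (.of_forall fun s => ?_)
  simp only [Complex.reCLM_apply]
  rw [show (u : ℂ) * Complex.I * X t s = ((u * X t s : ℝ) : ℂ) * Complex.I by push_cast; ring,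
    Complex.exp_ofReal_mul_I_re]

lemma HasLevyTriplet.lintegral_one_sub_exp (hX : IsLevyProcess P X)
    (hT : HasLevyTriplet P X γ 0 ν) (t : ℝ≥0) (l : ℝ) :
    ∫⁻ ω, ENNReal.ofReal (1 - Real.exp (-|l * X t ω|)) ∂P =
      ∫⁻ s, ENNReal.ofReal (1 - (Complex.exp ((t : ℝ) * charExp γ 0 ν (l * s))).re)
        ∂(cauchyMeasure 0 1) := by
  rw [lintegral_one_sub_exp_neg_abs_eq P (hX.measurable t)]
  exact lintegral_congr fun s => hT.lintegral_one_sub_cos hX t (l * s)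

lemma lintegral_one_sub_exp_levyMeasure (hν : IsLevyMeasure ν) (l : ℝ) :
    ∫⁻ x, ENNReal.ofReal (1 - Real.exp (-|l * x|)) ∂ν =
      ∫⁻ s, ENNReal.ofReal (-(charExp γ 0 ν (l * s)).re) ∂(cauchyMeasure 0 1) := by
  have := hν.sigmaFinite
  rw [lintegral_one_sub_exp_neg_abs_eq ν (Y := fun x => x) (by fun_prop)]
  exact lintegral_congr fun s => lintegral_one_sub_cos_eq hν (l * s)

/-- The small-time limit of `t⁻¹ E (1 - e^{-|X t|})` is at least the same integral for the Lévy
measure, by Fatou's lemma applied to the averages over the Cauchy distribution. -/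
lemma HasLevyTriplet.lintegral_one_sub_exp_le_liminf (hX : IsLevyProcess P X)
    (hT : HasLevyTriplet P X γ 0 ν) :
    ∫⁻ x, ENNReal.ofReal (1 - Real.exp (-|x|)) ∂ν ≤
      liminf (fun n : ℕ => (n + 1 : ℝ≥0∞) * ∫⁻ ω, ENNReal.ofReal
        (1 - Real.exp (-|X ((n + 1 : ℝ≥0)⁻¹) ω|)) ∂P) atTop := by
  have hν := hT.levyMeasure
  have hc := continuous_charExp (γ := γ) (σ := 0) hν
  have h1 := lintegral_one_sub_exp_levyMeasure (γ := γ) hν 1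
  simp only [one_mul] at h1
  rw [h1]
  have h2 : ∀ n : ℕ, (n + 1 : ℝ≥0∞) * ∫⁻ ω, ENNReal.ofReal
        (1 - Real.exp (-|X ((n + 1 : ℝ≥0)⁻¹) ω|)) ∂P =
      ∫⁻ s, ENNReal.ofReal ((n + 1 : ℝ) * (1 - (Complex.exp (((n : ℝ) + 1)⁻¹ *
        charExp γ 0 ν s)).re)) ∂(cauchyMeasure 0 1) := fun n => by
    have h3 := hT.lintegral_one_sub_exp hX (n + 1 : ℝ≥0)⁻¹ 1
    simp only [one_mul] at h3
    rw [h3, ← lintegral_const_mul _ (by fun_prop)]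
    refine lintegral_congr fun s => ?_
    rw [ENNReal.ofReal_mul (by positivity)]
    congr 1
    · rw [ENNReal.ofReal_add (by positivity) one_pos.le]; simp
  simp_rw [h2]
  refine le_trans (lintegral_mono fun s => ?_) (lintegral_liminf_le fun n => by fun_prop)
  refine (Tendsto.liminf_eq ?_).ge
  refine ENNReal.tendsto_ofReal ?_
  set w := charExp γ 0 ν s with hw
  have h4 : HasDerivAt (fun t : ℝ => -(Complex.exp (t * w)).re) (-w.re) 0 := by
    have h5 : HasDerivAt (fun t : ℂ => Complex.exp (t * w)) w ((0 : ℝ) : ℂ) := by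
      have := ((hasDerivAt_id ((0 : ℝ) : ℂ)).mul_const w).cexp
      simpa using this
    exact h5.real_of_complex.neg
  have h6 := h4.tendsto_slope_zero_right
  have h7 : Tendsto (fun n : ℕ => ((n : ℝ) + 1)⁻¹) atTop (𝓝[>] 0) := by
    refine tendsto_nhdsWithin_iff.2 ⟨?_, .of_forall fun n => by show (0 : ℝ) < _; positivity⟩
    simpa using tendsto_one_div_add_atTop_nhds_zero_nat (𝕜 := ℝ)
  refine (h6.comp h7).congr fun n => ?_
  simp only [Function.comp_apply, zero_add, inv_inv, smul_eq_mul, Complex.ofReal_zero, zero_mul,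
    Complex.exp_zero, Complex.one_re]
  push_cast
  ring

/-- A bound in the converse direction, uniform in `t`: apart from the jump part, the contribution
of the drift is of order `λ`, and the remainder is of second order in `t`. -/
lemma HasLevyTriplet.lintegral_one_sub_exp_le (hX : IsLevyProcess P X)
    (hT : HasLevyTriplet P X γ 0 ν) {K K₂ : ℝ} (hK : 0 < K)
    (hb : ∀ u, |(charExp γ 0 ν u).im| ≤ K * |u| + K₂) {t : ℝ≥0} (ht : 0 < t) {l : ℝ} (hl : 0 < l) :
    ∫⁻ ω, ENNReal.ofReal (1 - Real.exp (-|l * X t ω|)) ∂P ≤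
      ENNReal.ofReal t * (∫⁻ x, ENNReal.ofReal (1 - Real.exp (-|l * x|)) ∂ν +
        ENNReal.ofReal (8 * K * l + 4 * t * K₂ ^ 2)) := by
  have hν := hT.levyMeasure
  have hc := continuous_charExp (γ := γ) (σ := 0) hν
  have ht : (0 : ℝ) < t := ht
  have hm : Measurable fun s => ENNReal.ofReal (-(charExp γ 0 ν (l * s)).re) :=
    (ENNReal.continuous_ofReal.comp
      (Complex.continuous_re.comp (hc.comp (continuous_const_mul l))).neg).measurable
  rw [hT.lintegral_one_sub_exp hX, lintegral_one_sub_exp_levyMeasure (γ := γ) hν, mul_add,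
    ← lintegral_const_mul _ hm]
  calc ∫⁻ s, ENNReal.ofReal (1 - (Complex.exp ((t : ℝ) * charExp γ 0 ν (l * s))).re)
        ∂(cauchyMeasure 0 1)
      ≤ ∫⁻ s, (ENNReal.ofReal t * ENNReal.ofReal (-(charExp γ 0 ν (l * s)).re) +
          (4 * ENNReal.ofReal (min ((t * K * l * s) ^ 2) 1) + ENNReal.ofReal (4 * (t * K₂) ^ 2)))
          ∂(cauchyMeasure 0 1) := by
        refine lintegral_mono fun s => ?_
        have hre := charExp_re_nonpos (γ := γ) hν 0 (l * s)
        have h1 : (((t : ℝ) : ℂ) * charExp γ 0 ν (l * s)).re = t * (charExp γ 0 ν (l * s)).re :=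
          Complex.re_ofReal_mul _ _
        have h2 : (((t : ℝ) : ℂ) * charExp γ 0 ν (l * s)).im = t * (charExp γ 0 ν (l * s)).im :=
          Complex.im_ofReal_mul _ _
        have h3 := one_sub_re_exp_le (w := ((t : ℝ) : ℂ) * charExp γ 0 ν (l * s))
          (b := t * K * l * |s|) (c := t * K₂) (by rw [h1]; nlinarith) (by
            rw [h2, abs_mul, abs_of_pos ht]
            have := hb (l * s)
            rw [abs_mul, abs_of_pos hl] at this
            nlinarith)
        rw [h1] at h3
        rw [show (4 : ℝ≥0∞) = ENNReal.ofReal 4 by simp, ← ENNReal.ofReal_mul (p := 4) (by norm_num),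
          ← ENNReal.ofReal_mul ht.le, ← ENNReal.ofReal_add (by positivity) (by positivity),
          ← ENNReal.ofReal_add (by nlinarith) (by positivity)]
        refine ENNReal.ofReal_le_ofReal (h3.trans_eq ?_)
        rw [mul_pow (t * K * l : ℝ) |s|, sq_abs, ← mul_pow]
        ring
    _ = ∫⁻ s, ENNReal.ofReal t * ENNReal.ofReal (-(charExp γ 0 ν (l * s)).re)
          ∂(cauchyMeasure 0 1) + (4 * ∫⁻ s, ENNReal.ofReal (min ((t * K * l * s) ^ 2) 1)
          ∂(cauchyMeasure 0 1) + ENNReal.ofReal (4 * (t * K₂) ^ 2)) := by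
        rw [lintegral_add_left (hm.const_mul _), lintegral_add_left (by fun_prop),
          lintegral_const_mul 4 (by fun_prop), lintegral_const, measure_univ, mul_one]
    _ ≤ _ := by
        gcongr
        calc _ ≤ 4 * ENNReal.ofReal (2 * (t * K * l)) + ENNReal.ofReal (4 * (t * K₂) ^ 2) := by
              gcongr
              exact lintegral_min_sq_cauchyMeasure_le (by positivity)
          _ = _ := by
              rw [show (4 : ℝ≥0∞) = ENNReal.ofReal 4 by simp, ← ENNReal.ofReal_mul (p := 4) (by norm_num),
                ← ENNReal.ofReal_mul ht.le, ← ENNReal.ofReal_add (by positivity) (by positivity)]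
              congr 1
              ring

end

section

/-! ### Bounded variation along grids -/

/-- The points of the grid with mesh `1 / (n + 1)`. -/
noncomputable def gridPoint (n k : ℕ) : ℝ≥0 := k / (n + 1)

/-- The variation on `[0, T]` of `f` along the grid with mesh `1 / (n + 1)`. -/
noncomputable def gridVariation (T n : ℕ) (f : ℝ≥0 → ℝ) : ℝ :=
  ∑ i ∈ Finset.range (T * (n + 1)), |f (gridPoint n (i + 1)) - f (gridPoint n i)|

lemma gridPoint_mono (n : ℕ) : Monotone (gridPoint n) := fun i j h => by
  unfold gridPoint
  gcongr

lemma gridPoint_succ (n k : ℕ) : gridPoint n (k + 1) = gridPoint n k + (n + 1 : ℝ≥0)⁻¹ := by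
  unfold gridPoint
  push_cast
  rw [add_div, one_div]

lemma gridPoint_horizon (T n : ℕ) : gridPoint n (T * (n + 1)) = T := by
  unfold gridPoint
  push_cast
  field_simp

lemma gridVariation_nonneg (T n : ℕ) (f : ℝ≥0 → ℝ) : 0 ≤ gridVariation T n f :=
  Finset.sum_nonneg fun _ _ => abs_nonneg _

lemma ofReal_gridVariation (T n : ℕ) (f : ℝ≥0 → ℝ) : ENNReal.ofReal (gridVariation T n f) =
    ∑ i ∈ Finset.range (T * (n + 1)), edist (f (gridPoint n i)) (f (gridPoint n (i + 1))) := by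
  rw [gridVariation, ENNReal.ofReal_sum_of_nonneg fun _ _ => abs_nonneg _]
  refine Finset.sum_congr rfl fun i _ => ?_
  rw [edist_comm, edist_dist, Real.dist_eq]

lemma gridVariation_le (T n : ℕ) (f : ℝ≥0 → ℝ) :
    ENNReal.ofReal (gridVariation T n f) ≤ eVariationOn f (Icc 0 T) := by
  rw [ofReal_gridVariation, ← eVariationOn.image_range_of_monotone f (gridPoint_mono n)]
  refine eVariationOn.mono f ?_
  rintro _ ⟨k, hk, rfl⟩
  exact ⟨zero_le, (gridPoint_mono n hk).trans_eq (gridPoint_horizon T n)⟩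

/-- For a right-continuous function, boundedness of the variation along infinitely many of the
grids is enough for bounded variation: `f` is the pointwise limit of its step function
approximations from the right, and the variation is lower semicontinuous. -/
lemma eVariationOn_ne_top_of_frequently {f : ℝ≥0 → ℝ}
    (hf : ∀ t, ContinuousWithinAt f (Ici t) t) (T : ℕ) {M : ℝ}
    (h : ∃ᶠ n in atTop, gridVariation T n f ≤ M) : eVariationOn f (Icc 0 T) ≠ ∞ := by
  intro htop
  set φ : ℕ → ℝ≥0 → ℝ≥0 := fun n t => gridPoint n ⌈t * (n + 1)⌉₊ with hφ
  have hφm : ∀ n, Monotone (φ n) := fun n s t hst => gridPoint_mono n (Nat.ceil_mono (by gcongr))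
  have hlim : ∀ t, Tendsto (fun n => φ n t) atTop (𝓝[Ici t] t) := fun t => by
    have h1 : ∀ n, t ≤ φ n t := fun n => by
      simp only [hφ, gridPoint]
      rw [le_div_iff₀ (by positivity)]
      exact Nat.le_ceil _
    refine tendsto_nhdsWithin_iff.2 ⟨?_, .of_forall h1⟩
    have h2 : Tendsto (fun n : ℕ => t + 1 / ((n : ℝ≥0) + 1)) atTop (𝓝 t) := by
      have := tendsto_const_nhds (x := t).add (tendsto_one_div_add_atTop_nhds_zero_nat (𝕜 := ℝ≥0))
      rwa [add_zero] at this
    refine tendsto_of_tendsto_of_tendsto_of_le_of_le tendsto_const_nhds h2 h1 fun n => ?_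
    simp only [hφ, gridPoint]
    rw [div_le_iff₀ (by positivity), add_mul, one_div, inv_mul_cancel₀ (by positivity)]
    exact (Nat.ceil_lt_add_one zero_le).le
  have h1 : ∀ᶠ n in atTop, ENNReal.ofReal M < eVariationOn (f ∘ φ n) (Icc 0 T) :=
    eVariationOn.lowerSemicontinuous_aux (fun t _ => (hf t).tendsto.comp (hlim t))
      (htop ▸ ENNReal.ofReal_lt_top)
  obtain ⟨n, hn1, hn2⟩ := (h.and_eventually h1).exists
  refine hn2.not_ge (le_trans ?_ (ENNReal.ofReal_le_ofReal hn1))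
  rw [ofReal_gridVariation, ← eVariationOn.image_range_of_monotone f (gridPoint_mono n)]
  refine eVariationOn.comp_le_of_monotoneOn f (φ n) ((hφm n).monotoneOn _) fun t ht => ?_
  refine mem_image_of_mem _ ?_
  refine Nat.ceil_le.2 ?_
  push_cast
  gcongr
  exact ht.2

variable {Ω : Type*} [MeasurableSpace Ω] {P : Measure Ω} {X : ℝ≥0 → Ω → ℝ}

lemma IsLevyProcess.measurable_gridVariation (hX : IsLevyProcess P X) (T n : ℕ) :
    Measurable (fun ω => gridVariation T n fun t => X t ω) := by
  have := hX.measurable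
  unfold gridVariation
  fun_prop

lemma IsLevyProcess.identDistrib_grid (hX : IsLevyProcess P X) (n i : ℕ) :
    IdentDistrib (fun ω => X (gridPoint n (i + 1)) ω - X (gridPoint n i) ω)
      (X (n + 1 : ℝ≥0)⁻¹) P P := by
  rw [gridPoint_succ]
  exact hX.stationary _ _

/-- The Laplace transform of the variation along a grid factorizes, as the increments are
independent and stationary. -/
lemma IsLevyProcess.integral_exp_neg_gridVariation [IsProbabilityMeasure P]
    (hX : IsLevyProcess P X) (n : ℕ) :
    ∫ ω, Real.exp (-gridVariation 1 n fun t => X t ω) ∂P =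
      (∫ ω, Real.exp (-|X (n + 1 : ℝ≥0)⁻¹ ω|) ∂P) ^ (n + 1) := by
  have hm := hX.measurable
  have h1 := ((hX.indep_increments.nat (gridPoint_mono n)).precomp
    (Fin.val_injective (n := n + 1))).comp (fun _ x => Real.exp (-|x|)) fun _ => by fun_prop
  have h2 := h1.integral_fun_prod_eq_prod_integral fun i =>
    Measurable.aestronglyMeasurable (by
      show Measurable fun ω => Real.exp (-|X (gridPoint n (i + 1)) ω - X (gridPoint n i) ω|)
      fun_prop)
  have h3 : ∀ i : Fin (n + 1), ∫ ω, Real.exp (-|X (gridPoint n (i + 1)) ω -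
      X (gridPoint n i) ω|) ∂P = ∫ ω, Real.exp (-|X (n + 1 : ℝ≥0)⁻¹ ω|) ∂P := fun i =>
    ((hX.identDistrib_grid n i).comp (u := fun x => Real.exp (-|x|)) (by fun_prop)).integral_eq
  calc ∫ ω, Real.exp (-gridVariation 1 n fun t => X t ω) ∂P
      = ∫ ω, ∏ i : Fin (n + 1), Real.exp (-|X (gridPoint n (i + 1)) ω -
          X (gridPoint n i) ω|) ∂P := by
        refine integral_congr_ae (.of_forall fun ω => ?_)
        simp only [gridVariation, one_mul]
        rw [← Finset.sum_neg_distrib, Real.exp_sum, Finset.prod_range]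
    _ = ∏ i : Fin (n + 1), ∫ ω, Real.exp (-|X (gridPoint n (i + 1)) ω -
          X (gridPoint n i) ω|) ∂P := h2
    _ = _ := by
        rw [Finset.prod_congr rfl fun i _ => h3 i]
        simp

lemma one_sub_exp_neg_sum_le {l : ℝ} (hl : 0 ≤ l) (N : ℕ) (a : ℕ → ℝ) :
    1 - Real.exp (-(l * ∑ i ∈ Finset.range N, |a i|)) ≤
      ∑ i ∈ Finset.range N, (1 - Real.exp (-|l * a i|)) := by
  induction N with
  | zero => simp
  | succ N ih =>
    rw [Finset.sum_range_succ, Finset.sum_range_succ, mul_add, neg_add, Real.exp_add, abs_mul,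
      abs_of_nonneg hl]
    have h1 : Real.exp (-(l * ∑ i ∈ Finset.range N, |a i|)) ≤ 1 :=
      Real.exp_le_one_iff.2 (neg_nonpos.2 (by positivity))
    have h2 : Real.exp (-(l * |a N|)) ≤ 1 := Real.exp_le_one_iff.2 (neg_nonpos.2 (by positivity))
    nlinarith

/-- The path property is turned into a bound in expectation by the factorization of the Laplace
transform: if the paths have bounded variation, then `(n + 1) E (1 - e^{-|X (1 / (n + 1))|})` is
bounded. -/
lemma IsLevyProcess.exists_bound_of_isBVProcess [IsProbabilityMeasure P] (hX : IsLevyProcess P X)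
    (hBV : IsBVProcess P X) : ∃ C : ℝ, ∀ n : ℕ, (n + 1 : ℝ≥0∞) * ∫⁻ ω, ENNReal.ofReal
      (1 - Real.exp (-|X (n + 1 : ℝ≥0)⁻¹ ω|)) ∂P ≤ ENNReal.ofReal C := by
  set S : ℕ → Ω → ℝ := fun n ω => gridVariation 1 n fun t => X t ω with hS
  have hSm : ∀ n, Measurable (S n) := hX.measurable_gridVariation 1
  set A : ℕ → Set Ω := fun M => {ω | ∀ n, S n ω ≤ M} with hA
  have hAm : ∀ M, MeasurableSet (A M) := fun M => by
    have : A M = ⋂ n, {ω | S n ω ≤ M} := by ext; simp [hA]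
    rw [this]
    exact .iInter fun n => measurableSet_le (hSm n) measurable_const
  have hU : P (⋃ M, A M) ≠ 0 := by
    have h1 : ∀ᵐ ω ∂P, ω ∈ ⋃ M, A M := by
      filter_upwards [hBV] with ω hω
      have h2 : eVariationOn (fun t => X t ω) (Icc 0 (1 : ℕ)) ≠ ∞ := by
        have h3 : eVariationOn (fun t => X t ω) (univ ∩ Icc 0 (1 : ℕ)) ≠ ∞ :=
          hω 0 (1 : ℕ) trivial trivial
        rwa [univ_inter] at h3
      obtain ⟨M, hM⟩ := exists_nat_ge (eVariationOn (fun t => X t ω) (Icc 0 (1 : ℕ))).toReal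
      exact mem_iUnion.2 ⟨M, fun n => le_trans
        ((ENNReal.ofReal_le_iff_le_toReal h2).1 (gridVariation_le 1 n _)) hM⟩
    have h4 : P (⋃ M, A M) = P univ := measure_congr (eventuallyEq_univ.2 h1)
    rw [h4, measure_univ]
    exact one_ne_zero
  -- with positive probability the grid variations are bounded by one constant `M`
  obtain ⟨M, hM⟩ := exists_measure_pos_of_not_measure_iUnion_null hU
  have hδ : 0 < Real.exp (-M) * P.real (A M) :=
    mul_pos (Real.exp_pos _) (ENNReal.toReal_pos hM.ne' (measure_ne_top _ _))
  refine ⟨-Real.log (Real.exp (-M) * P.real (A M)), fun n => ?_⟩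
  have hm := hX.measurable
  have hi : Integrable (fun ω => Real.exp (-|X (n + 1 : ℝ≥0)⁻¹ ω|)) P :=
    Integrable.of_bound (C := 1) (by fun_prop) (.of_forall fun ω => by
      rw [Real.norm_of_nonneg (Real.exp_pos _).le]
      exact Real.exp_le_one_iff.2 (neg_nonpos.2 (abs_nonneg _)))
  have hi' : Integrable (fun ω => 1 - Real.exp (-|X (n + 1 : ℝ≥0)⁻¹ ω|)) P :=
    (integrable_const 1).sub hi
  set q := ∫ ω, Real.exp (-|X (n + 1 : ℝ≥0)⁻¹ ω|) ∂P with hq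
  have hq0 : 0 ≤ q := integral_nonneg fun ω => (Real.exp_pos _).le
  have h1 : Real.exp (-M) * P.real (A M) ≤ q ^ (n + 1) := by
    rw [hq, ← hX.integral_exp_neg_gridVariation n]
    have hiS : Integrable (fun ω => Real.exp (-S n ω)) P :=
      Integrable.of_bound (C := 1) (by have := hSm n; fun_prop) (.of_forall fun ω => by
        rw [Real.norm_of_nonneg (Real.exp_pos _).le]
        exact Real.exp_le_one_iff.2 (neg_nonpos.2 (gridVariation_nonneg 1 n _)))
    calc Real.exp (-M) * P.real (A M) = ∫ ω in A M, Real.exp (-M) ∂P := by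
          rw [setIntegral_const, smul_eq_mul, mul_comm]
      _ ≤ ∫ ω in A M, Real.exp (-S n ω) ∂P :=
          setIntegral_mono_on (integrableOn_const (by simp)) hiS.integrableOn (hAm M) fun ω hω =>
            Real.exp_le_exp.2 (neg_le_neg (hω n))
      _ ≤ _ := setIntegral_le_integral hiS (.of_forall fun ω => (Real.exp_pos _).le)
  -- `q ≤ e^{-(1 - q)}` for the Laplace transform `q` of one increment
  have h2 : q ^ (n + 1) ≤ Real.exp (-((n + 1 : ℝ) * (1 - q))) := by
    calc q ^ (n + 1) ≤ Real.exp (-(1 - q)) ^ (n + 1) := by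
          gcongr
          have := Real.add_one_le_exp (-(1 - q))
          linarith
      _ = _ := by
          rw [← Real.exp_nat_mul]
          push_cast
          ring_nf
  have h3 : (n + 1 : ℝ) * (1 - q) ≤ -Real.log (Real.exp (-M) * P.real (A M)) := by
    have := (Real.log_le_iff_le_exp hδ).2 (h1.trans h2)
    linarith
  rw [← ofReal_integral_eq_lintegral_ofReal hi' (.of_forall fun ω => sub_nonneg.2
    (Real.exp_le_one_iff.2 (neg_nonpos.2 (abs_nonneg _)))), integral_sub (integrable_const _) hi]
  simp only [integral_const, probReal_univ, one_smul]
  refine le_trans (le_of_eq ?_) (ENNReal.ofReal_le_ofReal h3)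
  rw [ENNReal.ofReal_mul (by positivity), ENNReal.ofReal_add (by positivity) one_pos.le]
  simp [hq]

variable {γ : ℝ} {ν : Measure ℝ}

lemma HasLevyTriplet.integrableOn_of_isBVProcess [IsProbabilityMeasure P]
    (hX : IsLevyProcess P X) (hT : HasLevyTriplet P X γ 0 ν) (hBV : IsBVProcess P X) :
    IntegrableOn (fun y : ℝ => y) {y | |y| < 1} ν := by
  obtain ⟨C, hC⟩ := hX.exists_bound_of_isBVProcess hBV
  have h1 : ∫⁻ x, ENNReal.ofReal (1 - Real.exp (-|x|)) ∂ν ≤ ENNReal.ofReal C :=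
    (hT.lintegral_one_sub_exp_le_liminf hX).trans
      ((liminf_le_liminf (.of_forall hC)).trans (liminf_const _).le)
  refine ⟨by fun_prop, ?_⟩
  rw [hasFiniteIntegral_iff_enorm]
  calc ∫⁻ x in {y | |y| < 1}, ‖x‖ₑ ∂ν
      ≤ ∫⁻ x in {y | |y| < 1}, 2 * ENNReal.ofReal (1 - Real.exp (-|x|)) ∂ν := by
        refine setLIntegral_mono' (measurableSet_abs_lt 1) fun x hx => ?_
        have hx : |x| < 1 := hx
        rw [Real.enorm_eq_ofReal_abs, show (2 : ℝ≥0∞) = ENNReal.ofReal 2 by simp,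
          ← ENNReal.ofReal_mul (by norm_num)]
        refine ENNReal.ofReal_le_ofReal ?_
        have h2 := Real.add_one_le_exp |x|
        have h3 : Real.exp (-|x|) * Real.exp |x| = 1 := by rw [← Real.exp_add]; simp
        have h4 := Real.exp_pos (-|x|)
        have h0 := abs_nonneg x
        have h5 : Real.exp (-|x|) * (1 + |x|) ≤ 1 := by nlinarith
        nlinarith
    _ ≤ ∫⁻ x, 2 * ENNReal.ofReal (1 - Real.exp (-|x|)) ∂ν := setLIntegral_le_lintegral _ _
    _ = 2 * ∫⁻ x, ENNReal.ofReal (1 - Real.exp (-|x|)) ∂ν :=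
        lintegral_const_mul _ (by fun_prop)
    _ < ∞ := ENNReal.mul_lt_top (by simp) (h1.trans_lt ENNReal.ofReal_lt_top)

/-- Dominated convergence with the bound `|x| ∧ 1`. -/
lemma tendsto_lintegral_one_sub_exp (hν : IsLevyMeasure ν)
    (hi : IntegrableOn (fun y : ℝ => y) {y | |y| < 1} ν) :
    Tendsto (fun m : ℕ => ∫⁻ x, ENNReal.ofReal (1 - Real.exp (-|(m + 1 : ℝ)⁻¹ * x|)) ∂ν) atTop
      (𝓝 0) := by
  have h1 := hν.integrable_min_abs hi
  rw [show (0 : ℝ≥0∞) = ∫⁻ _ : ℝ, 0 ∂ν by simp]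
  refine tendsto_lintegral_of_dominated_convergence (fun x => ENNReal.ofReal (min |x| 1))
    (fun m => by fun_prop) (fun m => .of_forall fun x => ENNReal.ofReal_le_ofReal ?_) ?_
    (.of_forall fun x => ?_)
  · have h2 : |(m + 1 : ℝ)⁻¹ * x| ≤ |x| := by
      rw [abs_mul, abs_of_pos (by positivity)]
      refine mul_le_of_le_one_left (abs_nonneg x) (inv_le_one_of_one_le₀ ?_)
      linarith [(Nat.cast_nonneg m : (0 : ℝ) ≤ m)]
    have h3 := Real.add_one_le_exp (-|(m + 1 : ℝ)⁻¹ * x|)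
    have h4 := Real.exp_pos (-|(m + 1 : ℝ)⁻¹ * x|)
    exact le_min (by linarith) (by linarith)
  · rw [← ofReal_integral_eq_lintegral_ofReal h1 (.of_forall fun x => by positivity)]
    exact ENNReal.ofReal_ne_top
  · have h5 : Tendsto (fun m : ℕ => (m + 1 : ℝ)⁻¹) atTop (𝓝 0) := by
      simpa using tendsto_one_div_add_atTop_nhds_zero_nat (𝕜 := ℝ)
    have h6 : Continuous fun l : ℝ => ENNReal.ofReal (1 - Real.exp (-|l * x|)) :=
      ENNReal.continuous_ofReal.comp (by fun_prop)
    have h7 := (h6.tendsto 0).comp h5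
    rwa [zero_mul, abs_zero, neg_zero, Real.exp_zero, sub_self, ENNReal.ofReal_zero] at h7

/-- The expectation of `1 - e^{-λ V}` for the variation `V` along a fine grid is small with `λ`,
uniformly in the grid; hence the variations do not tend to infinity. -/
lemma HasLevyTriplet.measure_tendsto_gridVariation [IsProbabilityMeasure P]
    (hX : IsLevyProcess P X) (hT : HasLevyTriplet P X γ 0 ν)
    (hi : IntegrableOn (fun y : ℝ => y) {y | |y| < 1} ν) (T : ℕ) :
    P {ω | Tendsto (fun n => gridVariation T n fun t => X t ω) atTop atTop} = 0 := by
  have hν := hT.levyMeasure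
  obtain ⟨K, hK, K₂, -, hb⟩ := exists_abs_charExp_im_le (γ := γ) hν hi
  set S : ℕ → Ω → ℝ := fun n ω => gridVariation T n fun t => X t ω with hS
  have hSm : ∀ n, Measurable (S n) := hX.measurable_gridVariation T
  set I : ℝ → ℝ≥0∞ := fun l => ∫⁻ x, ENNReal.ofReal (1 - Real.exp (-|l * x|)) ∂ν with hI
  have hstep : ∀ l > 0, ∀ n : ℕ, ∫⁻ ω, ENNReal.ofReal (1 - Real.exp (-(l * S n ω))) ∂P ≤
      T * (I l + ENNReal.ofReal (8 * K * l + 4 * (n + 1 : ℝ)⁻¹ * K₂ ^ 2)) := fun l hl n => by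
    have hm := hX.measurable
    have hinc : ∀ i, ∫⁻ ω, ENNReal.ofReal (1 - Real.exp (-|l * (X (gridPoint n (i + 1)) ω -
        X (gridPoint n i) ω)|)) ∂P =
        ∫⁻ ω, ENNReal.ofReal (1 - Real.exp (-|l * X (n + 1 : ℝ≥0)⁻¹ ω|)) ∂P := fun i =>
      ((hX.identDistrib_grid n i).comp
        (u := fun x => ENNReal.ofReal (1 - Real.exp (-|l * x|))) (by fun_prop)).lintegral_eq
    have hbound := hT.lintegral_one_sub_exp_le hX hK hb (t := (n + 1 : ℝ≥0)⁻¹) (by positivity) hl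
    calc ∫⁻ ω, ENNReal.ofReal (1 - Real.exp (-(l * S n ω))) ∂P
        ≤ ∫⁻ ω, ∑ i ∈ Finset.range (T * (n + 1)), ENNReal.ofReal (1 - Real.exp
            (-|l * (X (gridPoint n (i + 1)) ω - X (gridPoint n i) ω)|)) ∂P := by
          refine lintegral_mono fun ω => ?_
          rw [← ENNReal.ofReal_sum_of_nonneg fun i _ => sub_nonneg.2
            (Real.exp_le_one_iff.2 (neg_nonpos.2 (abs_nonneg _)))]
          exact ENNReal.ofReal_le_ofReal (one_sub_exp_neg_sum_le hl.le _ _)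
      _ = (T * (n + 1) : ℕ) *
            ∫⁻ ω, ENNReal.ofReal (1 - Real.exp (-|l * X (n + 1 : ℝ≥0)⁻¹ ω|)) ∂P := by
          rw [lintegral_finsetSum _ fun i _ => by fun_prop, Finset.sum_congr rfl fun i _ => hinc i]
          simp
      _ ≤ (T * (n + 1) : ℕ) * (ENNReal.ofReal ((n + 1 : ℝ≥0)⁻¹ : ℝ≥0) * (I l +
            ENNReal.ofReal (8 * K * l + 4 * ((n + 1 : ℝ≥0)⁻¹ : ℝ≥0) * K₂ ^ 2))) := by gcongr
      _ = _ := by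
          rw [← mul_assoc]
          congr 1
          push_cast
          rw [mul_assoc, ENNReal.ofReal_inv_of_pos (by positivity),
            ENNReal.ofReal_add (by positivity) one_pos.le, ENNReal.ofReal_natCast,
            ENNReal.ofReal_one, ENNReal.mul_inv_cancel (by simp) (by finiteness), mul_one]
  -- Fatou's lemma: where the variations explode, `1 - e^{-l V}` tends to `1` for every `l`
  have hle : ∀ l > 0, P {ω | Tendsto (fun n => S n ω) atTop atTop} ≤
      T * (I l + ENNReal.ofReal ((8 * K + 1) * l)) := fun l hl => by
    set g : Ω → ℝ≥0∞ := fun ω =>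
      liminf (fun n => ENNReal.ofReal (1 - Real.exp (-(l * S n ω)))) atTop with hg
    have hgm : Measurable g := .liminf fun n => by have := hSm n; fun_prop
    have h1 : {ω | Tendsto (fun n => S n ω) atTop atTop} ⊆ {ω | 1 ≤ g ω} := fun ω hω => by
      have hω : Tendsto (fun n => S n ω) atTop atTop := hω
      have h2 : Tendsto (fun n => ENNReal.ofReal (1 - Real.exp (-(l * S n ω)))) atTop
          (𝓝 (ENNReal.ofReal (1 - 0))) := by
        refine ENNReal.tendsto_ofReal (tendsto_const_nhds.sub ?_)
        exact Real.tendsto_exp_neg_atTop_nhds_zero.comp (hω.const_mul_atTop hl)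
      show 1 ≤ g ω
      exact (by simp : (1 : ℝ≥0∞) ≤ ENNReal.ofReal (1 - 0)).trans h2.liminf_eq.ge
    have h3 : ∀ᶠ n : ℕ in atTop, 4 * (n + 1 : ℝ)⁻¹ * K₂ ^ 2 ≤ l := by
      have h5 : Tendsto (fun n : ℕ => 4 * (n + 1 : ℝ)⁻¹ * K₂ ^ 2) atTop (𝓝 0) := by
        have := ((tendsto_one_div_add_atTop_nhds_zero_nat (𝕜 := ℝ)).const_mul 4).mul_const (K₂ ^ 2)
        simpa using this
      exact h5.eventually_le_const hl
    calc P {ω | Tendsto (fun n => S n ω) atTop atTop} ≤ P {ω | 1 ≤ g ω} := measure_mono h1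
      _ ≤ ∫⁻ ω, g ω ∂P := by simpa using mul_meas_ge_le_lintegral (μ := P) hgm 1
      _ ≤ liminf (fun n => ∫⁻ ω, ENNReal.ofReal (1 - Real.exp (-(l * S n ω))) ∂P) atTop :=
          lintegral_liminf_le fun n => by have := hSm n; fun_prop
      _ ≤ T * (I l + ENNReal.ofReal ((8 * K + 1) * l)) := by
          refine (liminf_le_liminf ?_).trans (liminf_const _).le
          filter_upwards [h3] with n hn
          refine (hstep l hl n).trans ?_
          gcongr
          linarith
  have hlim : Tendsto (fun m : ℕ => (T : ℝ≥0∞) * (I (m + 1 : ℝ)⁻¹ +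
      ENNReal.ofReal ((8 * K + 1) * (m + 1 : ℝ)⁻¹))) atTop (𝓝 0) := by
    have h5 : Tendsto (fun m : ℕ => (8 * K + 1) * (m + 1 : ℝ)⁻¹) atTop (𝓝 0) := by
      simpa using (tendsto_one_div_add_atTop_nhds_zero_nat (𝕜 := ℝ)).const_mul (8 * K + 1)
    have h6 := ENNReal.Tendsto.const_mul (a := (T : ℝ≥0∞))
      ((tendsto_lintegral_one_sub_exp hν hi).add (ENNReal.tendsto_ofReal h5)) (.inr (by simp))
    rwa [ENNReal.ofReal_zero, add_zero, mul_zero] at h6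
  exact nonpos_iff_eq_zero.1 (ge_of_tendsto' hlim fun m => hle _ (by positivity))

lemma HasLevyTriplet.isBVProcess_of_integrableOn [IsProbabilityMeasure P]
    (hX : IsLevyProcess P X) (hT : HasLevyTriplet P X γ 0 ν)
    (hi : IntegrableOn (fun y : ℝ => y) {y | |y| < 1} ν) : IsBVProcess P X := by
  have h1 : ∀ T : ℕ, ∀ᵐ ω ∂P, ¬ Tendsto (fun n => gridVariation T n fun t => X t ω) atTop atTop :=
    fun T => by
      rw [ae_iff]
      simpa using hT.measure_tendsto_gridVariation hX hi T
  filter_upwards [hX.cadlag, ae_all_iff.2 h1] with ω hω hS a b _ _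
  obtain ⟨T, hT⟩ := exists_nat_ge b
  obtain ⟨M, hM⟩ : ∃ M : ℝ, ∃ᶠ n in atTop, gridVariation T n (fun t => X t ω) ≤ M := by
    by_contra! h
    refine hS T (tendsto_atTop.2 fun M => ?_)
    filter_upwards [h M] with n hn using hn.le
  refine ne_top_of_le_ne_top (eVariationOn_ne_top_of_frequently (fun t => (hω t).1) T hM)
    (eVariationOn.mono _ ?_)
  rintro x ⟨-, -, hx⟩
  exact ⟨zero_le, hx.trans hT⟩

/-- A Lévy process without Gaussian part has paths of bounded variation if and only if its small
jumps are summable. -/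
theorem isBVProcess_iff [IsProbabilityMeasure P] (hX : IsLevyProcess P X)
    (hT : HasLevyTriplet P X γ 0 ν) :
    IsBVProcess P X ↔ IntegrableOn (fun y : ℝ => y) {y | |y| < 1} ν :=
  ⟨hT.integrableOn_of_isBVProcess hX, hT.isBVProcess_of_integrableOn hX⟩

end

end ZoomingIn

open ZoomingIn in
theorem theorem4p2 {Ω : Type*} [MeasurableSpace Ω] (P : Measure Ω) [IsProbabilityMeasure P]
    (X : ℝ≥0 → Ω → ℝ) (hX : IsLevyProcess P X)
    (γ σ : ℝ) (ν : Measure ℝ) (hT : HasLevyTriplet P X γ σ ν) :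
    -- (i) Brownian motion
    ((∀ σhat : ℝ, 0 < σhat →
        (IsAttractedTo (levyExponent γ σ ν) (levyExponent 0 σhat 0) ↔
          RegVaryingAtZero 0 (truncVar σ ν)) ∧
        (∀ a : ℝ → ℝ, IsScaling a →
          (ZoomsInTo (levyExponent γ σ ν) (levyExponent 0 σhat 0) a ↔
            RegVaryingAtZero 0 (truncVar σ ν) ∧
            (fun ε => a ε ^ 2 / truncVar σ ν (a ε)) ~[𝓝[>] 0] (fun ε => ε / σhat ^ 2)))) ∧
      (RegVaryingAtZero 0 (truncVar σ ν) ↔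
        (∀ᶠ x in 𝓝[>] 0, 0 < truncVar σ ν x) ∧
        Tendsto (fun x => x ^ 2 * tail ν x / truncVar σ ν x) (𝓝[>] 0) (𝓝 0))) ∧
    -- (ii) linear drift
    (∀ γhat : ℝ, γhat ≠ 0 →
      (IsAttractedTo (levyExponent γ σ ν) (levyExponent γhat 0 0) ↔
        σ = 0 ∧ (∀ᶠ x in 𝓝[>] 0, 0 < truncMean γ ν x / γhat) ∧
        Tendsto (fun x => x * tail ν x / truncMean γ ν x) (𝓝[>] 0) (𝓝 0)) ∧
      (∀ a : ℝ → ℝ, IsScaling a →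
        (ZoomsInTo (levyExponent γ σ ν) (levyExponent γhat 0 0) a ↔
          (σ = 0 ∧ (∀ᶠ x in 𝓝[>] 0, 0 < truncMean γ ν x / γhat) ∧
            Tendsto (fun x => x * tail ν x / truncMean γ ν x) (𝓝[>] 0) (𝓝 0)) ∧
          (fun ε => a ε / truncMean γ ν (a ε)) ~[𝓝[>] 0] (fun ε => ε / γhat)))) ∧
    -- (iii) strictly stable process
    (∀ α cpos cneg γhat : ℝ, IsStrictlyStableParam α cpos cneg γhat →
      (IsAttractedTo (levyExponent γ σ ν) (levyExponent γhat 0 (stableLevyMeasure α cpos cneg)) ↔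
        StableConditions P X γ σ ν α cpos cneg γhat) ∧
      (∀ a : ℝ → ℝ, IsScaling a →
        (ZoomsInTo (levyExponent γ σ ν)
            (levyExponent γhat 0 (stableLevyMeasure α cpos cneg)) a ↔
          StableConditions P X γ σ ν α cpos cneg γhat ∧
          (0 < cpos → (fun ε => tailPos ν (a ε)) ~[𝓝[>] 0] (fun ε => ε⁻¹ * (cpos / α))) ∧
          (0 < cneg → (fun ε => tailNeg ν (a ε)) ~[𝓝[>] 0] (fun ε => ε⁻¹ * (cneg / α)))))) := by
  have hν := hT.levyMeasure
  refine ⟨⟨fun σhat hσ => attraction_gaussian hν hσ, regVaryingAtZero_truncVar_iff hν⟩,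
    fun γhat hγ => attraction_drift hν hγ, fun α cpos cneg γhat hs => ?_⟩
  exact attraction_stable hν hs fun hσ => isBVProcess_iff hX (hσ ▸ hT)
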